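/- Let $n\ge 2$ and let $f,g$ be positive smooth functions on $\mathbb S^{n-1}$. Let $M_0=X_0(\mathbb S^{n-1})$ be a smooth, closed, uniformly convex hypersurface in $\mathbb R^n$ (all principal curvatures positive), given by a smooth embedding $X_0$ and containing the origin in its interior. For $T\in(0,\infty]$ let $X:\mathbb S^{n-1}\times[0,T)\to\mathbb R^n$ be a smooth solution of $$\frac{\partial X}{\partial t}(x,t)=-\frac{f(\nu)}{g\big(X/|X|\big)}\,|X|^n\,\mathcal K\,\nu+X,\qquad X(\cdot,0)=X_0,$$ where $\nu$ and $\mathcal K$ are the unit outer normal and the Gauss curvature of $M_t=X(\mathbb S^{n-1},t)$ at $X(x,t)$. Assume that for every $t\in[0,T)$ the map $X(\cdot,t)$ is a smooth embedding and $M_t$ is the boundary of a strictly convex body with the origin in its interior. Let $\kappa_1(x,t),\dots,\kappa_{n-1}(x,t)$ be the principal curvatures of $M_t$ at $X(x,t)$, and let $h(x,t)=\max_{y\in M_t}\langle y,x\rangle$ be the support function of $M_t$. (i) Suppose in addition that $$\int_{\mathbb S^{n-1}}f=\int_{\mathbb S^{n-1}}g>\int_{\omega}f+\int_{\omega^*}g$$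 for every compact, spherically convex $\omega\subset\mathbb S^{n-1}$. Here $\omega^*=\{v\in\mathbb S^{n-1}:\langle u,v\rangle\le 0\ \text{for all } u\in\omega\}$, and $\omega$ is called spherically convex if it is nonempty and the cone $\{tu:t\ge0,\,u\in\omega\}$ is convex and not all of $\mathbb R^n$. Then there is a constant $C>0$ depending only on $n$, $f$, $g$ and $M_0$ (in particular not on $T$, on $X_0$ or on the solution) such that $$\kappa_i(x,t)\ge C\qquad\text{for all }(x,t)\in\mathbb S^{n-1}\times[0,T),\ i=1,\dots,n-1 .$$ (ii) Without the additional condition of (i): for all $C_0,\kappa_0>0$ there is a constant $C>0$ depending only on $n,f,g,C_0,\kappa_0$ such that, for every $M_0$ and every solution as above for which all principal curvatures of $M_0$ are at least $\kappa_0$ and $1/C_0\le h\le C_0$ on $\mathbb S^{n-1}\times[0,T)$, one has $\kappa_i(x,t)\ge C$ for all $(x,t)\in\mathbb S^{n-1}\times[0,T)$ and all $i$. -/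

import Mathlib

open Set Filter Topology MeasureTheory
open scoped Manifold ContDiff RealInnerProductSpace

noncomputable section

namespace GaussFlow

/-- Euclidean space of dimension `n = d + 1`. -/
abbrev Euc (d : ℕ) : Type := EuclideanSpace ℝ (Fin (d + 1))

/-- The unit sphere of dimension `d = n - 1` in Euclidean space of dimension `n = d + 1`,
with its standard smooth structure. -/
abbrev Sph (d : ℕ) : Type := Metric.sphere (0 : Euc d) 1

instance instNonemptySph (d : ℕ) : Nonempty (Sph d) :=
  ⟨⟨EuclideanSpace.single 0 1, by simp⟩⟩

/-- Spherical Lebesgue measure. -/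
def sphMeasure (d : ℕ) : Measure (Sph d) := (volume : Measure (Euc d)).toSphere

open Classical in
/-- The direction `y / |y|` of a nonzero vector `y` (an arbitrary direction for `y = 0`). -/
def direction {d : ℕ} (y : Euc d) : Sph d :=
  if hy : y ≠ 0 then
    ⟨‖y‖⁻¹ • y, by simp [norm_smul, hy]⟩
  else Classical.arbitrary (Sph d)

/-! ### The condition relating the two densities -/

/-- The polar set of a set of directions. -/
def polarSet {d : ℕ} (W : Set (Sph d)) : Set (Sph d) :=
  {v | ∀ u ∈ W, ⟪(u : Euc d), (v : Euc d)⟫ ≤ 0}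

/-- The cone generated by a set of directions. -/
def coneOf {d : ℕ} (W : Set (Sph d)) : Set (Euc d) :=
  {y | ∃ t : ℝ, 0 ≤ t ∧ ∃ u ∈ W, y = t • (u : Euc d)}

/-- A set of directions is spherically convex if it is nonempty and generates a proper convex
cone; in particular it lies in a closed hemisphere. -/
def SphericallyConvex {d : ℕ} (W : Set (Sph d)) : Prop :=
  W.Nonempty ∧ Convex ℝ (coneOf W) ∧ coneOf W ≠ univ

/-- The measures with densities `f` and `g` are Aleksandrov related. -/
def AleksandrovRelated {d : ℕ} (f g : Sph d → ℝ) : Prop :=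
  ∫ x, f x ∂(sphMeasure d) = ∫ u, g u ∂(sphMeasure d) ∧
  ∀ W : Set (Sph d), IsCompact W → SphericallyConvex W →
    ∫ x in W, f x ∂(sphMeasure d) + ∫ u in polarSet W, g u ∂(sphMeasure d)
      < ∫ u, g u ∂(sphMeasure d)

/-! ### Closed convex hypersurfaces and their curvature -/

/-- The support function `h(x) = max_{y ∈ M} ⟨y, x⟩` of a compact hypersurface `M`. -/
def supportFn {d : ℕ} (M : Set (Euc d)) (x : Sph d) : ℝ :=
  sSup ((fun y : Euc d => ⟪y, (x : Euc d)⟫) '' M)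

/-- The unit outer normal at `y ∈ M` of a closed convex hypersurface `M`: the unit vector `v`
with `⟨z - y, v⟩ ≤ 0` for all `z ∈ M`. It is unique if `M` is smooth. -/
def outerNormal {d : ℕ} (M : Set (Euc d)) (y : Euc d) : Sph d :=
  Classical.epsilon fun v : Sph d => ∀ z ∈ M, ⟪z - y, (v : Euc d)⟫ ≤ 0

/-- The Gauss map `x ↦ ν(Y x)` of the closed convex hypersurface parametrized by `Y`. -/
def gaussMap {d : ℕ} (Y : Sph d → Euc d) (x : Sph d) : Sph d :=
  outerNormal (range Y) (Y x)

/-- Partial derivative at `x` of a map from the sphere to Euclidean space with respect to the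
`i`-th coordinate of the standard chart at `x`. -/
def partialAt {d : ℕ} (Y : Sph d → Euc d) (x : Sph d) (i : Fin d) : Euc d :=
  mvfderiv (𝓡 d) Y x
    (show TangentSpace (𝓡 d) x from (EuclideanSpace.single i 1 : EuclideanSpace ℝ (Fin d)))

/-- First fundamental form `⟨∂ᵢ Y, ∂ⱼ Y⟩`. -/
def firstForm {d : ℕ} (Y : Sph d → Euc d) (x : Sph d) : Matrix (Fin d) (Fin d) ℝ :=
  Matrix.of fun i j => ⟪partialAt Y x i, partialAt Y x j⟫

/-- Second fundamental form `⟨∂ᵢ ν, ∂ⱼ Y⟩` with respect to the outer normal; it is positive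
for round spheres. -/
def secondForm {d : ℕ} (Y : Sph d → Euc d) (x : Sph d) : Matrix (Fin d) (Fin d) ℝ :=
  Matrix.of fun i j =>
    ⟪partialAt (fun z => (gaussMap Y z : Euc d)) x i, partialAt Y x j⟫

/-- The Weingarten matrix. -/
def weingarten {d : ℕ} (Y : Sph d → Euc d) (x : Sph d) : Matrix (Fin d) (Fin d) ℝ :=
  (firstForm Y x)⁻¹ * secondForm Y x

/-- Gauss curvature at `Y x`. -/
def gaussCurvature {d : ℕ} (Y : Sph d → Euc d) (x : Sph d) : ℝ :=
  (weingarten Y x).det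

/-- `κ` is one of the principal curvatures at `Y x`. -/
def IsPrincipalCurvature {d : ℕ} (Y : Sph d → Euc d) (x : Sph d) (κ : ℝ) : Prop :=
  Module.End.HasEigenvalue (Matrix.toLin' (weingarten Y x)) κ

/-- `Y` is a smooth embedding of the sphere onto a closed hypersurface which is the boundary of a
strictly convex body containing the origin in its interior. -/
structure IsStrictlyConvexEmbedding {d : ℕ} (Y : Sph d → Euc d) : Prop where
  smooth : ContMDiff (𝓡 d) 𝓘(ℝ, Euc d) ∞ Y
  injective : Function.Injective Y
  immersion : ∀ x, Function.Injective (mvfderiv (𝓡 d) Y x)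
  frontier_eq : frontier (convexHull ℝ (range Y)) = range Y
  strictConvex : StrictConvex ℝ (convexHull ℝ (range Y))
  encloses : (0 : Euc d) ∈ interior (convexHull ℝ (range Y))

/-- Uniform convexity: moreover all principal curvatures are positive. -/
structure IsUniformlyConvexEmbedding {d : ℕ} (Y : Sph d → Euc d) : Prop extends
    IsStrictlyConvexEmbedding Y where
  curvature_pos : ∀ x κ, IsPrincipalCurvature Y x κ → 0 < κ

/-! ### The flow -/

/-- The time interval `[0, T)`, where `T` may be `∞`. -/
def timeInterval (T : EReal) : Set ℝ := {t | 0 ≤ t ∧ (t : EReal) < T}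

/-- `X` is a smooth solution on `[0, T)`, starting at `X₀`, of
`∂X/∂t = - f(ν) / g(X/|X|) |X|^n K ν + X` with `n = d + 1`, such that every hypersurface
`M_t = X(S, t)` is strictly convex and encloses the origin. -/
structure IsConvexSolution {d : ℕ} (f g : Sph d → ℝ) (X₀ : Sph d → Euc d) (T : EReal)
    (X : Sph d → ℝ → Euc d) : Prop where
  smooth : ContMDiffOn ((𝓡 d).prod 𝓘(ℝ, ℝ)) 𝓘(ℝ, Euc d) ∞
    (fun p : Sph d × ℝ => X p.1 p.2) (univ ×ˢ timeInterval T)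
  initial : ∀ x, X x 0 = X₀ x
  convex : ∀ t ∈ timeInterval T, IsStrictlyConvexEmbedding (fun x => X x t)
  evolution : ∀ x, ∀ t ∈ timeInterval T,
    HasDerivWithinAt (fun s => X x s)
      (-(f (gaussMap (fun z => X z t) x) / g (direction (X x t)) * ‖X x t‖ ^ (d + 1)
          * gaussCurvature (fun z => X z t) x) • (gaussMap (fun z => X z t) x : Euc d)
        + X x t)
      (timeInterval T) t

end GaussFlow

end

/-! The curvature estimate is a maximum principle for the support function. Let H(q,t) be the
support function of M_t, extended to be homogeneous of degree one in q. While the curvature is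
positive, the gradient of H at a normal q is the point of M_t with that normal, and the eigenvalues
of D²H on the orthogonal complement of q are the principal radii. A lower curvature bound is
therefore an upper bound for ⟨D²H w, w⟩ over unit tangent vectors w. The flow becomes the scalar
equation (H - ∂_t H) det(D²H + q ⊗ q) = f(q) |∇H|^n / g(∇H/|∇H|), recorded in `SupportSolution`; the
rank one term fills the kernel of D²H.

Given two-sided bounds on H, consider log ∂_w∂_w H - A log H + B|∇H|² (`testFn`) at a maximum over
unit tangent vectors, normals and times. The extremality conditions and the differentiated logarithm
of the equation combine so that the third order terms cancel or have a sign
(`two_mul_sum_le_of_max`). The gradient term leaves B times the sum of the radii, and this beats the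
contribution of g, which is linear in the largest radius with a coefficient independent of B. The
determinant itself is never differentiated: Hadamard's inequality in a sheared frame bounds it by a
product of diagonal entries, with equality at the base point, and two functions touching there have
equal first and ordered second derivatives (`det_le_prod_sheared`, `HasJet.compare`). The outcome is
`exists_spHess_bound`.

The solution is only assumed strictly convex, so H need not be smooth a priori. The polar dual point
p = ν/⟨X,ν⟩ is smooth regardless of curvature, since it solves an invertible linear system; H is
smooth as soon as p is an immersion, which positive curvature ensures. A continuity argument in time
closes the loop (`GaussFlow.exists_curvatureBound`): a bound c persists for a short time as c/2, on
that time the equation is available, and the a priori estimate restores c. This proves (ii).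

For (i) the bounds on H must be produced. With h and r the support and radial functions, ∫ g log r
is conserved and ∫ f log h does not increase; both follow by pulling f back by the Gauss map and g
back by radial projection (`hasDerivAt_logIntegral`, `logIntegral_le`). By compactness the
Aleksandrov condition holds with a uniform gap ε (`exists_gap`). Summing the gap over the superlevel
sets of the logarithms shows that a large ratio max r / min h would make ∫ f log h - ∫ g log r large
(`exists_oscillation_bound`), and the conserved integral fixes the scale. Since the initial data
enter only through quantities determined by the image M₀, so does the constant. -/

noncomputable section

namespace GaussFlow

variable {d : ℕ}

/-! ### Homogeneous extensions of maps on the sphere -/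

section Extensions

variable {F : Type*} [NormedAddCommGroup F] [NormedSpace ℝ F]

/-- The degree zero homogeneous extension of a map on the sphere. -/
def radialExt (Y : Sph d → F) (y : Euc d) : F := Y (direction y)

/-- The degree one homogeneous extension of a map on the sphere. -/
def conicExt (Y : Sph d → F) (y : Euc d) : F := ‖y‖ • Y (direction y)

lemma norm_sph (x : Sph d) : ‖(x : Euc d)‖ = 1 := by simp

lemma sph_ne_zero (x : Sph d) : (x : Euc d) ≠ 0 := by
  intro h; simpa [h] using norm_sph x

lemma inner_sph_self (x : Sph d) : ⟪(x : Euc d), (x : Euc d)⟫ = 1 := by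
  rw [real_inner_self_eq_norm_sq, norm_sph]; norm_num

lemma coe_direction {y : Euc d} (hy : y ≠ 0) : (direction y : Euc d) = ‖y‖⁻¹ • y := by
  simp [direction, hy]

lemma direction_smul {c : ℝ} (hc : 0 < c) (y : Euc d) (hy : y ≠ 0) :
    direction (c • y) = direction y := by
  apply Subtype.ext
  rw [coe_direction hy, coe_direction (smul_ne_zero hc.ne' hy), norm_smul, smul_smul,
    Real.norm_eq_abs, abs_of_pos hc]
  congr 1
  have := norm_ne_zero_iff.2 hy
  field_simp

@[simp] lemma direction_coe (x : Sph d) : direction (x : Euc d) = x := by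
  apply Subtype.ext
  rw [coe_direction (sph_ne_zero x), norm_sph]; simp

lemma norm_smul_direction {y : Euc d} (hy : y ≠ 0) : ‖y‖ • (direction y : Euc d) = y := by
  rw [coe_direction hy, smul_smul, mul_inv_cancel₀ (norm_ne_zero_iff.2 hy), one_smul]

lemma direction_smul_coe {c : ℝ} (hc : 0 < c) (x : Sph d) : direction (c • (x : Euc d)) = x := by
  rw [direction_smul hc _ (sph_ne_zero x), direction_coe]

lemma finrank_euc_fact (d : ℕ) : Fact (Module.finrank ℝ (Euc d) = d + 1) := ⟨by simp⟩

lemma contMDiffAt_direction {y : Euc d} (hy : y ≠ 0) :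
    ContMDiffAt 𝓘(ℝ, Euc d) (𝓡 d) ∞ (direction : Euc d → Sph d) y := by
  have := finrank_euc_fact d
  let U : TopologicalSpace.Opens (Euc d) := ⟨{0}ᶜ, isOpen_compl_singleton⟩
  have hU : ∀ u : U, (u : Euc d) ≠ 0 := fun u => u.2
  have h1 : ContMDiff 𝓘(ℝ, Euc d) 𝓘(ℝ, Euc d) ∞
      (fun u : U => ‖(u : Euc d)‖⁻¹ • (u : Euc d)) := by
    intro u
    have : ContDiffAt ℝ ∞ (fun y : Euc d => ‖y‖⁻¹ • y) (u : Euc d) :=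
      ((contDiffAt_norm ℝ (hU u)).inv (norm_ne_zero_iff.2 (hU u))).smul contDiffAt_id
    exact contMDiffAt_subtype_iff.2 this.contMDiffAt
  have h2 : ∀ u : U, ‖(u : Euc d)‖⁻¹ • (u : Euc d) ∈ Metric.sphere (0 : Euc d) 1 := by
    intro u
    simp [norm_smul, hU u]
  have h3 := h1.codRestrict_sphere (n := d) h2
  have h4 : (fun u : U => (direction (u : Euc d) : Sph d)) = Set.codRestrict _ _ h2 := by
    funext u
    apply Subtype.ext
    simp [coe_direction (hU u)]
  rw [← h4] at h3
  exact contMDiffAt_subtype_iff.1 (h3 ⟨y, hy⟩)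

lemma contDiffOn_radialExt_family {X : Sph d → ℝ → F} {I : Set ℝ}
    (hX : ContMDiffOn ((𝓡 d).prod 𝓘(ℝ, ℝ)) 𝓘(ℝ, F) ∞
      (fun p : Sph d × ℝ => X p.1 p.2) (univ ×ˢ I)) :
    ContDiffOn ℝ ∞ (fun p : Euc d × ℝ => X (direction p.1) p.2) ({0}ᶜ ×ˢ I) := by
  rw [← contMDiffOn_iff_contDiffOn]
  have h1 : ContMDiffOn 𝓘(ℝ, Euc d × ℝ) ((𝓡 d).prod 𝓘(ℝ, ℝ)) ∞
      (fun p : Euc d × ℝ => ((direction p.1, p.2) : Sph d × ℝ)) ({0}ᶜ ×ˢ I) := by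
    intro p hp
    apply ContMDiffWithinAt.prodMk
    · exact ((contMDiffAt_direction hp.1).comp p
        (contDiff_fst.contMDiff p)).contMDiffWithinAt
    · exact (contDiff_snd.contMDiff p).contMDiffWithinAt
  exact hX.comp h1 (fun p hp => ⟨mem_univ _, hp.2⟩)

lemma contDiffOn_radialExt {Y : Sph d → F} (hY : ContMDiff (𝓡 d) 𝓘(ℝ, F) ∞ Y) :
    ContDiffOn ℝ ∞ (radialExt Y) {0}ᶜ := by
  rw [← contMDiffOn_iff_contDiffOn]
  intro y hy
  exact ((hY _).comp y (contMDiffAt_direction hy)).contMDiffWithinAt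

lemma contDiffAt_radialExt {Y : Sph d → F} (hY : ContMDiff (𝓡 d) 𝓘(ℝ, F) ∞ Y) {y : Euc d}
    (hy : y ≠ 0) : ContDiffAt ℝ ∞ (radialExt Y) y :=
  (contDiffOn_radialExt hY).contDiffAt (isOpen_compl_singleton.mem_nhds hy)

/-- The differential of the inclusion of the sphere. -/
def sphIncl (x : Sph d) : EuclideanSpace ℝ (Fin d) →L[ℝ] Euc d :=
  (show EuclideanSpace ℝ (Fin d) →L[ℝ] Euc d from
    mvfderiv (𝓡 d) ((↑) : Sph d → Euc d) x)

lemma sphIncl_injective (x : Sph d) : Function.Injective (sphIncl x) :=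
  have := finrank_euc_fact d
  injective_mvfderiv_subtypeVal_sphere x

lemma range_sphIncl (x : Sph d) : (sphIncl x).range = (ℝ ∙ (x : Euc d))ᗮ :=
  have := finrank_euc_fact d
  range_mvfderiv_subtypeVal x

lemma inner_sphIncl (x : Sph d) (v : EuclideanSpace ℝ (Fin d)) :
    ⟪(x : Euc d), sphIncl x v⟫ = 0 := by
  have : sphIncl x v ∈ (ℝ ∙ (x : Euc d))ᗮ := by
    rw [← range_sphIncl]; exact ⟨v, rfl⟩
  exact Submodule.mem_orthogonal_singleton_iff_inner_right.1 this

lemma exists_sphIncl (x : Sph d) {w : Euc d} (hw : ⟪(x : Euc d), w⟫ = 0) :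
    ∃ v, sphIncl x v = w := by
  have : w ∈ (sphIncl x).range := by
    rw [range_sphIncl]; exact Submodule.mem_orthogonal_singleton_iff_inner_right.2 hw
  exact this

/-- Any map on the sphere factors as its radial extension after the inclusion, so the chain rule
trades manifold derivatives for Fréchet derivatives along tangent vectors. The geometry below is
computed with the latter. -/
lemma mvfderiv_eq_fderiv_radialExt {Y : Sph d → F} {x : Sph d}
    (hY : DifferentiableAt ℝ (radialExt Y) (x : Euc d)) (v : EuclideanSpace ℝ (Fin d)) :
    mvfderiv (𝓡 d) Y x v = fderiv ℝ (radialExt Y) (x : Euc d) (sphIncl x v) := by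
  have := finrank_euc_fact d
  have h1 : Y = radialExt Y ∘ ((↑) : Sph d → Euc d) := by
    funext z; simp [radialExt]
  have h2 : MDifferentiableAt 𝓘(ℝ, Euc d) 𝓘(ℝ, F) (radialExt Y) (x : Euc d) :=
    hY.mdifferentiableAt
  have h3 : MDifferentiableAt (𝓡 d) 𝓘(ℝ, Euc d) ((↑) : Sph d → Euc d) x :=
    ((contMDiff_coe_sphere (n := d) (m := 1)) x).mdifferentiableAt one_ne_zero
  conv_lhs => rw [h1]
  refine (mfderiv_comp_apply (I := 𝓡 d) (I' := 𝓘(ℝ, Euc d)) (I'' := 𝓘(ℝ, F)) x h2 h3 v).trans ?_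
  simp only [mvfderiv, mfderiv_eq_fderiv, sphIncl]
  rfl

lemma partialAt_eq {Y : Sph d → Euc d} {x : Sph d}
    (hY : DifferentiableAt ℝ (radialExt Y) (x : Euc d)) (i : Fin d) :
    partialAt Y x i =
      fderiv ℝ (radialExt Y) (x : Euc d) (sphIncl x (EuclideanSpace.single i 1)) :=
  mvfderiv_eq_fderiv_radialExt hY _

/-- The radial direction lies in the kernel of the differential of a radial extension. -/
lemma fderiv_radialExt_self (Y : Sph d → F) {y : Euc d} (hy : y ≠ 0)
    (hY : DifferentiableAt ℝ (radialExt Y) y) : fderiv ℝ (radialExt Y) y y = 0 := by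
  have h1 : HasDerivAt (fun s : ℝ => radialExt Y (s • y)) (fderiv ℝ (radialExt Y) y y) 1 := by
    have h2 : HasDerivAt (fun s : ℝ => s • y) y 1 := by
      simpa using (hasDerivAt_id (1 : ℝ)).smul_const y
    have h3 : HasFDerivAt (radialExt Y) (fderiv ℝ (radialExt Y) y) ((1 : ℝ) • y) := by
      simpa using hY.hasFDerivAt
    exact h3.comp_hasDerivAt 1 h2
  have h4 : (fun s : ℝ => radialExt Y (s • y)) =ᶠ[𝓝 1] fun _ => radialExt Y y := by
    filter_upwards [lt_mem_nhds (zero_lt_one (α := ℝ))] with s hs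
    simp [radialExt, direction_smul hs y hy]
  exact h1.unique ((hasDerivAt_const _ _).congr_of_eventuallyEq h4)

lemma conicExt_eq (Y : Sph d → F) : conicExt Y = fun y => ‖y‖ • radialExt Y y := rfl

lemma conicExt_smul (Y : Sph d → F) {c : ℝ} (hc : 0 < c) (y : Euc d) :
    conicExt Y (c • y) = c • conicExt Y y := by
  by_cases hy : y = 0
  · simp [conicExt, hy]
  · simp [conicExt, direction_smul hc y hy, norm_smul, abs_of_pos hc, mul_smul]

@[simp] lemma conicExt_coe (Y : Sph d → F) (x : Sph d) : conicExt Y (x : Euc d) = Y x := by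
  simp [conicExt]

omit [NormedAddCommGroup F] [NormedSpace ℝ F] in
@[simp] lemma radialExt_coe (Y : Sph d → F) (x : Sph d) : radialExt Y (x : Euc d) = Y x := by
  simp [radialExt]

lemma differentiableAt_conicExt {Y : Sph d → F} {y : Euc d} (hy : y ≠ 0)
    (hY : DifferentiableAt ℝ (radialExt Y) y) : DifferentiableAt ℝ (conicExt Y) y := by
  rw [conicExt_eq]
  exact (((contDiffAt_norm ℝ hy).differentiableAt one_ne_zero)).smul hY

lemma fderiv_norm_sph (x : Sph d) (v : Euc d) :
    fderiv ℝ (fun y : Euc d => ‖y‖) (x : Euc d) v = ⟪(x : Euc d), v⟫ := by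
  have h : HasFDerivAt (fun y : Euc d => Real.sqrt (‖y‖ ^ 2))
      ((1 / (2 * Real.sqrt (‖(x : Euc d)‖ ^ 2))) • (2 • innerSL ℝ (x : Euc d))) (x : Euc d) :=
    HasFDerivAt.sqrt (hasStrictFDerivAt_norm_sq (x : Euc d)).hasFDerivAt
      (by rw [norm_sph]; norm_num)
  have h2 : (fun y : Euc d => Real.sqrt (‖y‖ ^ 2)) = fun y => ‖y‖ := by
    funext y; exact Real.sqrt_sq (norm_nonneg y)
  rw [h2] at h
  rw [h.fderiv]
  simp

/-- On the sphere, the differential of the conic extension splits into a tangential and a radial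
part. -/
lemma fderiv_conicExt {Y : Sph d → F} {x : Sph d}
    (hY : DifferentiableAt ℝ (radialExt Y) (x : Euc d)) (v : Euc d) :
    fderiv ℝ (conicExt Y) (x : Euc d) v =
      fderiv ℝ (radialExt Y) (x : Euc d) v + ⟪(x : Euc d), v⟫ • Y x := by
  have h1 : DifferentiableAt ℝ (fun y : Euc d => ‖y‖) (x : Euc d) :=
    (contDiffAt_norm ℝ (sph_ne_zero x)).differentiableAt one_ne_zero
  have h2 : HasFDerivAt (conicExt Y) _ (x : Euc d) := h1.hasFDerivAt.smul hY.hasFDerivAt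
  rw [h2.fderiv]
  simp [fderiv_norm_sph]

/-- The differential of a conic extension is homogeneous of degree zero. -/
lemma fderiv_conicExt_smul (Y : Sph d → F) {c : ℝ} (hc : 0 < c) (y : Euc d) :
    fderiv ℝ (conicExt Y) (c • y) = fderiv ℝ (conicExt Y) y := by
  have h : conicExt Y = fun z => c • conicExt Y (c⁻¹ • z) := by
    funext z
    rw [← conicExt_smul Y hc, smul_smul, mul_inv_cancel₀ hc.ne', one_smul]
  conv_lhs => rw [h]
  rw [show (fun z => c • conicExt Y (c⁻¹ • z)) = c • (fun z => conicExt Y (c⁻¹ • z)) from rfl,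
    fderiv_const_smul_field, Pi.smul_apply, fderiv_comp_smul, smul_smul, smul_smul, mul_inv_cancel₀ hc.ne',
    inv_mul_cancel₀ hc.ne', one_smul, one_smul]

end Extensions

/-! ### Supporting normals and polar dual points -/

/-- The point `ν / ⟨Y, ν⟩` of the polar dual hypersurface. -/
def dualPt (Y : Sph d → Euc d) (x : Sph d) : Euc d :=
  (⟪Y x, (gaussMap Y x : Euc d)⟫)⁻¹ • (gaussMap Y x : Euc d)

namespace IsStrictlyConvexEmbedding

variable {Y : Sph d → Euc d} (hY : IsStrictlyConvexEmbedding Y)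
include hY

lemma differentiableAt {y : Euc d} (hy : y ≠ 0) : DifferentiableAt ℝ (radialExt Y) y :=
  (contDiffAt_radialExt hY.smooth hy).differentiableAt (by simp)

/-- Hahn–Banach separates a boundary point from the open interior of the hull, and the inequality
passes to the whole hull because a convex body with interior points lies in the closure of its
interior. -/
lemma exists_normal (x : Sph d) : ∃ v : Sph d, ∀ z ∈ range Y, ⟪z - Y x, (v : Euc d)⟫ ≤ 0 := by
  have hfr : Y x ∈ frontier (convexHull ℝ (range Y)) := by rw [hY.frontier_eq]; exact ⟨x, rfl⟩
  have hni : Y x ∉ interior (convexHull ℝ (range Y)) := fun h => hfr.2 h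
  obtain ⟨φ, hφ⟩ := geometric_hahn_banach_open_point (convex_convexHull ℝ (range Y)).interior
    isOpen_interior hni
  have hcl : ∀ z ∈ convexHull ℝ (range Y), φ z ≤ φ (Y x) := by
    intro z hz
    have h1 : z ∈ closure (interior (convexHull ℝ (range Y))) := by
      rw [(convex_convexHull ℝ (range Y)).closure_interior_eq_closure_of_nonempty_interior
        ⟨0, hY.encloses⟩]
      exact subset_closure hz
    exact closure_minimal (fun a ha => (hφ a ha).le)
      (isClosed_le φ.continuous continuous_const) h1
  set u := (InnerProductSpace.toDual ℝ (Euc d)).symm φ with hu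
  have hφu : ∀ z, φ z = ⟪z, u⟫ := by
    intro z
    rw [real_inner_comm, hu, InnerProductSpace.toDual_symm_apply]
  have hu0 : u ≠ 0 := by
    intro h0
    have := hφ 0 hY.encloses
    rw [hφu, hφu, h0] at this
    simp at this
  refine ⟨⟨‖u‖⁻¹ • u, by simp [norm_smul, hu0]⟩, fun z hz => ?_⟩
  have h1 := hcl z (subset_convexHull ℝ _ hz)
  rw [hφu, hφu] at h1
  rw [inner_smul_right, inner_sub_left]
  exact mul_nonpos_of_nonneg_of_nonpos (by positivity) (by linarith)

lemma normal_spec (x z : Sph d) : ⟪Y z - Y x, (gaussMap Y x : Euc d)⟫ ≤ 0 :=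
  Classical.epsilon_spec (hY.exists_normal x) (Y z) ⟨z, rfl⟩

/-- A small ball about the origin lies in the hull, so the supporting half space contains a positive
multiple of its own normal. -/
lemma inner_normal_pos {v : Sph d} {x : Sph d} (hv : ∀ z, ⟪Y z - Y x, (v : Euc d)⟫ ≤ 0) :
    0 < ⟪Y x, (v : Euc d)⟫ := by
  obtain ⟨ε, hε, hball⟩ := Metric.isOpen_iff.1 isOpen_interior _ hY.encloses
  have h1 : (ε / 2) • (v : Euc d) ∈ convexHull ℝ (range Y) := by
    apply interior_subset (hball _)
    rw [mem_ball_zero_iff, norm_smul, norm_sph, Real.norm_eq_abs, abs_of_pos (by positivity)]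
    linarith
  have h2 : convexHull ℝ (range Y) ⊆ {z | ⟪(v : Euc d), z⟫ ≤ ⟪Y x, (v : Euc d)⟫} := by
    apply convexHull_min
    · rintro _ ⟨z, rfl⟩
      have := hv z
      rw [inner_sub_left] at this
      simp only [mem_ofPred_eq]
      rw [real_inner_comm]; linarith
    · exact convex_halfSpace_le (innerₛₗ ℝ (v : Euc d)).isLinear _
  have h3 := h2 h1
  simp only [mem_ofPred_eq, inner_smul_right, inner_sph_self] at h3
  linarith

lemma height_pos (x : Sph d) : 0 < ⟪Y x, (gaussMap Y x : Euc d)⟫ :=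
  hY.inner_normal_pos (hY.normal_spec x)

/-- The height in a supporting direction is maximal at the point considered, so its differential
vanishes there. -/
lemma inner_fderiv_normal {v : Sph d} {y : Euc d} (hy : y ≠ 0)
    (hv : ∀ z, ⟪Y z - Y (direction y), (v : Euc d)⟫ ≤ 0) (w : Euc d) :
    ⟪fderiv ℝ (radialExt Y) y w, (v : Euc d)⟫ = 0 := by
  have h1 : IsLocalMax (fun z => ⟪radialExt Y z, (v : Euc d)⟫) y := by
    refine Filter.Eventually.of_forall fun z => ?_
    have := hv (direction z)
    rw [inner_sub_left] at this
    simp only [radialExt]; linarith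
  have h2 := (hY.differentiableAt hy).hasFDerivAt.inner ℝ (hasFDerivAt_const (v : Euc d) y)
  have h3 := h1.hasFDerivAt_eq_zero h2
  have h4 := congrArg (fun L => L w) h3
  simpa using h4

lemma fderiv_eq_zero {x : Sph d} {w : Euc d} (hw : ⟪(x : Euc d), w⟫ = 0)
    (h : fderiv ℝ (radialExt Y) (x : Euc d) w = 0) : w = 0 := by
  obtain ⟨v, rfl⟩ := exists_sphIncl x hw
  rw [← mvfderiv_eq_fderiv_radialExt (hY.differentiableAt (sph_ne_zero x))] at h
  have h0 : (v : TangentSpace (𝓡 d) x) = 0 := hY.immersion x (by rw [h]; exact (map_zero _).symm)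
  have : v = 0 := h0
  rw [this, map_zero]

lemma inner_conic_normal {v x : Sph d} (hv : ∀ z, ⟪Y z - Y x, (v : Euc d)⟫ ≤ 0) (w : Euc d) :
    ⟪fderiv ℝ (conicExt Y) (x : Euc d) w, (v : Euc d)⟫ = ⟪(x : Euc d), w⟫ * ⟪Y x, (v : Euc d)⟫ := by
  rw [fderiv_conicExt (hY.differentiableAt (sph_ne_zero x)), inner_add_left,
    hY.inner_fderiv_normal (sph_ne_zero x) (by simpa using hv), zero_add, real_inner_smul_left]

/-- The radial component of a kernel vector is detected by pairing with the normal, since the height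
is positive; what remains is tangential and is killed by the immersion property. Thus the cone over
the hypersurface has an invertible differential whatever the curvature. -/
lemma fderiv_conic_injective (x : Sph d) :
    Function.Injective (fderiv ℝ (conicExt Y) (x : Euc d)) := by
  rw [injective_iff_map_eq_zero]
  intro w hw
  have h1 := hY.inner_conic_normal (hY.normal_spec x) w
  rw [hw, inner_zero_left] at h1
  have h2 : ⟪(x : Euc d), w⟫ = 0 := by
    rcases mul_eq_zero.1 h1.symm with h | h
    · exact h
    · exact absurd h (hY.height_pos x).ne'
  rw [fderiv_conicExt (hY.differentiableAt (sph_ne_zero x)), h2, zero_smul, add_zero] at hw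
  exact hY.fderiv_eq_zero h2 hw

lemma fderiv_conic_injective' {y : Euc d} (hy : y ≠ 0) :
    Function.Injective (fderiv ℝ (conicExt Y) y) := by
  have := hY.fderiv_conic_injective (direction y)
  rwa [← fderiv_conicExt_smul Y (norm_pos_iff.2 hy), norm_smul_direction hy] at this

lemma inner_dualPt_self (x : Sph d) : ⟪Y x, dualPt Y x⟫ = 1 := by
  rw [dualPt, inner_smul_right, inv_mul_cancel₀ (hY.height_pos x).ne']

/-- Read as a linear system for the dual point: the adjoint of the differential of the cone sends it
to `x`. Inverting that operator gives regularity and uniqueness of the dual point without any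
curvature assumption. -/
lemma inner_conic_dualPt (x : Sph d) (w : Euc d) :
    ⟪fderiv ℝ (conicExt Y) (x : Euc d) w, dualPt Y x⟫ = ⟪(x : Euc d), w⟫ := by
  rw [dualPt, inner_smul_right, hY.inner_conic_normal (hY.normal_spec x)]
  have := (hY.height_pos x).ne'
  field_simp

lemma inner_fderiv_dualPt {y : Euc d} (hy : y ≠ 0) (w : Euc d) :
    ⟪fderiv ℝ (radialExt Y) y w, dualPt Y (direction y)⟫ = 0 := by
  rw [dualPt, inner_smul_right, hY.inner_fderiv_normal hy (hY.normal_spec _), mul_zero]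

/-- Every supporting normal, divided by its height, solves the same invertible linear system as the
dual point, hence gives the same point and the same direction. -/
lemma gaussMap_unique {v x : Sph d} (hv : ∀ z, ⟪Y z - Y x, (v : Euc d)⟫ ≤ 0) :
    gaussMap Y x = v := by
  have hpos := hY.inner_normal_pos hv
  have hinj := hY.fderiv_conic_injective x
  have hsurj : Function.Surjective (fderiv ℝ (conicExt Y) (x : Euc d)) :=
    (LinearMap.injective_iff_surjective (f := (fderiv ℝ (conicExt Y) (x : Euc d)).toLinearMap)).1
      hinj
  have h1 : (⟪Y x, (v : Euc d)⟫)⁻¹ • (v : Euc d) = dualPt Y x := by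
    apply ext_inner_left ℝ
    intro z
    obtain ⟨w, rfl⟩ := hsurj z
    rw [hY.inner_conic_dualPt, inner_smul_right, hY.inner_conic_normal hv]
    field_simp
  have h2 : direction ((⟪Y x, (v : Euc d)⟫)⁻¹ • (v : Euc d)) = v :=
    direction_smul_coe (by positivity) v
  have h3 : direction (dualPt Y x) = gaussMap Y x :=
    direction_smul_coe (inv_pos.2 (hY.height_pos x)) _
  rw [← h2, h1, h3]

lemma direction_dualPt (x : Sph d) : direction (dualPt Y x) = gaussMap Y x :=
  direction_smul_coe (inv_pos.2 (hY.height_pos x)) _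

lemma norm_dualPt (x : Sph d) : ‖dualPt Y x‖ = (⟪Y x, (gaussMap Y x : Euc d)⟫)⁻¹ := by
  rw [dualPt, norm_smul, norm_sph, mul_one, Real.norm_eq_abs,
    abs_of_pos (inv_pos.2 (hY.height_pos x))]

lemma dualPt_ne_zero (x : Sph d) : dualPt Y x ≠ 0 := by
  rw [← norm_pos_iff, hY.norm_dualPt]; exact inv_pos.2 (hY.height_pos x)

lemma inner_dualPt_le (x z : Sph d) : ⟪Y x, dualPt Y z⟫ ≤ 1 := by
  have h1 := hY.normal_spec z x
  have h2 := hY.height_pos z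
  rw [inner_sub_left] at h1
  rw [dualPt, inner_smul_right, inv_mul_le_iff₀ h2]
  linarith

/-- If equality held, strict convexity would make the midpoint of the two points an interior point
of the hull at which a linear functional is maximal. The functional would then vanish, although it
equals one at `Y z`. -/
lemma inner_dualPt_lt {x z : Sph d} (hxz : x ≠ z) : ⟪Y x, dualPt Y z⟫ < 1 := by
  refine lt_of_le_of_ne (hY.inner_dualPt_le x z) fun heq => ?_
  have hne : Y x ≠ Y z := fun h => hxz (hY.injective h)
  have hmem : ∀ u, Y u ∈ convexHull ℝ (range Y) := fun u => subset_convexHull ℝ _ ⟨u, rfl⟩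
  have hmid := hY.strictConvex (hmem x) (hmem z) hne (a := 1 / 2) (b := 1 / 2) (by norm_num)
    (by norm_num) (by norm_num)
  have h2 : convexHull ℝ (range Y) ⊆ {y | ⟪dualPt Y z, y⟫ ≤ 1} := by
    apply convexHull_min
    · rintro _ ⟨u, rfl⟩
      simp only [mem_ofPred_eq]
      rw [real_inner_comm]; exact hY.inner_dualPt_le u z
    · exact convex_halfSpace_le (innerₛₗ ℝ (dualPt Y z)).isLinear _
  have h3 : IsLocalMax (fun y => ⟪dualPt Y z, y⟫) ((1 / 2 : ℝ) • Y x + (1 / 2 : ℝ) • Y z) := by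
    filter_upwards [mem_interior_iff_mem_nhds.1 hmid] with y hy
    refine (h2 hy).trans (le_of_eq ?_)
    rw [inner_add_right, inner_smul_right, inner_smul_right, real_inner_comm, heq,
      real_inner_comm, hY.inner_dualPt_self]
    norm_num
  have h4 := h3.hasFDerivAt_eq_zero ((innerSL ℝ (dualPt Y z)).hasFDerivAt)
  have h5 := congrArg (fun L => L (Y z)) h4
  simp only [innerSL_apply_apply, zero_apply] at h5
  rw [real_inner_comm, hY.inner_dualPt_self] at h5
  exact one_ne_zero h5

lemma continuous : Continuous Y := hY.smooth.continuous

lemma ne_zero (x : Sph d) : Y x ≠ 0 := by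
  intro h
  have := hY.inner_dualPt_self x
  simp [h] at this

/-- Every direction is normal to the hypersurface at some point. -/
lemma exists_gaussMap_eq (q : Sph d) : ∃ x, gaussMap Y x = q := by
  obtain ⟨x, -, hx⟩ := isCompact_univ.exists_isMaxOn (univ_nonempty (α := Sph d))
    (f := fun z => ⟪Y z, (q : Euc d)⟫) (by have := hY.continuous; fun_prop)
  refine ⟨x, hY.gaussMap_unique fun z => ?_⟩
  have : ⟪Y z, (q : Euc d)⟫ ≤ ⟪Y x, (q : Euc d)⟫ := hx (mem_univ z)
  rw [inner_sub_left]; linarith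

/-- Every ray from the origin meets the hypersurface. -/
lemma exists_direction_eq (q : Sph d) : ∃ x, direction (Y x) = q := by
  have hconv := convex_convexHull ℝ (range Y)
  have hnhds : convexHull ℝ (range Y) ∈ 𝓝 (0 : Euc d) := mem_interior_iff_mem_nhds.1 hY.encloses
  have hbdd : Bornology.IsBounded (convexHull ℝ (range Y)) :=
    isBounded_convexHull.2 (isCompact_range hY.continuous).isBounded
  have hg : 0 < gauge (convexHull ℝ (range Y)) (q : Euc d) :=
    (gauge_pos (absorbent_nhds_zero hnhds) (NormedSpace.isVonNBounded_of_isBounded _ hbdd)).2 (sph_ne_zero q)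
  -- Rescaling to gauge one lands on the frontier of the hull, which is the hypersurface itself.
  set c := (gauge (convexHull ℝ (range Y)) (q : Euc d))⁻¹ with hc
  have hc0 : 0 < c := inv_pos.2 hg
  have h1 : gauge (convexHull ℝ (range Y)) (c • (q : Euc d)) = 1 := by
    rw [gauge_smul_of_nonneg hc0.le, hc, smul_eq_mul, inv_mul_cancel₀ hg.ne']
  have h2 : c • (q : Euc d) ∈ frontier (convexHull ℝ (range Y)) :=
    (gauge_eq_one_iff_mem_frontier hconv hnhds).1 h1
  rw [hY.frontier_eq] at h2
  obtain ⟨x, hx⟩ := h2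
  exact ⟨x, by rw [hx, direction_smul_coe hc0]⟩

lemma supportFn_gaussMap (x : Sph d) :
    supportFn (range Y) (gaussMap Y x) = ⟪Y x, (gaussMap Y x : Euc d)⟫ := by
  apply IsGreatest.csSup_eq
  refine ⟨⟨Y x, ⟨x, rfl⟩, rfl⟩, ?_⟩
  rintro _ ⟨_, ⟨z, rfl⟩, rfl⟩
  have := hY.normal_spec x z
  rw [inner_sub_left] at this
  simp only; linarith

end IsStrictlyConvexEmbedding

/-! ### Smooth dependence of dual points on time -/

section Slices

variable {F : Type*} [NormedAddCommGroup F] [NormedSpace ℝ F]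

/-- The time set may contain an endpoint, so the joint derivative is taken within the product.
Restricted to spatial vectors it is the ordinary derivative of the slice, because the spatial domain
is open. -/
lemma contDiffOn_fderiv_slice {f : Euc d × ℝ → F} {I : Set ℝ} (hI : UniqueDiffOn ℝ I)
    (hf : ContDiffOn ℝ ∞ f ({0}ᶜ ×ˢ I)) :
    ContDiffOn ℝ ∞ (fun p : Euc d × ℝ => fderiv ℝ (fun y => f (y, p.2)) p.1) ({0}ᶜ ×ˢ I) := by
  have hD : UniqueDiffOn ℝ (({0}ᶜ : Set (Euc d)) ×ˢ I) :=
    isOpen_compl_singleton.uniqueDiffOn.prod hI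
  have h1 : ContDiffOn ℝ ∞ (fun p : Euc d × ℝ =>
      (fderivWithin ℝ f ({0}ᶜ ×ˢ I) p).comp (ContinuousLinearMap.inl ℝ (Euc d) ℝ))
      ({0}ᶜ ×ˢ I) :=
    (hf.fderivWithin hD (m := ∞) (by simp)).clm_comp contDiffOn_const
  refine h1.congr fun p hp => ?_
  have h2 : HasFDerivWithinAt f (fderivWithin ℝ f ({0}ᶜ ×ˢ I) p) ({0}ᶜ ×ˢ I) p :=
    ((hf p hp).differentiableWithinAt (by simp)).hasFDerivWithinAt
  have h3 : HasFDerivWithinAt (fun y : Euc d => (y, p.2)) (ContinuousLinearMap.inl ℝ (Euc d) ℝ)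
      ({0}ᶜ : Set (Euc d)) p.1 := (hasFDerivAt_prodMk_left p.1 p.2).hasFDerivWithinAt
  have h4 := HasFDerivWithinAt.comp p.1 (show HasFDerivWithinAt f _ _ (p.1, p.2) from h2) h3
    (fun y hy => show (y, p.2) ∈ ({0}ᶜ : Set (Euc d)) ×ˢ I from ⟨hy, hp.2⟩)
  exact (h4.hasFDerivAt (isOpen_compl_singleton.mem_nhds hp.1)).fderiv

lemma contDiffOn_conicExt_family {X : Sph d → ℝ → F} {I : Set ℝ}
    (hX : ContDiffOn ℝ ∞ (fun p : Euc d × ℝ => X (direction p.1) p.2) ({0}ᶜ ×ˢ I)) :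
    ContDiffOn ℝ ∞ (fun p : Euc d × ℝ => conicExt (fun z => X z p.2) p.1) ({0}ᶜ ×ˢ I) := by
  have h1 : ContDiffOn ℝ ∞ (fun p : Euc d × ℝ => ‖p.1‖) ({0}ᶜ ×ˢ I) := fun p hp =>
    ((contDiffAt_norm ℝ hp.1).comp p contDiff_fst.contDiffAt).contDiffWithinAt
  exact h1.smul hX

lemma contDiffOn_radial_of_conic_family {X : Sph d → ℝ → F} {I : Set ℝ}
    (hX : ContDiffOn ℝ ∞ (fun p : Euc d × ℝ => conicExt (fun z => X z p.2) p.1) ({0}ᶜ ×ˢ I)) :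
    ContDiffOn ℝ ∞ (fun p : Euc d × ℝ => X (direction p.1) p.2) ({0}ᶜ ×ˢ I) := by
  have h1 : ContDiffOn ℝ ∞ (fun p : Euc d × ℝ => ‖p.1‖⁻¹) ({0}ᶜ ×ˢ I) := fun p hp =>
    (((contDiffAt_norm ℝ hp.1).comp p contDiff_fst.contDiffAt).inv
      (norm_ne_zero_iff.2 hp.1)).contDiffWithinAt
  refine (h1.smul hX).congr fun p hp => ?_
  simp only [conicExt, Pi.smul_apply', smul_smul]
  rw [inv_mul_cancel₀ (norm_ne_zero_iff.2 hp.1), one_smul]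

/-- The dual points of a smooth family of embeddings depend smoothly on all variables. -/
lemma contDiffOn_conicExt_dualPt_family {X : Sph d → ℝ → Euc d} {I : Set ℝ}
    (hI : UniqueDiffOn ℝ I)
    (hX : ContDiffOn ℝ ∞ (fun p : Euc d × ℝ => X (direction p.1) p.2) ({0}ᶜ ×ˢ I))
    (hc : ∀ t ∈ I, IsStrictlyConvexEmbedding fun z => X z t) :
    ContDiffOn ℝ ∞ (fun p : Euc d × ℝ => conicExt (dualPt fun z => X z p.2) p.1)
      ({0}ᶜ ×ˢ I) := by
  set A : Euc d × ℝ → Euc d →L[ℝ] Euc d := fun p => fderiv ℝ (conicExt fun z => X z p.2) p.1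
    with hA
  have hAs : ContDiffOn ℝ ∞ A ({0}ᶜ ×ˢ I) :=
    contDiffOn_fderiv_slice hI (contDiffOn_conicExt_family hX)
  let b := EuclideanSpace.basisFun (Fin (d + 1)) ℝ
  have hunit : ∀ p ∈ (({0}ᶜ : Set (Euc d)) ×ˢ I), IsUnit (A p) := by
    intro p hp
    have hinj := (hc p.2 hp.2).fderiv_conic_injective' hp.1
    rw [ContinuousLinearMap.isUnit_iff_bijective]
    exact ⟨hinj, (LinearMap.injective_iff_surjective (f := (A p).toLinearMap)).1 hinj⟩
  have hinv : ContDiffOn ℝ ∞ (fun p => Ring.inverse (A p)) ({0}ᶜ ×ˢ I) := by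
    intro p hp
    obtain ⟨u, hu⟩ := hunit p hp
    have := contDiffAt_ringInverse ℝ (n := ∞) u
    rw [hu] at this
    exact this.comp_contDiffWithinAt p (hAs p hp)
  -- By `inner_conic_dualPt` the coordinate of the dual cone along `b i` is the pairing of the base
  -- point with the preimage of `b i` under `A`; inversion of operators is smooth at units.
  have h1 : ContDiffOn ℝ ∞ (fun p : Euc d × ℝ =>
      ∑ i, ⟪p.1, Ring.inverse (A p) (b i)⟫ • b i) ({0}ᶜ ×ˢ I) := by
    refine ContDiffOn.sum fun i _ => ?_
    exact (contDiff_fst.contDiffOn.inner ℝ (hinv.clm_apply contDiffOn_const)).smul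
      contDiffOn_const
  refine h1.congr fun p hp => ?_
  have hy : p.1 ≠ 0 := hp.1
  rw [← b.sum_repr' (conicExt (dualPt fun z => X z p.2) p.1)]
  refine Finset.sum_congr rfl fun i _ => ?_
  congr 1
  have h2 : A p (Ring.inverse (A p) (b i)) = b i := by
    have := Ring.mul_inverse_cancel (A p) (hunit p hp)
    exact congrArg (fun L : Euc d →L[ℝ] Euc d => L (b i)) this
  have h3 := (hc p.2 hp.2).inner_conic_dualPt (direction p.1) (Ring.inverse (A p) (b i))
  rw [← fderiv_conicExt_smul _ (norm_pos_iff.2 hy), norm_smul_direction hy] at h3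
  change ⟪A p (Ring.inverse (A p) (b i)), _⟫ = _ at h3
  rw [h2] at h3
  rw [conicExt, inner_smul_right, h3, ← real_inner_smul_left, norm_smul_direction hy]

end Slices

/-! ### Determinant identities, and curvature through dual points -/

/-- The determinant of a mixed Gram matrix. -/
lemma det_inner_comp {ι : Type*} [Fintype ι] [DecidableEq ι] (hι : Fintype.card ι = d + 1)
    (S T : Euc d →L[ℝ] Euc d) (c : ι → Euc d) :
    (Matrix.of fun i j => ⟪S (c i), T (c j)⟫).det =
      S.det * T.det * (Matrix.of fun i j => ⟪c i, c j⟫).det := by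
  let e : Fin (d + 1) ≃ ι := Fintype.equivOfCardEq (by simp [hι])
  let o := (EuclideanSpace.basisFun (Fin (d + 1)) ℝ).reindex e
  have h1 : ∀ u v : ι → Euc d, (Matrix.of fun i j => ⟪u i, v j⟫) =
      (o.toBasis.toMatrix u).transpose * o.toBasis.toMatrix v := by
    intro u v
    ext i j
    simp only [Matrix.of_apply, Matrix.mul_apply, Matrix.transpose_apply, Module.Basis.toMatrix_apply,
      OrthonormalBasis.coe_toBasis_repr_apply, OrthonormalBasis.repr_apply_apply]
    rw [← o.sum_inner_mul_inner (u i) (v j)]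
    exact Finset.sum_congr rfl fun k _ => by rw [real_inner_comm]
  have h2 : ∀ (S : Euc d →L[ℝ] Euc d), (o.toBasis.toMatrix fun i => S (c i)).det =
      S.det * (o.toBasis.toMatrix c).det := by
    intro S
    have h3 : (o.toBasis.toMatrix fun i => S (c i)) =
        LinearMap.toMatrix o.toBasis o.toBasis S.toLinearMap * o.toBasis.toMatrix c := by
      ext i j
      rw [Module.Basis.toMatrix_apply, Matrix.mul_apply]
      have := LinearMap.toMatrix_mulVec_repr o.toBasis o.toBasis S.toLinearMap (c j)
      have h4 := congrFun this i
      rw [Matrix.mulVec, dotProduct] at h4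
      exact h4.symm
    rw [h3, Matrix.det_mul, LinearMap.det_toMatrix]
  rw [h1, Matrix.det_mul, Matrix.det_transpose, h2, h2, h1 c c, Matrix.det_mul,
    Matrix.det_transpose]
  ring

/-- The determinant of a map perturbed by a rank one operator with range in the image of `x`. -/
lemma det_comp_one_add_rankOne (S : Euc d →L[ℝ] Euc d) (u a : Euc d) :
    (S + (innerSL ℝ a).smulRight (S u)).det = S.det * (1 + ⟪a, u⟫) := by
  have h1 : S + (innerSL ℝ a).smulRight (S u) =
      S.comp (ContinuousLinearMap.id ℝ (Euc d) + (innerSL ℝ a).smulRight u) := by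
    ext v; simp
  have h2 : (ContinuousLinearMap.id ℝ (Euc d) + (innerSL ℝ a).smulRight u).det = 1 + ⟪a, u⟫ := by
    have := LinearMap.transvection.det (innerSL ℝ a : Euc d →L[ℝ] ℝ).toLinearMap u
    simp only [ContinuousLinearMap.coe_coe, innerSL_apply_apply] at this
    rw [← this]
    congr 1
  rw [h1]
  change LinearMap.det (S.toLinearMap ∘ₗ _) = _
  rw [LinearMap.det_comp]
  congr 1

lemma fderiv_comp_sphIncl_sum (x : Sph d) (L : Euc d →L[ℝ] Euc d) (v : Fin d → ℝ) :
    L (sphIncl x (WithLp.toLp 2 v)) = ∑ i, v i • L (sphIncl x (EuclideanSpace.single i 1)) := by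
  have h : (WithLp.toLp 2 v : EuclideanSpace ℝ (Fin d)) =
      ∑ i, v i • EuclideanSpace.single i (1 : ℝ) := by
    ext j
    simp [Finset.sum_apply, Pi.single_apply]
  rw [h, map_sum, map_sum]
  simp

namespace IsStrictlyConvexEmbedding

variable {Y : Sph d → Euc d} (hY : IsStrictlyConvexEmbedding Y)
include hY

lemma contDiffOn_conicExt_dualPt : ContDiffOn ℝ ∞ (conicExt (dualPt Y)) {0}ᶜ := by
  have h1 := contDiffOn_conicExt_dualPt_family (X := fun z _ => Y z) (I := univ) uniqueDiffOn_univ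
    (((contDiffOn_radialExt hY.smooth).comp contDiffOn_fst fun p hp => hp.1)) (fun _ _ => hY)
  exact h1.comp (g := fun p : Euc d × ℝ => conicExt (dualPt Y) p.1) (f := fun y => (y, (0 : ℝ)))
    (contDiff_id.prodMk contDiff_const).contDiffOn (fun y hy => ⟨hy, mem_univ _⟩)

lemma contDiffAt_radialExt_dualPt {y : Euc d} (hy : y ≠ 0) :
    ContDiffAt ℝ ∞ (radialExt (dualPt Y)) y := by
  have h1 : ContDiffAt ℝ ∞ (conicExt (dualPt Y)) y :=
    hY.contDiffOn_conicExt_dualPt.contDiffAt (isOpen_compl_singleton.mem_nhds hy)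
  refine (((contDiffAt_norm ℝ hy).inv (norm_ne_zero_iff.2 hy)).smul h1).congr_of_eventuallyEq ?_
  filter_upwards [isOpen_compl_singleton.mem_nhds hy] with z hz
  simp only [conicExt, smul_smul, radialExt, Pi.smul_apply', Pi.inv_apply]
  rw [inv_mul_cancel₀ (norm_ne_zero_iff.2 hz), one_smul]

lemma differentiableAt_dualPt {y : Euc d} (hy : y ≠ 0) :
    DifferentiableAt ℝ (radialExt (dualPt Y)) y :=
  (hY.contDiffAt_radialExt_dualPt hy).differentiableAt (by simp)

/-- Differentiate ⟨Y, p⟩ = 1 and drop the term in which Y is differentiated. This is the other half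
of the duality: Y is conormal to the dual hypersurface. -/
lemma inner_fderiv_dualPt_right {y : Euc d} (hy : y ≠ 0) (w : Euc d) :
    ⟪Y (direction y), fderiv ℝ (radialExt (dualPt Y)) y w⟫ = 0 := by
  have h2 := (hY.differentiableAt hy).hasFDerivAt.inner ℝ (hY.differentiableAt_dualPt hy).hasFDerivAt
  have h3 : (fun z => ⟪radialExt Y z, radialExt (dualPt Y) z⟫) = fun _ => (1 : ℝ) := by
    funext z; exact hY.inner_dualPt_self _
  rw [h3] at h2
  have h4 := congrArg (fun L => L w) (h2.unique (hasFDerivAt_const (1 : ℝ) y))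
  simp only [ContinuousLinearMap.coe_comp, Function.comp_apply, ContinuousLinearMap.prod_apply,
    fderivInnerCLM_apply, zero_apply] at h4
  have h5 := hY.inner_fderiv_dualPt hy w
  rw [radialExt, radialExt, h5, add_zero] at h4
  exact h4

/-- The curvature form is symmetric. -/
lemma curvature_symm (x : Sph d) (v w : Euc d) :
    ⟪fderiv ℝ (radialExt (dualPt Y)) (x : Euc d) v, fderiv ℝ (radialExt Y) (x : Euc d) w⟫ =
      ⟪fderiv ℝ (radialExt (dualPt Y)) (x : Euc d) w, fderiv ℝ (radialExt Y) (x : Euc d) v⟫ := by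
  have hx := sph_ne_zero x
  have hs : ContDiffAt ℝ ∞ (radialExt Y) (x : Euc d) := contDiffAt_radialExt hY.smooth hx
  have hd : DifferentiableAt ℝ (fderiv ℝ (radialExt Y)) (x : Euc d) :=
    (hs.fderiv_right (m := ∞) (by simp)).differentiableAt (by simp)
  -- Differentiating ⟨p, dY w⟩ = 0 in the direction `v` turns the form into minus the second
  -- derivative of Y paired with p, which is symmetric.
  have key : ∀ v w : Euc d,
      ⟪fderiv ℝ (radialExt (dualPt Y)) (x : Euc d) v, fderiv ℝ (radialExt Y) (x : Euc d) w⟫ =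
        - ⟪dualPt Y x, fderiv ℝ (fderiv ℝ (radialExt Y)) (x : Euc d) v w⟫ := by
    intro v w
    have h1 : HasFDerivAt (fun y => fderiv ℝ (radialExt Y) y w)
        ((fderiv ℝ (fderiv ℝ (radialExt Y)) (x : Euc d)).flip w) (x : Euc d) := by
      have := hd.hasFDerivAt.clm_apply (hasFDerivAt_const w (x : Euc d))
      simpa using this
    have h2 := (hY.differentiableAt_dualPt hx).hasFDerivAt.inner ℝ h1
    have h3 : (fun y => ⟪radialExt (dualPt Y) y, fderiv ℝ (radialExt Y) y w⟫)
        =ᶠ[𝓝 (x : Euc d)] fun _ => (0 : ℝ) := by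
      filter_upwards [isOpen_compl_singleton.mem_nhds hx] with y hy
      rw [real_inner_comm]; exact hY.inner_fderiv_dualPt hy w
    have h4 := congrArg (fun L => L v)
      (h2.unique ((hasFDerivAt_const (0 : ℝ) (x : Euc d)).congr_of_eventuallyEq h3))
    simp only [ContinuousLinearMap.coe_comp, Function.comp_apply, ContinuousLinearMap.prod_apply,
      fderivInnerCLM_apply, zero_apply, ContinuousLinearMap.flip_apply, radialExt_coe] at h4
    linarith
  rw [key, key]
  have := (hs.isSymmSndFDerivAt
    (by simpa using (by exact_mod_cast le_top : ((2 : ℕ∞) : WithTop ℕ∞) ≤ ∞))) v w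
  rw [this]

/-- The normal is p/|p| with |p| the inverse height, so dν is the height times dp plus a multiple of
p. That multiple is invisible to tangent vectors, which is why the second fundamental form can be
computed from dp. -/
lemma fderiv_gaussMap (x : Sph d) (w : Euc d) :
    DifferentiableAt ℝ (radialExt fun z => (gaussMap Y z : Euc d)) (x : Euc d) ∧
    ∃ c : ℝ, fderiv ℝ (radialExt fun z => (gaussMap Y z : Euc d)) (x : Euc d) w =
      ⟪Y x, (gaussMap Y x : Euc d)⟫ • fderiv ℝ (radialExt (dualPt Y)) (x : Euc d) w
        + c • dualPt Y x := by
  have hx := sph_ne_zero x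
  have h1 : (radialExt fun z => (gaussMap Y z : Euc d)) =
      fun y => ‖radialExt (dualPt Y) y‖⁻¹ • radialExt (dualPt Y) y := by
    funext y
    simp only [radialExt]
    rw [← hY.direction_dualPt, coe_direction (hY.dualPt_ne_zero _)]
  have h0 : radialExt (dualPt Y) (x : Euc d) ≠ 0 := hY.dualPt_ne_zero _
  have h2 : DifferentiableAt ℝ (fun y => ‖radialExt (dualPt Y) y‖⁻¹) (x : Euc d) :=
    ((hY.differentiableAt_dualPt hx).norm ℝ h0).inv (norm_ne_zero_iff.2 h0)
  have h3 := h2.hasFDerivAt.smul (hY.differentiableAt_dualPt hx).hasFDerivAt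
  rw [h1]
  refine ⟨h3.differentiableAt, fderiv ℝ (fun y => ‖radialExt (dualPt Y) y‖⁻¹) (x : Euc d) w, ?_⟩
  have h4 : HasFDerivAt (fun y => ‖radialExt (dualPt Y) y‖⁻¹ • radialExt (dualPt Y) y) _
    (x : Euc d) := h3
  rw [h4.fderiv]
  simp [hY.norm_dualPt]

lemma secondForm_eq (x : Sph d) (i j : Fin d) :
    secondForm Y x i j = ⟪Y x, (gaussMap Y x : Euc d)⟫ *
      ⟪fderiv ℝ (radialExt (dualPt Y)) (x : Euc d) (sphIncl x (EuclideanSpace.single i 1)),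
        fderiv ℝ (radialExt Y) (x : Euc d) (sphIncl x (EuclideanSpace.single j 1))⟫ := by
  obtain ⟨h1, c, h2⟩ := hY.fderiv_gaussMap x (sphIncl x (EuclideanSpace.single i 1))
  have h3 := hY.inner_fderiv_dualPt (sph_ne_zero x) (sphIncl x (EuclideanSpace.single j 1))
  rw [direction_coe, real_inner_comm] at h3
  rw [secondForm, Matrix.of_apply, partialAt_eq h1, h2,
    partialAt_eq (hY.differentiableAt (sph_ne_zero x)), inner_add_left, real_inner_smul_left,
    real_inner_smul_left, h3, mul_zero, add_zero]

lemma firstForm_eq (x : Sph d) (i j : Fin d) :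
    firstForm Y x i j =
      ⟪fderiv ℝ (radialExt Y) (x : Euc d) (sphIncl x (EuclideanSpace.single i 1)),
        fderiv ℝ (radialExt Y) (x : Euc d) (sphIncl x (EuclideanSpace.single j 1))⟫ := by
  rw [firstForm, Matrix.of_apply, partialAt_eq (hY.differentiableAt (sph_ne_zero x)),
    partialAt_eq (hY.differentiableAt (sph_ne_zero x))]

lemma firstForm_posDef (x : Sph d) : (firstForm Y x).PosDef := by
  have h : firstForm Y x = Matrix.gram ℝ (fun i : Fin d =>
      fderiv ℝ (radialExt Y) (x : Euc d) (sphIncl x (EuclideanSpace.single i 1))) := by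
    ext i j
    rw [hY.firstForm_eq, Matrix.gram_apply]
  rw [h]
  apply Matrix.posDef_gram_of_linearIndependent
  rw [Fintype.linearIndependent_iff]
  intro v hv i
  rw [← fderiv_comp_sphIncl_sum] at hv
  have h1 := hY.fderiv_eq_zero (inner_sphIncl x _) hv
  have h2 : (WithLp.toLp 2 v : EuclideanSpace ℝ (Fin d)) = 0 :=
    sphIncl_injective x (by rw [h1, map_zero])
  have := congrArg (fun u : EuclideanSpace ℝ (Fin d) => u i) h2
  simpa using this

lemma exists_fderiv_conic_eq (x : Sph d) (z : Euc d) :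
    ∃ u, fderiv ℝ (conicExt Y) (x : Euc d) u = z :=
  (LinearMap.injective_iff_surjective (f := (fderiv ℝ (conicExt Y) (x : Euc d)).toLinearMap)).1
      (hY.fderiv_conic_injective x) z

/-- Gauss curvature as a quotient of Jacobians. -/
lemma gaussCurvature_mul_det (x : Sph d) :
    (fderiv ℝ (conicExt Y) (x : Euc d)).det ≠ 0 ∧
    gaussCurvature Y x * (fderiv ℝ (conicExt Y) (x : Euc d)).det =
      ⟪Y x, (gaussMap Y x : Euc d)⟫ ^ (d + 2) *
        (fderiv ℝ (conicExt (dualPt Y)) (x : Euc d)).det := by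
  have hx := sph_ne_zero x
  set h := ⟪Y x, (gaussMap Y x : Euc d)⟫ with hh
  have hpos : 0 < h := hY.height_pos x
  set A := fderiv ℝ (conicExt Y) (x : Euc d) with hA
  set P := fderiv ℝ (conicExt (dualPt Y)) (x : Euc d) with hP
  set ν : Euc d := (gaussMap Y x : Euc d) with hν
  -- Tangent coordinate vectors completed by the radial direction: a frame of the whole space in
  -- which both cone differentials split.
  let c : Fin d ⊕ Unit → Euc d :=
    Sum.elim (fun i => sphIncl x (EuclideanSpace.single i 1)) (fun _ => (x : Euc d))
  have hcard : Fintype.card (Fin d ⊕ Unit) = d + 1 := by simp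
  set G := (Matrix.of fun i j => ⟪c i, c j⟫).det with hG
  have hAv : ∀ v, A v = fderiv ℝ (radialExt Y) (x : Euc d) v + ⟪(x : Euc d), v⟫ • Y x :=
    fderiv_conicExt (hY.differentiableAt hx)
  have hPv : ∀ v, P v = fderiv ℝ (radialExt (dualPt Y)) (x : Euc d) v
      + ⟪(x : Euc d), v⟫ • dualPt Y x := fderiv_conicExt (hY.differentiableAt_dualPt hx)
  have hAb : ∀ i, A (c (Sum.inl i)) =
      fderiv ℝ (radialExt Y) (x : Euc d) (sphIncl x (EuclideanSpace.single i 1)) := by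
    intro i; rw [hAv]; simp [c, inner_sphIncl]
  have hPb : ∀ i, P (c (Sum.inl i)) = fderiv ℝ (radialExt (dualPt Y)) (x : Euc d)
      (sphIncl x (EuclideanSpace.single i 1)) := by
    intro i; rw [hPv]; simp [c, inner_sphIncl]
  have hAx : ∀ i, A (c (Sum.inr i)) = Y x := by
    intro i; rw [hAv]
    simp [c, fderiv_radialExt_self Y hx (hY.differentiableAt hx)]
  have hPx : ∀ i, P (c (Sum.inr i)) = dualPt Y x := by
    intro i; rw [hPv]
    simp [c, fderiv_radialExt_self _ hx (hY.differentiableAt_dualPt hx)]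
  have hYp : ∀ w, ⟪fderiv ℝ (radialExt (dualPt Y)) (x : Euc d) w, Y x⟫ = 0 := by
    intro w
    have := hY.inner_fderiv_dualPt_right hx w
    rwa [direction_coe, real_inner_comm] at this
  have hpY : ∀ w, ⟪dualPt Y x, fderiv ℝ (radialExt Y) (x : Euc d) w⟫ = 0 := by
    intro w
    have := hY.inner_fderiv_dualPt hx w
    rwa [direction_coe, real_inner_comm] at this
  have hνY : ∀ w, ⟪ν, fderiv ℝ (radialExt Y) (x : Euc d) w⟫ = 0 := by
    intro w
    have := hY.inner_fderiv_normal hx (v := gaussMap Y x) (by simpa using hY.normal_spec x) w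
    rwa [real_inner_comm] at this
  -- The duality relations make the mixed Gram matrix of `P` and `A` block diagonal, with blocks the
  -- rescaled second form and one.
  have eq1 : P.det * A.det * G = h⁻¹ ^ d * (secondForm Y x).det := by
    rw [hG, ← det_inner_comp hcard]
    have : (Matrix.of fun i j => ⟪P (c i), A (c j)⟫) =
        Matrix.fromBlocks (h⁻¹ • secondForm Y x) 0 0 (1 : Matrix Unit Unit ℝ) := by
      ext i j
      rcases i with i | i <;> rcases j with j | j
      · simp only [Matrix.of_apply, hPb, hAb, Matrix.fromBlocks_apply₁₁, Matrix.smul_apply,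
          hY.secondForm_eq, smul_eq_mul]
        rw [← hν, ← hh, ← mul_assoc, inv_mul_cancel₀ hpos.ne', one_mul]
      · simp only [Matrix.of_apply, hPb, hAx, Matrix.fromBlocks_apply₁₂, hYp, Matrix.zero_apply]
      · simp only [Matrix.of_apply, hPx, hAb, Matrix.fromBlocks_apply₂₁, hpY, Matrix.zero_apply]
      · simp only [Matrix.of_apply, hPx, hAx, Matrix.fromBlocks_apply₂₂, Matrix.one_apply]
        rw [real_inner_comm, hY.inner_dualPt_self]; simp
    rw [this, Matrix.det_fromBlocks_zero₁₂, Matrix.det_smul, Matrix.det_one, mul_one]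
    simp
  -- With this `u`, the rank one perturbation of `A` sends the radial vector to ν instead of Y and
  -- leaves tangent vectors alone. Its Gram matrix against `A` is then block triangular and exhibits
  -- the first form.
  obtain ⟨u, hu⟩ := hY.exists_fderiv_conic_eq x (ν - Y x)
  have hνν : ⟪ν, ν⟫ = 1 := inner_sph_self _
  have hu2 : (1 + ⟪(x : Euc d), u⟫) * h = 1 := by
    have h1 := hY.inner_conic_normal (hY.normal_spec x) u
    rw [hu, inner_sub_left] at h1
    change ⟪ν, ν⟫ - h = _ * h at h1
    rw [hνν] at h1
    linarith
  have eq2 : A.det * A.det * G = h ^ 2 * (firstForm Y x).det := by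
    have h1 := det_comp_one_add_rankOne A u (x : Euc d)
    have h2 : (A + (innerSL ℝ (x : Euc d)).smulRight (A u)).det * A.det * G =
        (firstForm Y x).det * h := by
      rw [hG, ← det_inner_comp hcard]
      have : (Matrix.of fun i j =>
          ⟪(A + (innerSL ℝ (x : Euc d)).smulRight (A u)) (c i), A (c j)⟫) =
          Matrix.fromBlocks (firstForm Y x)
            (Matrix.of fun i _ => ⟪A (c (Sum.inl i)), Y x⟫) 0 (h • (1 : Matrix Unit Unit ℝ)) := by
        ext i j
        have e1 : ∀ i, (A + (innerSL ℝ (x : Euc d)).smulRight (A u)) (c (Sum.inl i)) =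
            A (c (Sum.inl i)) := by intro i; simp [c, inner_sphIncl]
        have e2 : ∀ i, (A + (innerSL ℝ (x : Euc d)).smulRight (A u)) (c (Sum.inr i)) = ν := by
          intro i
          rw [add_apply, hAx, hA, hu]
          simp [c]
        rcases i with i | i <;> rcases j with j | j
        · simp only [Matrix.of_apply, e1, hAb, Matrix.fromBlocks_apply₁₁, hY.firstForm_eq]
        · simp only [Matrix.of_apply, e1, hAx, Matrix.fromBlocks_apply₁₂]
        · simp only [Matrix.of_apply, e2, hAb, Matrix.fromBlocks_apply₂₁, hνY, Matrix.zero_apply]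
        · simp only [Matrix.of_apply, e2, hAx, Matrix.fromBlocks_apply₂₂, Matrix.smul_apply,
            Matrix.one_apply, smul_eq_mul]
          rw [hh, real_inner_comm]; simp
      rw [this, Matrix.det_fromBlocks_zero₂₁, Matrix.det_smul, Matrix.det_one, mul_one]
      simp
    rw [h1] at h2
    have : A.det * A.det * G * ((1 + ⟪(x : Euc d), u⟫) * h) = (firstForm Y x).det * h * h := by
      rw [← h2]; ring
    rw [hu2, mul_one] at this
    rw [this]; ring
  have hI : (firstForm Y x).det ≠ 0 := (hY.firstForm_posDef x).det_pos.ne'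
  have hne : A.det * A.det * G ≠ 0 := by rw [eq2]; positivity
  have hA0 : A.det ≠ 0 := fun h0 => hne (by rw [h0]; ring)
  have hG0 : G ≠ 0 := fun h0 => hne (by rw [h0]; ring)
  refine ⟨hA0, ?_⟩
  have hK : gaussCurvature Y x * (firstForm Y x).det = (secondForm Y x).det := by
    rw [gaussCurvature, weingarten, Matrix.det_mul, Matrix.det_nonsing_inv, Ring.inverse_eq_inv']
    field_simp
  have e3 : (secondForm Y x).det = h ^ d * (P.det * A.det * G) := by
    rw [eq1, ← mul_assoc, ← mul_pow, mul_inv_cancel₀ hpos.ne', one_pow, one_mul]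
  have e4 : (gaussCurvature Y x * A.det) * (A.det * G) =
      (h ^ (d + 2) * P.det) * (A.det * G) := by
    calc (gaussCurvature Y x * A.det) * (A.det * G)
        = gaussCurvature Y x * (A.det * A.det * G) := by ring
      _ = h ^ 2 * (gaussCurvature Y x * (firstForm Y x).det) := by rw [eq2]; ring
      _ = (h ^ (d + 2) * P.det) * (A.det * G) := by rw [hK, e3]; ring
  exact mul_right_cancel₀ (mul_ne_zero hA0 hG0) e4

end IsStrictlyConvexEmbedding

/-! ### Principal curvatures as bounds on a quadratic form -/

/-- All principal curvatures are at least `c`, expressed through the curvature form. -/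
def CurvatureBound (Y : Sph d → Euc d) (c : ℝ) : Prop :=
  ∀ (x : Sph d) (w : Euc d), ⟪(x : Euc d), w⟫ = 0 →
    c * ‖fderiv ℝ (radialExt Y) (x : Euc d) w‖ ^ 2 ≤ ⟪Y x, (gaussMap Y x : Euc d)⟫ *
      ⟪fderiv ℝ (radialExt (dualPt Y)) (x : Euc d) w, fderiv ℝ (radialExt Y) (x : Euc d) w⟫

namespace IsStrictlyConvexEmbedding

variable {Y : Sph d → Euc d} (hY : IsStrictlyConvexEmbedding Y)
include hY

lemma dotProduct_secondForm (x : Sph d) (v : Fin d → ℝ) :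
    v ⬝ᵥ (secondForm Y x).mulVec v = ⟪Y x, (gaussMap Y x : Euc d)⟫ *
      ⟪fderiv ℝ (radialExt (dualPt Y)) (x : Euc d) (sphIncl x (WithLp.toLp 2 v)),
        fderiv ℝ (radialExt Y) (x : Euc d) (sphIncl x (WithLp.toLp 2 v))⟫ := by
  rw [fderiv_comp_sphIncl_sum, fderiv_comp_sphIncl_sum]
  simp only [dotProduct, Matrix.mulVec, sum_inner, inner_sum, real_inner_smul_left,
    inner_smul_right, hY.secondForm_eq, Finset.mul_sum]
  rw [Finset.sum_comm]
  exact Finset.sum_congr rfl fun i _ => Finset.sum_congr rfl fun j _ => by ring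

lemma dotProduct_firstForm (x : Sph d) (v : Fin d → ℝ) :
    v ⬝ᵥ (firstForm Y x).mulVec v =
      ‖fderiv ℝ (radialExt Y) (x : Euc d) (sphIncl x (WithLp.toLp 2 v))‖ ^ 2 := by
  rw [← real_inner_self_eq_norm_sq, fderiv_comp_sphIncl_sum]
  simp only [dotProduct, Matrix.mulVec, sum_inner, inner_sum, real_inner_smul_left,
    inner_smul_right, hY.firstForm_eq, Finset.mul_sum]
  rw [Finset.sum_comm]
  exact Finset.sum_congr rfl fun i _ => Finset.sum_congr rfl fun j _ => by ring

lemma firstForm_mul_weingarten (x : Sph d) : firstForm Y x * weingarten Y x = secondForm Y x := by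
  rw [weingarten, ← mul_assoc, Matrix.mul_nonsing_inv _
    (hY.firstForm_posDef x).det_pos.ne'.isUnit, one_mul]

lemma exists_of_isPrincipalCurvature {x : Sph d} {κ : ℝ} (h : IsPrincipalCurvature Y x κ) :
    ∃ w : Euc d, ⟪(x : Euc d), w⟫ = 0 ∧ 0 < ‖fderiv ℝ (radialExt Y) (x : Euc d) w‖ ∧
      ⟪Y x, (gaussMap Y x : Euc d)⟫ * ⟪fderiv ℝ (radialExt (dualPt Y)) (x : Euc d) w,
        fderiv ℝ (radialExt Y) (x : Euc d) w⟫ =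
          κ * ‖fderiv ℝ (radialExt Y) (x : Euc d) w‖ ^ 2 := by
  obtain ⟨v, hv⟩ := h.exists_hasEigenvector
  have hv1 := hv.apply_eq_smul
  have hv0 := hv.2
  rw [Matrix.toLin'_apply] at hv1
  refine ⟨sphIncl x (WithLp.toLp 2 v), inner_sphIncl x _, ?_, ?_⟩
  · rw [norm_pos_iff]
    intro h0
    have h1 := hY.fderiv_eq_zero (inner_sphIncl x _) h0
    have h2 : (WithLp.toLp 2 v : EuclideanSpace ℝ (Fin d)) = 0 :=
      sphIncl_injective x (by rw [h1, map_zero])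
    apply hv0
    funext i
    have := congrArg (fun u : EuclideanSpace ℝ (Fin d) => u i) h2
    simpa using this
  · rw [← hY.dotProduct_secondForm, ← hY.dotProduct_firstForm, ← hY.firstForm_mul_weingarten,
      ← Matrix.mulVec_mulVec, hv1, Matrix.mulVec_smul, dotProduct_smul, smul_eq_mul]

lemma le_of_curvatureBound {c : ℝ} (hc : CurvatureBound Y c) {x : Sph d} {κ : ℝ}
    (h : IsPrincipalCurvature Y x κ) : c ≤ κ := by
  obtain ⟨w, hw, hpos, heq⟩ := hY.exists_of_isPrincipalCurvature h
  have := hc x w hw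
  rw [heq] at this
  exact le_of_mul_le_mul_right this (by positivity)

/-- The curvature form is bounded below by the least principal curvature. -/
lemma exists_isPrincipalCurvature_le (x : Sph d) {w : Euc d} (hw : ⟪(x : Euc d), w⟫ = 0)
    (hw0 : w ≠ 0) :
    ∃ κ, IsPrincipalCurvature Y x κ ∧ κ * ‖fderiv ℝ (radialExt Y) (x : Euc d) w‖ ^ 2 ≤
      ⟪Y x, (gaussMap Y x : Euc d)⟫ *
      ⟪fderiv ℝ (radialExt (dualPt Y)) (x : Euc d) w, fderiv ℝ (radialExt Y) (x : Euc d) w⟫ := by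
  obtain ⟨v0, rfl⟩ := exists_sphIncl x hw
  have hv0 : v0 ≠ 0 := fun h => hw0 (by rw [h, map_zero])
  let q : EuclideanSpace ℝ (Fin d) → ℝ := fun v => v.ofLp ⬝ᵥ (secondForm Y x).mulVec v.ofLp
  let r : EuclideanSpace ℝ (Fin d) → ℝ := fun v => v.ofLp ⬝ᵥ (firstForm Y x).mulVec v.ofLp
  have hqc : Continuous q := by
    apply continuous_finsetSum; intro i _
    refine Continuous.mul (by fun_prop) ?_
    simp only [Matrix.mulVec, dotProduct]
    apply continuous_finsetSum; intro j _
    fun_prop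
  have hrc : Continuous r := by
    apply continuous_finsetSum; intro i _
    refine Continuous.mul (by fun_prop) ?_
    simp only [Matrix.mulVec, dotProduct]
    apply continuous_finsetSum; intro j _
    fun_prop
  have hrpos : ∀ v, v ≠ 0 → 0 < r v := by
    intro v hv
    have := (hY.firstForm_posDef x).dotProduct_mulVec_pos (x := v.ofLp)
      (fun h => hv (by ext i; exact congrFun h i))
    simpa using this
  have hq2 : ∀ (s : ℝ) v, q (s • v) = s ^ 2 * q v := by
    intro s v
    simp only [q, WithLp.ofLp_smul, Matrix.mulVec_smul, dotProduct_smul, smul_dotProduct,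
      smul_eq_mul]
    ring
  have hr2 : ∀ (s : ℝ) v, r (s • v) = s ^ 2 * r v := by
    intro s v
    simp only [r, WithLp.ofLp_smul, Matrix.mulVec_smul, dotProduct_smul, smul_dotProduct,
      smul_eq_mul]
    ring
  have hne : (Metric.sphere (0 : EuclideanSpace ℝ (Fin d)) 1).Nonempty :=
    ⟨‖v0‖⁻¹ • v0, by simp [norm_smul, hv0]⟩
  have hsne : ∀ v ∈ Metric.sphere (0 : EuclideanSpace ℝ (Fin d)) 1, v ≠ 0 := by
    intro v hv h0; simp [h0] at hv
  -- The least principal curvature is the minimum of the quotient of the two forms over the compact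
  -- unit sphere of coordinates.
  obtain ⟨v1, hv1, hmin⟩ := (isCompact_sphere (0 : EuclideanSpace ℝ (Fin d)) 1).exists_isMinOn hne
    (f := fun v => q v / r v)
    (hqc.continuousOn.div hrc.continuousOn fun v hv => (hrpos v (hsne v hv)).ne')
  set κ := q v1 / r v1 with hκ
  have hall : ∀ v, κ * r v ≤ q v := by
    intro v
    by_cases hv : v = 0
    · simp [hv, q, r]
    have h1 : κ ≤ q (‖v‖⁻¹ • v) / r (‖v‖⁻¹ • v) := hmin (by simp [norm_smul, hv])
    have h2 : 0 < ‖v‖⁻¹ ^ 2 := by have := norm_pos_iff.2 hv; positivity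
    rw [hq2, hr2, mul_div_mul_left _ _ h2.ne', le_div_iff₀ (hrpos v hv)] at h1
    exact h1
  have hsymm : (secondForm Y x).IsHermitian := by
    ext i j
    simp only [Matrix.conjTranspose_apply, star_trivial, hY.secondForm_eq]
    rw [hY.curvature_symm]
  have hpsd : (secondForm Y x - κ • firstForm Y x).PosSemidef := by
    apply Matrix.PosSemidef.of_dotProduct_mulVec_nonneg
    · exact hsymm.sub ((hY.firstForm_posDef x).isHermitian.smul (IsSelfAdjoint.all κ))
    · intro v
      have := hall (WithLp.toLp 2 v)
      simp only [q, r] at this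
      rw [star_trivial, Matrix.sub_mulVec, Matrix.smul_mulVec, dotProduct_sub, dotProduct_smul,
        smul_eq_mul]
      linarith
  -- A positive semidefinite form that vanishes at a vector has this vector in its kernel; this is
  -- the eigenvector equation for the Weingarten matrix.
  have hz : (secondForm Y x - κ • firstForm Y x).mulVec v1.ofLp = 0 := by
    rw [← hpsd.dotProduct_mulVec_zero_iff, star_trivial, Matrix.sub_mulVec, Matrix.smul_mulVec,
      dotProduct_sub, dotProduct_smul, smul_eq_mul]
    change q v1 - κ * r v1 = 0
    rw [hκ, div_mul_cancel₀ _ (hrpos v1 (hsne v1 hv1)).ne', sub_self]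
  have hprin : IsPrincipalCurvature Y x κ := by
    apply Module.End.hasEigenvalue_of_hasEigenvector (x := v1.ofLp)
    rw [Module.End.hasEigenvector_iff]
    refine ⟨Module.End.mem_eigenspace_iff.2 ?_, fun h => hsne v1 hv1 (by ext i; exact congrFun h i)⟩
    rw [Matrix.toLin'_apply, weingarten, ← Matrix.mulVec_mulVec]
    rw [Matrix.sub_mulVec, Matrix.smul_mulVec, sub_eq_zero] at hz
    rw [hz, Matrix.mulVec_smul, Matrix.mulVec_mulVec, Matrix.nonsing_inv_mul _
      (hY.firstForm_posDef x).det_pos.ne'.isUnit, Matrix.one_mulVec]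
  have h2 := hall v0
  have h4 := hY.dotProduct_secondForm x v0.ofLp
  have h5 := hY.dotProduct_firstForm x v0.ofLp
  simp only [q, r, h4, h5] at h2
  exact ⟨κ, hprin, h2⟩

lemma curvatureBound_of_forall {c : ℝ} (hc : ∀ x κ, IsPrincipalCurvature Y x κ → c ≤ κ) :
    CurvatureBound Y c := by
  intro x w hw
  by_cases hw0 : w = 0
  · simp [hw0]
  obtain ⟨κ, hκ, hle⟩ := hY.exists_isPrincipalCurvature_le x hw hw0
  exact (mul_le_mul_of_nonneg_right (hc x κ hκ) (sq_nonneg _)).trans hle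

end IsStrictlyConvexEmbedding

/-! ### Support functions and pairs of dual hypersurfaces -/

/-- The support function of the hypersurface `Y`, extended homogeneously to the whole space. -/
def supExt (Y : Sph d → Euc d) (q : Euc d) : ℝ := sSup (range fun x => ⟪Y x, q⟫)

lemma le_supExt {Y : Sph d → Euc d} (hY : Continuous Y) (q : Euc d) (x : Sph d) :
    ⟪Y x, q⟫ ≤ supExt Y q :=
  le_csSup (isCompact_range (by fun_prop)).bddAbove ⟨x, rfl⟩

lemma supExt_eq_of_le {Y : Sph d → Euc d} {q : Euc d} {x : Sph d}
    (h : ∀ z, ⟪Y z, q⟫ ≤ ⟪Y x, q⟫) : supExt Y q = ⟪Y x, q⟫ :=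
  IsGreatest.csSup_eq ⟨⟨x, rfl⟩, by rintro _ ⟨z, rfl⟩; exact h z⟩

lemma exists_supExt_eq {Y : Sph d → Euc d} (hY : Continuous Y) (q : Euc d) :
    ∃ x, supExt Y q = ⟪Y x, q⟫ := by
  obtain ⟨x, -, hx⟩ := isCompact_univ.exists_isMaxOn (univ_nonempty (α := Sph d))
    (f := fun z => ⟪Y z, q⟫) (by fun_prop)
  exact ⟨x, supExt_eq_of_le fun z => hx (mem_univ z)⟩

lemma supExt_smul {Y : Sph d → Euc d} (hY : Continuous Y) {c : ℝ} (hc : 0 ≤ c) (q : Euc d) :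
    supExt Y (c • q) = c * supExt Y q := by
  obtain ⟨x, hx⟩ := exists_supExt_eq hY q
  rw [hx, supExt_eq_of_le (x := x), inner_smul_right]
  intro z
  rw [inner_smul_right, inner_smul_right]
  exact mul_le_mul_of_nonneg_left (hx ▸ le_supExt hY q z) hc

lemma supportFn_eq_supExt (Y : Sph d → Euc d) (x : Sph d) :
    supportFn (range Y) x = supExt Y (x : Euc d) := by
  rw [supportFn, supExt, ← range_comp]
  rfl

/-- A pair of smooth families of closed hypersurfaces which are polar dual to each other; the
normals of the first one are the directions of the second one. -/
structure DualFamily (Y p : Sph d → ℝ → Euc d) (I : Set ℝ) : Prop where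
  smooth_left : ContDiffOn ℝ ∞ (fun q : Euc d × ℝ => conicExt (fun z => Y z q.2) q.1)
    ({0}ᶜ ×ˢ I)
  smooth_right : ContDiffOn ℝ ∞ (fun q : Euc d × ℝ => conicExt (fun z => p z q.2) q.1)
    ({0}ᶜ ×ˢ I)
  inner_self : ∀ t ∈ I, ∀ x, ⟪Y x t, p x t⟫ = 1
  inner_lt : ∀ t ∈ I, ∀ x z, x ≠ z → ⟪Y x t, p z t⟫ < 1
  injective : ∀ t ∈ I, ∀ x : Sph d,
    Function.Injective (fderiv ℝ (conicExt fun z => p z t) (x : Euc d))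
  surj : ∀ t ∈ I, ∀ q : Sph d, ∃ x, direction (p x t) = q

namespace DualFamily

variable {Y p : Sph d → ℝ → Euc d} {I : Set ℝ} (h : DualFamily Y p I)
include h

lemma inner_le {t : ℝ} (ht : t ∈ I) (x z : Sph d) : ⟪Y x t, p z t⟫ ≤ 1 := by
  by_cases hxz : x = z
  · rw [hxz, h.inner_self t ht]
  · exact (h.inner_lt t ht x z hxz).le

lemma right_ne_zero {t : ℝ} (ht : t ∈ I) (x : Sph d) : p x t ≠ 0 := by
  intro h0
  have := h.inner_self t ht x
  simp [h0] at this

lemma continuousOn_left : ContinuousOn (fun q : Sph d × ℝ => Y q.1 q.2) (univ ×ˢ I) := by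
  have h1 := h.smooth_left.continuousOn.comp
    (f := fun q : Sph d × ℝ => ((q.1 : Euc d), q.2)) (s := univ ×ˢ I) (by fun_prop)
    (fun q hq => ⟨sph_ne_zero q.1, hq.2⟩)
  simpa [Function.comp_def] using h1

lemma continuousOn_right : ContinuousOn (fun q : Sph d × ℝ => p q.1 q.2) (univ ×ˢ I) := by
  have h1 := h.smooth_right.continuousOn.comp
    (f := fun q : Sph d × ℝ => ((q.1 : Euc d), q.2)) (s := univ ×ˢ I) (by fun_prop)
    (fun q hq => ⟨sph_ne_zero q.1, hq.2⟩)
  simpa [Function.comp_def] using h1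

lemma continuous_left {t : ℝ} (ht : t ∈ I) : Continuous fun x => Y x t := by
  rw [← continuousOn_univ]
  exact h.continuousOn_left.comp (f := fun x : Sph d => (x, t)) (by fun_prop)
    (fun x _ => ⟨mem_univ _, ht⟩)

lemma supExt_right {t : ℝ} (ht : t ∈ I) (x : Sph d) : supExt (fun z => Y z t) (p x t) = 1 := by
  rw [supExt_eq_of_le (x := x), h.inner_self t ht]
  intro z
  rw [h.inner_self t ht]; exact h.inner_le ht z x

/-- The dual hypersurface is the unit level of the support function, so in the conic coordinates of
`p` the support function is simply the norm. -/
lemma supExt_conicExt {t : ℝ} (ht : t ∈ I) (y : Euc d) :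
    supExt (fun z => Y z t) (conicExt (fun z => p z t) y) = ‖y‖ := by
  rw [conicExt, supExt_smul (h.continuous_left ht) (norm_nonneg y), h.supExt_right ht, mul_one]

lemma exists_conicExt_eq {t : ℝ} (ht : t ∈ I) {q : Euc d} (hq : q ≠ 0) :
    ∃ y, y ≠ 0 ∧ conicExt (fun z => p z t) y = q := by
  obtain ⟨x, hx⟩ := h.surj t ht (direction q)
  have h1 := norm_pos_iff.2 (h.right_ne_zero ht x)
  have h2 := norm_pos_iff.2 hq
  refine ⟨(‖q‖ * ‖p x t‖⁻¹) • (x : Euc d), smul_ne_zero (by positivity) (sph_ne_zero x), ?_⟩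
  rw [conicExt_smul _ (by positivity), conicExt_coe, mul_smul, ← coe_direction
    (h.right_ne_zero ht x), hx, norm_smul_direction hq]

lemma contDiffAt_right (hI : IsOpen I) {t : ℝ} (ht : t ∈ I) {y : Euc d} (hy : y ≠ 0) :
    ContDiffAt ℝ ∞ (fun q : Euc d × ℝ => conicExt (fun z => p z q.2) q.1) (y, t) :=
  h.smooth_right.contDiffAt ((isOpen_compl_singleton.prod hI).mem_nhds ⟨hy, ht⟩)

lemma contDiffAt_right_slice (hI : IsOpen I) {t : ℝ} (ht : t ∈ I) {y : Euc d} (hy : y ≠ 0) :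
    ContDiffAt ℝ ∞ (conicExt (fun z => p z t)) y :=
  ContDiffAt.comp (g := fun q : Euc d × ℝ => conicExt (fun z => p z q.2) q.1)
    (f := fun y => (y, t)) y (h.contDiffAt_right hI ht hy)
    (contDiffAt_id.prodMk contDiffAt_const)

lemma contDiffAt_left (hI : IsOpen I) {t : ℝ} (ht : t ∈ I) {y : Euc d} (hy : y ≠ 0) :
    ContDiffAt ℝ ∞ (fun q : Euc d × ℝ => conicExt (fun z => Y z q.2) q.1) (y, t) :=
  h.smooth_left.contDiffAt ((isOpen_compl_singleton.prod hI).mem_nhds ⟨hy, ht⟩)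

lemma differentiableAt_left_time (hI : IsOpen I) {t : ℝ} (ht : t ∈ I) (x : Sph d) :
    DifferentiableAt ℝ (fun s => Y x s) t := by
  have h1 := (h.contDiffAt_left hI ht (sph_ne_zero x)).comp t
    (f := fun s : ℝ => ((x : Euc d), s)) (contDiffAt_const.prodMk contDiffAt_id)
  have h2 := h1.differentiableAt (by simp)
  simpa [Function.comp_def] using h2

/-- The support function is smooth. -/
lemma contDiffAt_supExt (hI : IsOpen I) {t : ℝ} (ht : t ∈ I) {q : Euc d} (hq : q ≠ 0) :
    ContDiffAt ℝ ∞ (fun w : Euc d × ℝ => supExt (fun z => Y z w.2) w.1) (q, t) := by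
  obtain ⟨y, hy, rfl⟩ := h.exists_conicExt_eq ht hq
  set f : Euc d × ℝ → Euc d := fun q => conicExt (fun z => p z q.2) q.1 with hf
  -- Conic coordinates given by `p`, with time carried along. The differential is injective, so Φ is
  -- locally invertible, and the support function is the norm of the spatial part of the inverse.
  let Φ : Euc d × ℝ → Euc d × ℝ := fun w => (f w, w.2)
  have hfs : ContDiffAt ℝ ∞ f (y, t) := h.contDiffAt_right hI ht hy
  have hΦ : ContDiffAt ℝ ∞ Φ (y, t) := hfs.prodMk contDiffAt_snd
  have hΦ' : HasFDerivAt Φ ((fderiv ℝ f (y, t)).prod (ContinuousLinearMap.snd ℝ (Euc d) ℝ))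
      (y, t) := (hfs.differentiableAt (by simp)).hasFDerivAt.prodMk hasFDerivAt_snd
  have hslice : ∀ v, fderiv ℝ f (y, t) (v, 0) = fderiv ℝ (conicExt (fun z => p z t)) y v := by
    intro v
    have h1 := (hfs.differentiableAt (by simp)).hasFDerivAt.comp y
      (hasFDerivAt_prodMk_left (𝕜 := ℝ) y t)
    have h2 : HasFDerivAt (conicExt (fun z => p z t)) _ y := h1
    rw [h2.fderiv]; simp
  have hyinj : Function.Injective (fderiv ℝ (conicExt (fun z => p z t)) y) := by
    have := h.injective t ht (direction y)
    rwa [← fderiv_conicExt_smul _ (norm_pos_iff.2 hy), norm_smul_direction hy] at this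
  have hinj : Function.Injective
      ((fderiv ℝ f (y, t)).prod (ContinuousLinearMap.snd ℝ (Euc d) ℝ)).toLinearMap := by
    rw [injective_iff_map_eq_zero]
    rintro ⟨v, s⟩ hvs
    have h1 : fderiv ℝ f (y, t) (v, s) = 0 := congrArg Prod.fst hvs
    have h2 : s = 0 := congrArg Prod.snd hvs
    subst h2
    rw [hslice] at h1
    rw [hyinj (h1.trans (map_zero _).symm)]; rfl
  let e : (Euc d × ℝ) ≃L[ℝ] (Euc d × ℝ) :=
    (LinearEquiv.ofInjectiveEndo _ hinj).toContinuousLinearEquiv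
  have he : HasFDerivAt Φ (e : (Euc d × ℝ) →L[ℝ] (Euc d × ℝ)) (y, t) := by
    exact hΦ'.congr_fderiv (ContinuousLinearMap.ext fun w => rfl)
  have h0 : (∞ : WithTop ℕ∞) ≠ 0 := by simp
  have hG := hΦ.to_localInverse he h0
  have hGe : (hΦ.localInverse he h0) (Φ (y, t)) = (y, t) := hΦ.localInverse_apply_image he h0
  have hright := (hΦ.hasStrictFDerivAt' he h0).eventually_right_inverse
  have hmem : ∀ᶠ w in 𝓝 (Φ (y, t)), hΦ.localInverse he h0 w ∈ ({0}ᶜ : Set (Euc d)) ×ˢ I := by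
    have hc := hG.continuousAt
    apply hc.eventually_mem
    rw [hGe]
    exact (isOpen_compl_singleton.prod hI).mem_nhds ⟨hy, ht⟩
  have hnorm : ContDiffAt ℝ ∞ (fun w => ‖(hΦ.localInverse he h0 w).1‖) (Φ (y, t)) := by
    have h1 : ContDiffAt ℝ ∞ (fun z : Euc d × ℝ => ‖z.1‖)
        ((hΦ.localInverse he h0) (Φ (y, t))) := by
      rw [hGe]
      exact (contDiffAt_norm ℝ hy).comp (y, t) contDiffAt_fst
    exact h1.comp _ hG
  refine hnorm.congr_of_eventuallyEq ?_
  filter_upwards [hright, hmem] with w hw1 hw2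
  replace hw1 : Φ (hΦ.localInverse he h0 w) = w := hw1
  have h3 : f (hΦ.localInverse he h0 w) = w.1 := congrArg Prod.fst hw1
  have h4 : (hΦ.localInverse he h0 w).2 = w.2 := by
    have := congrArg Prod.snd hw1
    exact this
  rw [← h4, ← h3]
  exact h.supExt_conicExt hw2.2 _

lemma contDiffOn_supExt (hI : IsOpen I) :
    ContDiffOn ℝ ∞ (fun w : Euc d × ℝ => supExt (fun z => Y z w.2) w.1) ({0}ᶜ ×ˢ I) :=
  fun _ hw => (h.contDiffAt_supExt hI hw.2 hw.1).contDiffWithinAt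

/-- First derivatives of the support function, by the envelope theorem. -/
lemma hasFDerivAt_supExt (hI : IsOpen I) {t : ℝ} (ht : t ∈ I) {y : Euc d} (hy : y ≠ 0)
    (v : Euc d) (s : ℝ) :
    fderiv ℝ (fun w : Euc d × ℝ => supExt (fun z => Y z w.2) w.1)
      (conicExt (fun z => p z t) y, t) (v, s) =
      ⟪Y (direction y) t, v⟫ +
        s * ⟪deriv (fun s => Y (direction y) s) t, conicExt (fun z => p z t) y⟫ := by
  set x := direction y with hx
  set q := conicExt (fun z => p z t) y with hq
  have hq0 : q ≠ 0 := smul_ne_zero (norm_ne_zero_iff.2 hy) (h.right_ne_zero ht x)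
  have h1 := ((h.contDiffAt_supExt hI ht hq0).differentiableAt (by simp)).hasFDerivAt
  have h2 : HasFDerivAt (fun w : Euc d × ℝ => Y x w.2)
      ((ContinuousLinearMap.toSpanSingleton ℝ (deriv (fun s => Y x s) t)).comp
        (ContinuousLinearMap.snd ℝ (Euc d) ℝ)) (q, t) :=
    HasFDerivAt.comp (q, t) (h.differentiableAt_left_time hI ht x).hasDerivAt.hasFDerivAt
      hasFDerivAt_snd
  have h3 := h2.inner ℝ (hasFDerivAt_fst (𝕜 := ℝ) (p := (q, t)))
  -- For fixed `x` the function ⟨Y x, ·⟩ touches the support function from below at this point and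
  -- at this time, so the joint differentials agree.
  have hmin : IsLocalMin (fun w : Euc d × ℝ => supExt (fun z => Y z w.2) w.1 - ⟪Y x w.2, w.1⟫)
      (q, t) := by
    have : ∀ᶠ w : Euc d × ℝ in 𝓝 (q, t), w.2 ∈ I :=
      continuousAt_snd.eventually_mem (hI.mem_nhds ht)
    filter_upwards [this] with w hw
    have e1 : supExt (fun z => Y z t) q - ⟪Y x t, q⟫ = 0 := by
      rw [hq, h.supExt_conicExt ht, conicExt, inner_smul_right, ← hx, h.inner_self t ht, mul_one,
        sub_self]
    simp only [e1]
    exact sub_nonneg.2 (le_supExt (h.continuous_left hw) w.1 x)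
  have h4 := hmin.hasFDerivAt_eq_zero (h1.sub h3)
  have h5 := congrArg (fun L => L (v, s)) (sub_eq_zero.1 h4)
  simp only at h5
  rw [h5]
  simp [real_inner_smul_left]

end DualFamily

/-! ### Determinant inequalities for positive semidefinite forms -/

/-- Hadamard's inequality for positive semidefinite matrices. -/
lemma det_le_prod_diag {ι : Type*} [Fintype ι] [DecidableEq ι] {M : Matrix ι ι ℝ}
    (hM : M.PosSemidef) : M.det ≤ ∏ i, M i i := by
  by_cases h0 : M.det = 0
  · rw [h0]; exact Finset.prod_nonneg fun i _ => hM.diag_nonneg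
  have hpd : M.PosDef := hM.posDef_iff_det_ne_zero.2 h0
  have hdiag : ∀ i, 0 < M i i := fun i => hpd.diag_pos
  -- Conjugating by this diagonal matrix makes all diagonal entries one, so the eigenvalues sum to
  -- the dimension and 1 + x ≤ exp x bounds their product by one.
  let D : Matrix ι ι ℝ := Matrix.diagonal fun i => (Real.sqrt (M i i))⁻¹
  have hD : D.conjTranspose = D := by simp [D]
  have hN : (D.conjTranspose * M * D).PosSemidef := hM.conjTranspose_mul_mul_same D
  rw [hD] at hN
  have hNii : ∀ i, (D * M * D) i i = 1 := by
    intro i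
    simp only [D, Matrix.mul_diagonal, Matrix.diagonal_mul]
    have h1 := Real.mul_self_sqrt (hdiag i).le
    have h2 := (Real.sqrt_pos.2 (hdiag i)).ne'
    field_simp
    linarith
  have htr : ∑ i, hN.isHermitian.eigenvalues i = Fintype.card ι := by
    have := hN.isHermitian.trace_eq_sum_eigenvalues
    simp only [Matrix.trace, Matrix.diag, hNii] at this
    simpa using this.symm
  have hdet : (D * M * D).det ≤ 1 := by
    rw [hN.isHermitian.det_eq_prod_eigenvalues]
    simp only [RCLike.ofReal_real_eq_id, id_eq]
    calc ∏ i, hN.isHermitian.eigenvalues i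
        ≤ ∏ i, Real.exp (hN.isHermitian.eigenvalues i - 1) :=
          Finset.prod_le_prod (fun i _ => hN.eigenvalues_nonneg i) fun i _ => by
            have := Real.add_one_le_exp (hN.isHermitian.eigenvalues i - 1); linarith
      _ = 1 := by
          rw [← Real.exp_sum, Finset.sum_sub_distrib, htr]; simp
  have hdD : D.det * D.det = (∏ i, M i i)⁻¹ := by
    simp only [D, Matrix.det_diagonal]
    rw [← Finset.prod_mul_distrib, ← Finset.prod_inv_distrib]
    refine Finset.prod_congr rfl fun i _ => ?_
    rw [← mul_inv, Real.mul_self_sqrt (hdiag i).le]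
  have hp : 0 < ∏ i, M i i := Finset.prod_pos fun i _ => hdiag i
  rw [Matrix.det_mul, Matrix.det_mul] at hdet
  have h3 : M.det * (D.det * D.det) ≤ 1 := by linarith
  rw [hdD] at h3
  rwa [← div_eq_mul_inv, div_le_one hp] at h3

/-- Changing the rank one part of an operator with kernel spanned by a unit vector `e`. -/
lemma det_add_rankOne_of_kernel {S : Euc d →L[ℝ] Euc d} {e : Euc d} (he : ⟪e, e⟫ = 1)
    (hS : ∀ u v, ⟪S u, v⟫ = ⟪S v, u⟫) (hSe : S e = 0) (c : Euc d) :
    (S + (innerSL ℝ c).smulRight c).det = ⟪c, e⟫ ^ 2 * (S + (innerSL ℝ e).smulRight e).det := by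
  set T := S + (innerSL ℝ e).smulRight e with hT
  have hTe : T e = e := by
    rw [hT, add_apply, hSe, ContinuousLinearMap.smulRight_apply, innerSL_apply_apply, he]
    simp
  have h1 := det_comp_one_add_rankOne T e (c - e)
  rw [hTe] at h1
  have h2 := det_comp_one_add_rankOne (ContinuousLinearMap.id ℝ (Euc d)) (c - e) e
  -- Both factors are rank one perturbations, and each contributes one factor ⟨c, e⟩ = 1 + ⟨c - e,
  -- e⟩. The composition is as claimed because the range of `S` is orthogonal to `e`.
  have h3 : S + (innerSL ℝ c).smulRight c =
      (ContinuousLinearMap.id ℝ (Euc d) + (innerSL ℝ e).smulRight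
        (ContinuousLinearMap.id ℝ (Euc d) (c - e))).comp
        (T + (innerSL ℝ (c - e)).smulRight e) := by
    ext1 v
    have h4 : ⟪e, S v⟫ = 0 := by rw [real_inner_comm, hS, hSe, inner_zero_left]
    simp only [hT, add_apply, ContinuousLinearMap.smulRight_apply, innerSL_apply_apply,
      ContinuousLinearMap.comp_apply, ContinuousLinearMap.id_apply, inner_add_right,
      inner_smul_right, h4, he, inner_sub_left]
    module
  have h5 : ∀ A B : Euc d →L[ℝ] Euc d, (A.comp B).det = A.det * B.det := by
    intro A B
    exact LinearMap.det_comp A.toLinearMap B.toLinearMap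
  rw [h3, h5, h1, h2]
  have h6 : (ContinuousLinearMap.id ℝ (Euc d)).det = 1 := LinearMap.det_id
  rw [h6, inner_sub_left, inner_sub_right, he, real_inner_comm c e]
  ring

/-- Upper bound for the determinant of the Hessian of a homogeneous function at `q + s w` by a
product of diagonal entries with respect to a sheared frame. -/
lemma det_le_prod_sheared (b : OrthonormalBasis (Fin (d + 1)) ℝ (Euc d))
    {S : Euc d →L[ℝ] Euc d} (hS : ∀ u v, ⟪S u, v⟫ = ⟪S v, u⟫) (hpos : ∀ v, 0 ≤ ⟪S v, v⟫)
    {w : Euc d} (hw : ⟪b 0, w⟫ = 0) {s : ℝ} (hker : S (b 0 + s • w) = 0)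
    (c : Fin d → ℝ) (hc : ∑ k : Fin d, c k * ⟪b k.succ, w⟫ = 0) :
    (S + (innerSL ℝ (b 0)).smulRight (b 0)).det ≤
      ∏ k : Fin d, ⟪S (b k.succ + (s * c k) • w), b k.succ + (s * c k) • w⟫ := by
  set R := S + (innerSL ℝ (b 0)).smulRight (b 0) with hR
  have hRv : ∀ u v, ⟪R u, v⟫ = ⟪S u, v⟫ + ⟪b 0, u⟫ * ⟪b 0, v⟫ := by
    intro u v; simp [hR, inner_add_left, real_inner_smul_left]
  -- The shear v ↦ v + ⟨γ, v⟩ w sends `b 0` to the kernel vector and each `b k.succ` to the tilted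
  -- vector of the statement. It has determinant one because γ is orthogonal to `w`, and this is the
  -- role of `hc`.
  let γ : Euc d := s • (b 0 + ∑ k : Fin d, c k • b k.succ)
  have hγ0 : ⟪γ, b 0⟫ = s := by
    simp [γ, real_inner_smul_left, inner_add_left, sum_inner, b.inner_eq_ite]
  have hγk : ∀ k : Fin d, ⟪γ, b k.succ⟫ = s * c k := by
    intro k
    simp [γ, real_inner_smul_left, inner_add_left, sum_inner, b.inner_eq_ite,
      (Fin.succ_ne_zero k).symm]
  have hγw : ⟪γ, w⟫ = 0 := by
    simp only [γ, real_inner_smul_left, inner_add_left, sum_inner, hw, hc]; ring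
  let G := ContinuousLinearMap.id ℝ (Euc d) + (innerSL ℝ γ).smulRight
    (ContinuousLinearMap.id ℝ (Euc d) w)
  have hG : ∀ v, G v = v + ⟪γ, v⟫ • w := by intro v; simp [G]
  have hGdet : G.det = 1 := by
    have h1 := det_comp_one_add_rankOne (ContinuousLinearMap.id ℝ (Euc d)) w γ
    have h6 : (ContinuousLinearMap.id ℝ (Euc d)).det = 1 := LinearMap.det_id
    rw [hγw, add_zero, mul_one, h6] at h1
    exact h1
  have h5 : ∀ A B : Euc d →L[ℝ] Euc d, (A.comp B).det = A.det * B.det := by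
    intro A B
    exact LinearMap.det_comp A.toLinearMap B.toLinearMap
  have hgram : (Matrix.of fun i j => ⟪b i, b j⟫) = (1 : Matrix (Fin (d + 1)) (Fin (d + 1)) ℝ) := by
    ext i j; simp [b.inner_eq_ite, Matrix.one_apply]
  have h7 := det_inner_comp (by simp) (R.comp G) G b
  rw [hgram, h5, hGdet, Matrix.det_one, mul_one, mul_one, mul_one] at h7
  have hsymm : ∀ u v, ⟪R u, v⟫ = ⟪R v, u⟫ := by
    intro u v; rw [hRv, hRv, hS]; ring
  have hpsd : (Matrix.of fun i j => ⟪(R.comp G) (b i), G (b j)⟫).PosSemidef := by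
    apply Matrix.PosSemidef.of_dotProduct_mulVec_nonneg
    · ext i j
      simp [hsymm (G (b j))]
    · intro v
      have : star v ⬝ᵥ (Matrix.of fun i j => ⟪(R.comp G) (b i), G (b j)⟫).mulVec v =
          ⟪R (∑ i, v i • G (b i)), ∑ i, v i • G (b i)⟫ := by
        simp only [map_sum, map_smul, sum_inner, inner_sum, real_inner_smul_left, inner_smul_right,
          dotProduct, Matrix.mulVec, star_trivial, Matrix.of_apply, Finset.mul_sum,
          ContinuousLinearMap.comp_apply]
        rw [Finset.sum_comm]
        exact Finset.sum_congr rfl fun i _ => Finset.sum_congr rfl fun j _ => by ring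
      rw [this, hRv]
      exact add_nonneg (hpos _) (mul_self_nonneg _)
  have h8 := det_le_prod_diag hpsd
  rw [h7, Fin.prod_univ_succ] at h8
  refine h8.trans (le_of_eq ?_)
  have h9 : ⟪(R.comp G) (b 0), G (b 0)⟫ = 1 := by
    rw [ContinuousLinearMap.comp_apply, hG, hγ0, hRv, hker, inner_zero_left, inner_add_right,
      inner_smul_right, hw]
    simp
  simp only [Matrix.of_apply, h9, one_mul]
  refine Finset.prod_congr rfl fun k _ => ?_
  have h10 : ⟪b 0, b k.succ + (s * c k) • w⟫ = 0 := by
    rw [inner_add_right, inner_smul_right, hw]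
    simp [b.inner_eq_ite, (Fin.succ_ne_zero k).symm]
  rw [ContinuousLinearMap.comp_apply, hG, hγk, hRv, h10]
  ring

/-! ### Second order jets on the line -/

/-- `f` has value `a`, first derivative `b` and second derivative `c` at `0`. -/
def HasJet (f : ℝ → ℝ) (a b c : ℝ) : Prop :=
  f 0 = a ∧ ∃ f' : ℝ → ℝ, (∀ᶠ s in 𝓝 0, HasDerivAt f (f' s) s) ∧ f' 0 = b ∧ HasDerivAt f' c 0

namespace HasJet

variable {f g : ℝ → ℝ} {a b c a' b' c' : ℝ}

lemma hasDerivAt (hf : HasJet f a b c) : HasDerivAt f b 0 := by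
  obtain ⟨-, f', h1, h2, -⟩ := hf
  rw [← h2]; exact h1.self_of_nhds

lemma const (a : ℝ) : HasJet (fun _ => a) a 0 0 :=
  ⟨rfl, fun _ => 0, .of_forall fun _ => hasDerivAt_const _ _, rfl, hasDerivAt_const _ _⟩

lemma id : HasJet (fun s => s) 0 1 0 :=
  ⟨rfl, fun _ => 1, .of_forall fun s => hasDerivAt_id s, rfl, hasDerivAt_const _ _⟩

lemma add (hf : HasJet f a b c) (hg : HasJet g a' b' c') :
    HasJet (fun s => f s + g s) (a + a') (b + b') (c + c') := by
  obtain ⟨h0, f', h1, h2, h3⟩ := hf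
  obtain ⟨k0, g', k1, k2, k3⟩ := hg
  refine ⟨by simp [h0, k0], fun s => f' s + g' s, ?_, by simp [h2, k2], h3.add k3⟩
  filter_upwards [h1, k1] with s hs ks using hs.add ks

lemma mul (hf : HasJet f a b c) (hg : HasJet g a' b' c') :
    HasJet (fun s => f s * g s) (a * a') (b * a' + a * b') (c * a' + 2 * (b * b') + a * c') := by
  have df := hf.hasDerivAt
  have dg := hg.hasDerivAt
  obtain ⟨h0, f', h1, h2, h3⟩ := hf
  obtain ⟨k0, g', k1, k2, k3⟩ := hg
  refine ⟨by simp [h0, k0], fun s => f' s * g s + f s * g' s, ?_, by simp [h0, k0, h2, k2], ?_⟩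
  · filter_upwards [h1, k1] with s hs ks using hs.mul ks
  · refine ((h3.mul dg).add (df.mul k3)).congr_deriv ?_
    rw [h0, k0, h2, k2]; ring

lemma const_mul (hf : HasJet f a b c) (r : ℝ) :
    HasJet (fun s => r * f s) (r * a) (r * b) (r * c) := by
  simpa using (HasJet.const r).mul hf

lemma sub (hf : HasJet f a b c) (hg : HasJet g a' b' c') :
    HasJet (fun s => f s - g s) (a - a') (b - b') (c - c') := by
  have := hf.add (hg.const_mul (-1))
  simpa [sub_eq_add_neg] using this

lemma sum {ι : Type*} (t : Finset ι) {f : ι → ℝ → ℝ} {a b c : ι → ℝ}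
    (hf : ∀ i ∈ t, HasJet (f i) (a i) (b i) (c i)) :
    HasJet (fun s => ∑ i ∈ t, f i s) (∑ i ∈ t, a i) (∑ i ∈ t, b i) (∑ i ∈ t, c i) := by
  classical
  induction t using Finset.induction_on with
  | empty => simpa using HasJet.const 0
  | insert i t hi ih =>
    simp only [Finset.sum_insert hi]
    exact (hf i (Finset.mem_insert_self i t)).add
      (ih fun j hj => hf j (Finset.mem_insert_of_mem hj))

lemma log (hf : HasJet f a b c) (ha : 0 < a) :
    HasJet (fun s => Real.log (f s)) (Real.log a) (b / a) (c / a - (b / a) ^ 2) := by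
  have df := hf.hasDerivAt
  obtain ⟨h0, f', h1, h2, h3⟩ := hf
  have hne : ∀ᶠ s in 𝓝 0, f s ≠ 0 := by
    apply df.continuousAt.eventually_ne
    rw [h0]; exact ha.ne'
  refine ⟨by simp [h0], fun s => f' s / f s, ?_, by simp [h0, h2], ?_⟩
  · filter_upwards [h1, hne] with s hs hn using hs.log hn
  · refine (h3.div df (by rw [h0]; exact ha.ne')).congr_deriv ?_
    rw [h0, h2]
    field_simp

lemma congr (hf : HasJet f a b c) (h : g =ᶠ[𝓝 0] f) : HasJet g a b c := by
  obtain ⟨h0, f', h1, h2, h3⟩ := hf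
  refine ⟨h.self_of_nhds.trans h0, f', ?_, h2, h3⟩
  filter_upwards [h1, h.eventuallyEq_nhds] with s hs hs' using hs.congr_of_eventuallyEq hs'

/-- A negative second derivative would make the point a local maximum as well; the function would be
locally constant and its second derivative zero. -/
lemma of_isLocalMin (hf : HasJet f a b c) (hm : IsLocalMin f 0) : b = 0 ∧ 0 ≤ c := by
  have hb : b = 0 := hm.hasDerivAt_eq_zero hf.hasDerivAt
  refine ⟨hb, ?_⟩
  by_contra hc
  push Not at hc
  have df := hf.hasDerivAt
  obtain ⟨h0, f', h1, h2, h3⟩ := hf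
  have hderiv : deriv f =ᶠ[𝓝 0] f' := by
    filter_upwards [h1] with s hs using hs.deriv
  have hdd : deriv (deriv f) 0 = c := (h3.congr_of_eventuallyEq hderiv).deriv
  have hmax := isLocalMax_of_deriv_deriv_neg (f := f) (x₀ := 0) (by rw [hdd]; exact hc)
    (by rw [df.deriv, hb]) df.continuousAt
  have hconst : f =ᶠ[𝓝 0] fun _ => f 0 := by
    filter_upwards [hm, hmax] with s hs1 hs2 using le_antisymm hs2 hs1
  have hz : f' =ᶠ[𝓝 0] fun _ => 0 := by
    filter_upwards [h1, hconst.eventuallyEq_nhds] with s hs hs'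
    exact hs.unique ((hasDerivAt_const s (f 0)).congr_of_eventuallyEq hs')
  have := h3.unique ((hasDerivAt_const (0 : ℝ) (0 : ℝ)).congr_of_eventuallyEq hz)
  linarith

/-- Comparison of two functions touching at `0`. -/
lemma compare (hf : HasJet f a b c) (hg : HasJet g a b' c')
    (hle : ∀ᶠ s in 𝓝 0, f s ≤ g s) : b = b' ∧ c ≤ c' := by
  have hm : IsLocalMin (fun s => g s - f s) 0 := by
    filter_upwards [hle] with s hs
    rw [hf.1, hg.1]
    linarith
  have := (hg.sub hf).of_isLocalMin hm
  exact ⟨by linarith [this.1], by linarith [this.2]⟩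

end HasJet

/-! ### Directional derivatives in space-time and homogeneity -/

/-- Directional derivative in space-time. -/
def dd (e : Euc d × ℝ) (F : Euc d × ℝ → ℝ) (p : Euc d × ℝ) : ℝ := fderiv ℝ F p e

/-- Spatial directional derivative. -/
def ds (v : Euc d) (F : Euc d × ℝ → ℝ) : Euc d × ℝ → ℝ := dd (v, 0) F

/-- Time derivative. -/
def dt (F : Euc d × ℝ → ℝ) : Euc d × ℝ → ℝ := dd (0, 1) F

section Basic

variable {U : Set (Euc d × ℝ)} {F G : Euc d × ℝ → ℝ}

lemma contDiffOn_dd (hU : IsOpen U) (hF : ContDiffOn ℝ ∞ F U) (e : Euc d × ℝ) :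
    ContDiffOn ℝ ∞ (dd e F) U :=
  (hF.fderiv_of_isOpen hU (m := ∞) (by simp)).clm_apply contDiffOn_const

lemma contDiffOn_ds (hU : IsOpen U) (hF : ContDiffOn ℝ ∞ F U) (v : Euc d) :
    ContDiffOn ℝ ∞ (ds v F) U := contDiffOn_dd hU hF _

lemma differentiableAt_of_contDiffOn (hU : IsOpen U) (hF : ContDiffOn ℝ ∞ F U) {p : Euc d × ℝ}
    (hp : p ∈ U) : DifferentiableAt ℝ F p :=
  (hF.contDiffAt (hU.mem_nhds hp)).differentiableAt (by simp)

lemma dd_dd (hU : IsOpen U) (hF : ContDiffOn ℝ ∞ F U) {p : Euc d × ℝ} (hp : p ∈ U)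
    (e e' : Euc d × ℝ) : dd e (dd e' F) p = fderiv ℝ (fderiv ℝ F) p e e' := by
  have h1 : DifferentiableAt ℝ (fderiv ℝ F) p :=
    ((hF.contDiffAt (hU.mem_nhds hp)).fderiv_right (m := ∞) (by simp)).differentiableAt (by simp)
  have h2 : HasFDerivAt (dd e' F) _ p := h1.hasFDerivAt.clm_apply (hasFDerivAt_const e' p)
  rw [dd, h2.fderiv]
  simp

lemma dd_comm (hU : IsOpen U) (hF : ContDiffOn ℝ ∞ F U) {p : Euc d × ℝ} (hp : p ∈ U)
    (e e' : Euc d × ℝ) : dd e (dd e' F) p = dd e' (dd e F) p := by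
  rw [dd_dd hU hF hp, dd_dd hU hF hp]
  exact ((hF.contDiffAt (hU.mem_nhds hp)).isSymmSndFDerivAt
    (by simpa using (by exact_mod_cast le_top : ((2 : ℕ∞) : WithTop ℕ∞) ≤ ∞))) e e'

lemma ds_comm (hU : IsOpen U) (hF : ContDiffOn ℝ ∞ F U) {p : Euc d × ℝ} (hp : p ∈ U)
    (v v' : Euc d) : ds v (ds v' F) p = ds v' (ds v F) p := dd_comm hU hF hp _ _

lemma dd_congr (hU : IsOpen U) (hFG : EqOn F G U) (e : Euc d × ℝ) : EqOn (dd e F) (dd e G) U := by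
  intro p hp
  have : F =ᶠ[𝓝 p] G := by
    filter_upwards [hU.mem_nhds hp] with z hz using hFG hz
  rw [dd, dd, this.fderiv_eq]

lemma ds_congr (hU : IsOpen U) (hFG : EqOn F G U) (v : Euc d) : EqOn (ds v F) (ds v G) U :=
  dd_congr hU hFG _

lemma ds_sum_smul {ι : Type*} (t : Finset ι) (a : ι → ℝ) (v : ι → Euc d) (F : Euc d × ℝ → ℝ)
    (p : Euc d × ℝ) : ds (∑ i ∈ t, a i • v i) F p = ∑ i ∈ t, a i * ds (v i) F p := by
  have : ((∑ i ∈ t, a i • v i, 0) : Euc d × ℝ) = ∑ i ∈ t, a i • ((v i, 0) : Euc d × ℝ) := by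
    rw [Prod.ext_iff]; simp [Prod.fst_sum, Prod.snd_sum]
  rw [ds, dd, this, map_sum]
  exact Finset.sum_congr rfl fun i _ => by rw [map_smul]; rfl

lemma ds_smul (c : ℝ) (v : Euc d) (F : Euc d × ℝ → ℝ) (p : Euc d × ℝ) :
    ds (c • v) F p = c * ds v F p := by
  have : ((c • v, 0) : Euc d × ℝ) = c • ((v, 0) : Euc d × ℝ) := by simp
  rw [ds, dd, this, map_smul]; rfl

lemma hasDerivAt_line (hU : IsOpen U) (hF : ContDiffOn ℝ ∞ F U) {p e : Euc d × ℝ} {s : ℝ}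
    (hp : p + s • e ∈ U) : HasDerivAt (fun s => F (p + s • e)) (dd e F (p + s • e)) s := by
  have h1 : HasDerivAt (fun s : ℝ => p + s • e) e s := by
    simpa using ((hasDerivAt_id s).smul_const e).const_add p
  exact (differentiableAt_of_contDiffOn hU hF hp).hasFDerivAt.comp_hasDerivAt s h1

lemma eventually_line_mem (hU : IsOpen U) {p : Euc d × ℝ} (hp : p ∈ U) (e : Euc d × ℝ) :
    ∀ᶠ s in 𝓝 (0 : ℝ), p + s • e ∈ U := by
  have : ContinuousAt (fun s : ℝ => p + s • e) 0 := by fun_prop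
  apply this.eventually_mem
  simpa using hU.mem_nhds hp

lemma hasJet_line (hU : IsOpen U) (hF : ContDiffOn ℝ ∞ F U) {p : Euc d × ℝ} (hp : p ∈ U)
    (e : Euc d × ℝ) : HasJet (fun s => F (p + s • e)) (F p) (dd e F p) (dd e (dd e F) p) := by
  refine ⟨by simp, fun s => dd e F (p + s • e), ?_, by simp, ?_⟩
  · filter_upwards [eventually_line_mem hU hp e] with s hs using hasDerivAt_line hU hF hs
  · have := hasDerivAt_line hU (contDiffOn_dd hU hF e) (p := p) (e := e) (s := 0) (by simpa using hp)
    simpa using this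

end Basic

/-- The spatial gradient. -/
def spGrad (F : Euc d × ℝ → ℝ) (p : Euc d × ℝ) : Euc d :=
  ∑ i, ds (EuclideanSpace.basisFun (Fin (d + 1)) ℝ i) F p •
    EuclideanSpace.basisFun (Fin (d + 1)) ℝ i

/-- The spatial Hessian. -/
def spHess (F : Euc d × ℝ → ℝ) (p : Euc d × ℝ) : Euc d →L[ℝ] Euc d :=
  ∑ i, ((fderiv ℝ (ds (EuclideanSpace.basisFun (Fin (d + 1)) ℝ i) F) p).comp
    (ContinuousLinearMap.inl ℝ (Euc d) ℝ)).smulRight (EuclideanSpace.basisFun (Fin (d + 1)) ℝ i)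

lemma inner_spGrad (F : Euc d × ℝ → ℝ) (p : Euc d × ℝ) (v : Euc d) :
    ⟪spGrad F p, v⟫ = ds v F p := by
  conv_rhs => rw [← (EuclideanSpace.basisFun (Fin (d + 1)) ℝ).sum_repr' v]
  rw [ds_sum_smul, spGrad, sum_inner]
  exact Finset.sum_congr rfl fun i _ => by rw [real_inner_smul_left, mul_comm]

lemma spGrad_eq_sum (b : OrthonormalBasis (Fin (d + 1)) ℝ (Euc d)) (F : Euc d × ℝ → ℝ)
    (p : Euc d × ℝ) : spGrad F p = ∑ i, ds (b i) F p • b i := by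
  conv_lhs => rw [← b.sum_repr' (spGrad F p)]
  exact Finset.sum_congr rfl fun i _ => by rw [real_inner_comm, inner_spGrad]

lemma norm_spGrad_sq (b : OrthonormalBasis (Fin (d + 1)) ℝ (Euc d)) (F : Euc d × ℝ → ℝ)
    (p : Euc d × ℝ) : ‖spGrad F p‖ ^ 2 = ∑ i, ds (b i) F p * ds (b i) F p := by
  rw [← b.sum_sq_norm_inner_left (spGrad F p)]
  refine Finset.sum_congr rfl fun i _ => ?_
  rw [inner_spGrad, Real.norm_eq_abs, sq_abs, sq]

section Homogeneous

variable {I : Set ℝ} {F : Euc d × ℝ → ℝ}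

lemma isOpen_domain (hI : IsOpen I) : IsOpen (({0}ᶜ : Set (Euc d)) ×ˢ I) :=
  isOpen_compl_singleton.prod hI

lemma inner_spHess (hI : IsOpen I) (hF : ContDiffOn ℝ ∞ F ({0}ᶜ ×ˢ I)) {p : Euc d × ℝ}
    (hp : p ∈ ({0}ᶜ : Set (Euc d)) ×ˢ I) (u v : Euc d) :
    ⟪spHess F p u, v⟫ = ds u (ds v F) p := by
  rw [ds_comm (isOpen_domain hI) hF hp]
  conv_rhs => rw [← (EuclideanSpace.basisFun (Fin (d + 1)) ℝ).sum_repr' v]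
  rw [ds_sum_smul, spHess, sum_apply, sum_inner]
  refine Finset.sum_congr rfl fun i _ => ?_
  rw [ds_comm (isOpen_domain hI) hF hp]
  simp [real_inner_smul_left, ds, dd, mul_comm]

/-- Positive homogeneity of integral degree in space. -/
def HomDeg (k : ℤ) (I : Set ℝ) (F : Euc d × ℝ → ℝ) : Prop :=
  ∀ c : ℝ, 0 < c → ∀ q : Euc d, q ≠ 0 → ∀ t ∈ I, F (c • q, t) = c ^ k * F (q, t)

/-- Euler's relation, from the derivative of s ↦ F(s q, t) at s = 1. -/
lemma HomDeg.euler {k : ℤ} (h : HomDeg k I F) (hI : IsOpen I)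
    (hF : ContDiffOn ℝ ∞ F ({0}ᶜ ×ˢ I)) {q : Euc d} (hq : q ≠ 0) {t : ℝ} (ht : t ∈ I) :
    ds q F (q, t) = k * F (q, t) := by
  have hd := differentiableAt_of_contDiffOn (isOpen_domain hI) hF (p := (q, t)) ⟨hq, ht⟩
  have h1 : HasDerivAt (fun s : ℝ => ((s • q, t) : Euc d × ℝ)) (q, 0) 1 := by
    have := ((hasDerivAt_id (1 : ℝ)).smul_const q).prodMk (hasDerivAt_const (1 : ℝ) t)
    simpa using this
  have h2 : HasFDerivAt F (fderiv ℝ F (q, t)) ((1 : ℝ) • q, t) := by simpa using hd.hasFDerivAt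
  have h3 : HasDerivAt (fun s : ℝ => F (s • q, t)) (ds q F (q, t)) 1 := h2.comp_hasDerivAt 1 h1
  have h4 : HasDerivAt (fun s : ℝ => s ^ k * F (q, t)) ((k * (1 : ℝ) ^ (k - 1)) * F (q, t)) 1 :=
    (hasDerivAt_zpow k 1 (Or.inl one_ne_zero)).mul_const _
  have h5 : (fun s : ℝ => F (s • q, t)) =ᶠ[𝓝 1] fun s => s ^ k * F (q, t) := by
    filter_upwards [lt_mem_nhds (zero_lt_one (α := ℝ))] with s hs using h s hs q hq t ht
  have h6 := h3.unique (h4.congr_of_eventuallyEq h5)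
  simpa using h6

lemma HomDeg.scale_dd {k : ℤ} (h : HomDeg k I F) (hI : IsOpen I)
    (hF : ContDiffOn ℝ ∞ F ({0}ᶜ ×ˢ I)) {q : Euc d} (hq : q ≠ 0) {t : ℝ} (ht : t ∈ I) {c : ℝ}
    (hc : 0 < c) (v : Euc d) (s : ℝ) :
    dd (c • v, s) F (c • q, t) = c ^ k * dd (v, s) F (q, t) := by
  have hd := differentiableAt_of_contDiffOn (isOpen_domain hI) hF (p := (q, t)) ⟨hq, ht⟩
  have hd' := differentiableAt_of_contDiffOn (isOpen_domain hI) hF (p := (c • q, t))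
    ⟨smul_ne_zero hc.ne' hq, ht⟩
  let L : Euc d × ℝ →L[ℝ] Euc d × ℝ :=
    (c • ContinuousLinearMap.fst ℝ (Euc d) ℝ).prod (ContinuousLinearMap.snd ℝ (Euc d) ℝ)
  have h1 : HasFDerivAt (fun p : Euc d × ℝ => F (L p)) ((fderiv ℝ F (c • q, t)).comp L) (q, t) :=
    HasFDerivAt.comp (q, t) (show HasFDerivAt F _ (L (q, t)) from hd'.hasFDerivAt) L.hasFDerivAt
  have h2 : HasFDerivAt (fun p : Euc d × ℝ => c ^ k * F p) (c ^ k • fderiv ℝ F (q, t)) (q, t) :=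
    hd.hasFDerivAt.const_mul _
  have h3 : (fun p : Euc d × ℝ => F (L p)) =ᶠ[𝓝 (q, t)] fun p => c ^ k * F p := by
    filter_upwards [(isOpen_domain hI).mem_nhds (show (q, t) ∈ _ from ⟨hq, ht⟩)] with p hp
    exact h c hc p.1 hp.1 p.2 hp.2
  have h4 := congrArg (fun A => A (v, s)) (h1.unique (h2.congr_of_eventuallyEq h3))
  simpa [L, dd] using h4

lemma HomDeg.ds {k : ℤ} (h : HomDeg k I F) (hI : IsOpen I)
    (hF : ContDiffOn ℝ ∞ F ({0}ᶜ ×ˢ I)) (v : Euc d) : HomDeg (k - 1) I (ds v F) := by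
  intro c hc q hq t ht
  have h1 := h.scale_dd hI hF hq ht hc v 0
  have h2 : dd (c • v, 0) F (c • q, t) = c * GaussFlow.ds v F (c • q, t) := ds_smul c v F _
  rw [h2] at h1
  change GaussFlow.ds v F (c • q, t) = c ^ (k - 1) * dd (v, 0) F (q, t)
  rw [zpow_sub_one₀ hc.ne']
  field_simp
  linarith

lemma HomDeg.dt {k : ℤ} (h : HomDeg k I F) (hI : IsOpen I)
    (hF : ContDiffOn ℝ ∞ F ({0}ᶜ ×ˢ I)) : HomDeg k I (dt F) := by
  intro c hc q hq t ht
  have h1 := h.scale_dd hI hF hq ht hc 0 1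
  rwa [smul_zero] at h1

end Homogeneous

/-- Jets of the composition of a smooth function with a curve. -/
lemma hasJet_comp {Φ : Euc d → ℝ} (hΦ : ContDiffOn ℝ ∞ Φ {0}ᶜ) {c c' : ℝ → Euc d}
    {x x₁ x₂ : Euc d} (h0 : c 0 = x) (hx : x ≠ 0) (h1 : ∀ᶠ s in 𝓝 0, HasDerivAt c (c' s) s)
    (h2 : c' 0 = x₁) (h3 : HasDerivAt c' x₂ 0) :
    HasJet (fun s => Φ (c s)) (Φ x) (fderiv ℝ Φ x x₁)
      (fderiv ℝ (fderiv ℝ Φ) x x₁ x₁ + fderiv ℝ Φ x x₂) := by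
  have hd : ∀ y ∈ ({0}ᶜ : Set (Euc d)), HasFDerivAt Φ (fderiv ℝ Φ y) y := fun y hy =>
    ((hΦ.contDiffAt (isOpen_compl_singleton.mem_nhds hy)).differentiableAt (by simp)).hasFDerivAt
  have hdd : HasFDerivAt (fderiv ℝ Φ) (fderiv ℝ (fderiv ℝ Φ) x) x :=
    (((hΦ.contDiffAt (isOpen_compl_singleton.mem_nhds hx)).fderiv_right (m := ∞)
      (by simp)).differentiableAt (by simp)).hasFDerivAt
  have hc0 : HasDerivAt c x₁ 0 := h2 ▸ h1.self_of_nhds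
  have hne : ∀ᶠ s in 𝓝 0, c s ≠ 0 := by
    apply hc0.continuousAt.eventually_ne; rwa [h0]
  refine ⟨by simp only [h0], fun s => fderiv ℝ Φ (c s) (c' s), ?_, by simp only [h0, h2], ?_⟩
  · filter_upwards [h1, hne] with s hs hs' using (hd _ hs').comp_hasDerivAt s hs
  · rw [← h0] at hdd
    have h4 := (hdd.comp_hasDerivAt 0 hc0).clm_apply h3
    refine h4.congr_deriv ?_
    simp [h0, h2]

/-! ### The equation of the support function and its logarithm -/

/-- The logarithm of the density `f`, extended to the punctured space. -/
def logDensity (f : Sph d → ℝ) (q : Euc d) : ℝ := Real.log (f (direction q))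

/-- The logarithm of the factor `|X|^n / g(X/|X|)` of the speed. -/
def logFactor (g : Sph d → ℝ) (X : Euc d) : ℝ :=
  (d + 1) * Real.log ‖X‖ - Real.log (g (direction X))

lemma contDiffOn_logDensity {f : Sph d → ℝ} (hf : ContMDiff (𝓡 d) 𝓘(ℝ, ℝ) ∞ f)
    (hf_pos : ∀ x, 0 < f x) : ContDiffOn ℝ ∞ (logDensity f) {0}ᶜ :=
  (contDiffOn_radialExt hf).log fun _ _ => (hf_pos _).ne'

lemma contDiffOn_logFactor {g : Sph d → ℝ} (hg : ContMDiff (𝓡 d) 𝓘(ℝ, ℝ) ∞ g)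
    (hg_pos : ∀ x, 0 < g x) : ContDiffOn ℝ ∞ (logFactor g) {0}ᶜ := by
  have h1 : ContDiffOn ℝ ∞ (fun X : Euc d => Real.log ‖X‖) {0}ᶜ := fun X hX =>
    ((contDiffAt_norm ℝ hX).log (norm_ne_zero_iff.2 hX)).contDiffWithinAt
  exact (contDiffOn_const.mul h1).sub (contDiffOn_logDensity hg hg_pos)

/-- Smooth homogeneous solutions of the evolution equation of the support function. -/
structure SupportSolution (f g : Sph d → ℝ) (C₀ : ℝ) (I : Set ℝ) (H : Euc d × ℝ → ℝ) : Prop where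
  isOpen : IsOpen I
  smooth : ContDiffOn ℝ ∞ H ({0}ᶜ ×ˢ I)
  hom : HomDeg 1 I H
  hess_pos : ∀ q : Sph d, ∀ t ∈ I, ∀ v : Euc d, ⟪(q : Euc d), v⟫ = 0 → v ≠ 0 →
    0 < ⟪spHess H (q, t) v, v⟫
  equation : ∀ q : Sph d, ∀ t ∈ I, (H (q, t) - dt H (q, t)) *
    (spHess H (q, t) + (innerSL ℝ (q : Euc d)).smulRight (q : Euc d)).det =
      f q * (‖spGrad H (q, t)‖ ^ (d + 1) / g (direction (spGrad H (q, t))))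
  lower : ∀ q : Sph d, ∀ t ∈ I, 1 / C₀ ≤ H (q, t)
  upper : ∀ q : Sph d, ∀ t ∈ I, H (q, t) ≤ C₀
  grad_le : ∀ q : Sph d, ∀ t ∈ I, ‖spGrad H (q, t)‖ ≤ C₀

lemma log_le_of_mul_le {F N G V R P : ℝ} (hF : 0 < F) (hN : 0 < N) (hG : 0 < G) (hV : 0 < V)
    (hR : 0 < R) (hP : 0 < P) (h : F * (N ^ (d + 1) / G) ≤ V * (R ^ (d + 1) * P)) :
    Real.log F + ((d + 1) * Real.log N - Real.log G) ≤
      Real.log V + (d + 1) * Real.log R + Real.log P := by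
  have h5 := Real.log_le_log (by positivity) h
  rw [Real.log_mul hF.ne' (by positivity), Real.log_div (by positivity) hG.ne', Real.log_pow,
    Real.log_mul hV.ne' (by positivity), Real.log_mul (by positivity) hP.ne', Real.log_pow] at h5
  push_cast at h5
  linarith

namespace SupportSolution

variable {f g : Sph d → ℝ} {C₀ : ℝ} {I : Set ℝ} {H : Euc d × ℝ → ℝ}
  (h : SupportSolution f g C₀ I H)
include h

lemma isOpenU : IsOpen (({0}ᶜ : Set (Euc d)) ×ˢ I) := isOpen_domain h.isOpen

lemma hom_ds (v : Euc d) : HomDeg 0 I (ds v H) := h.hom.ds h.isOpen h.smooth v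

lemma hom_ds_ds (u v : Euc d) : HomDeg (-1) I (ds u (ds v H)) :=
  (h.hom_ds v).ds h.isOpen (contDiffOn_ds h.isOpenU h.smooth v) u

lemma spGrad_smul {c : ℝ} (hc : 0 < c) {q : Euc d} (hq : q ≠ 0) {t : ℝ} (ht : t ∈ I) :
    spGrad H (c • q, t) = spGrad H (q, t) := by
  apply ext_inner_right ℝ
  intro v
  rw [inner_spGrad, inner_spGrad, h.hom_ds v c hc q hq t ht, zpow_zero, one_mul]

lemma spHess_smul {c : ℝ} (hc : 0 < c) {q : Euc d} (hq : q ≠ 0) {t : ℝ} (ht : t ∈ I) :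
    spHess H (c • q, t) = c⁻¹ • spHess H (q, t) := by
  ext1 u
  apply ext_inner_right ℝ
  intro v
  rw [inner_spHess h.isOpen h.smooth (p := (c • q, t)) ⟨smul_ne_zero hc.ne' hq, ht⟩, h.hom_ds_ds u v c hc q hq t ht,
    smul_apply, real_inner_smul_left, inner_spHess h.isOpen h.smooth (p := (q, t)) ⟨hq, ht⟩, zpow_neg_one]

lemma spHess_symm {q : Euc d} (hq : q ≠ 0) {t : ℝ} (ht : t ∈ I) (u v : Euc d) :
    ⟪spHess H (q, t) u, v⟫ = ⟪spHess H (q, t) v, u⟫ := by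
  rw [inner_spHess h.isOpen h.smooth (p := (q, t)) ⟨hq, ht⟩, inner_spHess h.isOpen h.smooth (p := (q, t)) ⟨hq, ht⟩,
    ds_comm h.isOpenU h.smooth (p := (q, t)) ⟨hq, ht⟩]

lemma spHess_self {q : Euc d} (hq : q ≠ 0) {t : ℝ} (ht : t ∈ I) : spHess H (q, t) q = 0 := by
  apply ext_inner_right ℝ
  intro v
  rw [inner_spHess h.isOpen h.smooth (p := (q, t)) ⟨hq, ht⟩,
    (h.hom_ds v).euler h.isOpen (contDiffOn_ds h.isOpenU h.smooth v) hq ht]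
  simp

lemma spHess_nonneg {q : Euc d} (hq : q ≠ 0) {t : ℝ} (ht : t ∈ I) (v : Euc d) :
    0 ≤ ⟪spHess H (q, t) v, v⟫ := by
  have hn := norm_pos_iff.2 hq
  rw [← norm_smul_direction hq, h.spHess_smul hn (sph_ne_zero _) ht, smul_apply,
    real_inner_smul_left]
  refine mul_nonneg (inv_nonneg.2 hn.le) ?_
  set e := direction q
  set a := ⟪(e : Euc d), v⟫ with ha
  set u := v - a • (e : Euc d) with hu
  have hSe := h.spHess_self (sph_ne_zero e) ht
  have h1 : spHess H ((e : Euc d), t) v = spHess H ((e : Euc d), t) u := by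
    rw [hu, map_sub, map_smul, hSe, smul_zero, sub_zero]
  have h2 : ⟪spHess H ((e : Euc d), t) u, v⟫ = ⟪spHess H ((e : Euc d), t) u, u⟫ := by
    have h3 : ⟪spHess H ((e : Euc d), t) u, (e : Euc d)⟫ = 0 := by
      rw [h.spHess_symm (sph_ne_zero e) ht, hSe, inner_zero_left]
    calc ⟪spHess H ((e : Euc d), t) u, v⟫
        = ⟪spHess H ((e : Euc d), t) u, v⟫ - a * ⟪spHess H ((e : Euc d), t) u, (e : Euc d)⟫ := by
          rw [h3]; ring
      _ = _ := by rw [← inner_smul_right, ← inner_sub_right]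
  rw [h1, h2]
  by_cases hu0 : u = 0
  · simp [hu0]
  · refine (h.hess_pos e t ht u ?_ hu0).le
    rw [hu, inner_sub_right, inner_smul_right, inner_sph_self]; simp [ha]

lemma inner_spGrad_self {q : Euc d} (hq : q ≠ 0) {t : ℝ} (ht : t ∈ I) :
    ⟪spGrad H (q, t), q⟫ = H (q, t) := by
  rw [inner_spGrad, h.hom.euler h.isOpen h.smooth hq ht]; simp

lemma grad_ge (q : Sph d) {t : ℝ} (ht : t ∈ I) :
    1 / C₀ ≤ ‖spGrad H ((q : Euc d), t)‖ := by
  calc 1 / C₀ ≤ ⟪spGrad H ((q : Euc d), t), (q : Euc d)⟫ := by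
        rw [h.inner_spGrad_self (sph_ne_zero q) ht]; exact h.lower q t ht
    _ ≤ ‖spGrad H ((q : Euc d), t)‖ * ‖(q : Euc d)‖ := real_inner_le_norm _ _
    _ = _ := by rw [norm_sph, mul_one]

/-- The logarithm of the equation along the line `q + s w`, in the form of an inequality which is
an equality at `s = 0`. -/
lemma log_equation_le (hC₀ : 0 < C₀) (hf_pos : ∀ x, 0 < f x) (hg_pos : ∀ x, 0 < g x)
    (b : OrthonormalBasis (Fin (d + 1)) ℝ (Euc d)) {t : ℝ} (ht : t ∈ I)
    {w : Euc d} (hw : ⟪b 0, w⟫ = 0) (c : Fin d → ℝ) (hc : ∑ k : Fin d, c k * ⟪b k.succ, w⟫ = 0)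
    {s : ℝ} (hV : 0 < H (b 0 + s • w, t) - dt H (b 0 + s • w, t))
    (hS : ∀ k : Fin d, 0 < ⟪spHess H (b 0 + s • w, t) (b k.succ + (s * c k) • w),
      b k.succ + (s * c k) • w⟫) :
    logDensity f (b 0 + s • w) + logFactor g (spGrad H (b 0 + s • w, t)) ≤
      Real.log (H (b 0 + s • w, t) - dt H (b 0 + s • w, t)) +
        (d + 1) * Real.log ‖b 0 + s • w‖ +
        ∑ k : Fin d, Real.log ⟪spHess H (b 0 + s • w, t) (b k.succ + (s * c k) • w),
          b k.succ + (s * c k) • w⟫ := by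
  set q := b 0 + s • w with hq
  have hq1 : ⟪b 0, q⟫ = 1 := by
    rw [hq, inner_add_right, inner_smul_right, hw]; simp
  have hq0 : q ≠ 0 := by intro h0; rw [h0, inner_zero_right] at hq1; exact zero_ne_one hq1
  set ρ := ‖q‖ with hρ
  have hρ0 : 0 < ρ := norm_pos_iff.2 hq0
  set e := direction q with he
  have hqe : ρ • (e : Euc d) = q := norm_smul_direction hq0
  have heq : (e : Euc d) = ρ⁻¹ • q := coe_direction hq0
  have he0 := sph_ne_zero e
  set S := spHess H (q, t) with hSdef
  have hSe : spHess H ((e : Euc d), t) = ρ • S := by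
    rw [heq, h.spHess_smul (inv_pos.2 hρ0) hq0 ht, inv_inv]
  have hXe : spGrad H ((e : Euc d), t) = spGrad H (q, t) := by
    rw [heq, h.spGrad_smul (inv_pos.2 hρ0) hq0 ht]
  have hVe : H ((e : Euc d), t) - dt H ((e : Euc d), t) = ρ⁻¹ * (H (q, t) - dt H (q, t)) := by
    rw [heq, h.hom _ (inv_pos.2 hρ0) q hq0 t ht,
      h.hom.dt h.isOpen h.smooth _ (inv_pos.2 hρ0) q hq0 t ht]
    simp; ring
  have heqn := h.equation e t ht
  -- The equation holds on the sphere with the rank one term of the direction `e`. It is exchanged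
  -- for the fixed term of `b 0`, which lies in no moving frame, at the cost of a power of ρ.
  have hdet1 := det_add_rankOne_of_kernel (S := ρ • S) (e := (e : Euc d)) (inner_sph_self e)
    (fun u v => by
      rw [smul_apply, smul_apply, real_inner_smul_left, real_inner_smul_left,
        h.spHess_symm hq0 ht])
    (by rw [← hSe]; exact h.spHess_self he0 ht) (b 0)
  -- The kernel of the Hessian moves with `s`; the shear follows it, so Hadamard's inequality loses
  -- nothing to first order and the parameters `c` stay free.
  have hdet2 := det_le_prod_sheared b (S := ρ • S)
    (fun u v => by
      rw [smul_apply, smul_apply, real_inner_smul_left, real_inner_smul_left,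
        h.spHess_symm hq0 ht])
    (fun v => by
      rw [smul_apply, real_inner_smul_left]
      exact mul_nonneg hρ0.le (h.spHess_nonneg hq0 ht v))
    hw (s := s) (by rw [← hq, smul_apply, h.spHess_self hq0 ht, smul_zero]) c hc
  have h1 : ⟪b 0, (e : Euc d)⟫ = ρ⁻¹ := by rw [heq, inner_smul_right, hq1, mul_one]
  rw [hSe, hXe, hVe] at heqn
  rw [h1] at hdet1
  set T := (ρ • S + (innerSL ℝ (e : Euc d)).smulRight (e : Euc d)).det with hT
  have h2 : T = ρ ^ 2 * (ρ • S + (innerSL ℝ (b 0)).smulRight (b 0)).det := by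
    rw [hdet1]; field_simp
  set P := ∏ k : Fin d, ⟪S (b k.succ + (s * c k) • w), b k.succ + (s * c k) • w⟫ with hP
  have hPpos : 0 < P := Finset.prod_pos fun k _ => hS k
  have h3 : T ≤ ρ ^ 2 * (ρ ^ d * P) := by
    rw [h2]
    refine mul_le_mul_of_nonneg_left (hdet2.trans (le_of_eq ?_)) (by positivity)
    simp only [smul_apply, real_inner_smul_left]
    rw [Finset.prod_mul_distrib]; simp [hP]
  have hX0 : 0 < ‖spGrad H (q, t)‖ := by
    rw [← hXe]; exact lt_of_lt_of_le (by positivity) (h.grad_ge e ht)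
  have h4 : f e * (‖spGrad H (q, t)‖ ^ (d + 1) / g (direction (spGrad H (q, t)))) ≤
      (H (q, t) - dt H (q, t)) * (ρ ^ (d + 1) * P) := by
    rw [← heqn]
    calc ρ⁻¹ * (H (q, t) - dt H (q, t)) * T
        ≤ ρ⁻¹ * (H (q, t) - dt H (q, t)) * (ρ ^ 2 * (ρ ^ d * P)) :=
          mul_le_mul_of_nonneg_left h3 (by positivity)
      _ = _ := by field_simp; ring
  have hfe := hf_pos e
  have hge := hg_pos (direction (spGrad H (q, t)))
  have hlP : Real.log P = ∑ k : Fin d, Real.log ⟪S (b k.succ + (s * c k) • w),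
      b k.succ + (s * c k) • w⟫ := Real.log_prod fun k _ => (hS k).ne'
  rw [← hlP]
  exact log_le_of_mul_le hfe hX0 hge hV hρ0 hPpos h4

/-- At a point where the Hessian is diagonal, the equation takes a simple form. -/
lemma diag_equation (b : OrthonormalBasis (Fin (d + 1)) ℝ (Euc d)) {q : Sph d} (hb : b 0 = q)
    {t : ℝ} (ht : t ∈ I) {l : Fin d → ℝ}
    (hl : ∀ i j : Fin d, ⟪spHess H ((q : Euc d), t) (b i.succ), b j.succ⟫ =
      if i = j then l i else 0) :
    (H ((q : Euc d), t) - dt H ((q : Euc d), t)) * ∏ k, l k =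
      f q * (‖spGrad H ((q : Euc d), t)‖ ^ (d + 1) /
        g (direction (spGrad H ((q : Euc d), t)))) := by
  rw [← h.equation q t ht]
  congr 1
  set S := spHess H ((q : Euc d), t)
  have hSq : S q = 0 := h.spHess_self (sph_ne_zero q) ht
  have h7 := det_inner_comp (by simp) (S + (innerSL ℝ (q : Euc d)).smulRight (q : Euc d))
    (ContinuousLinearMap.id ℝ (Euc d)) b
  have hgram : (Matrix.of fun i j => ⟪b i, b j⟫) = (1 : Matrix (Fin (d + 1)) (Fin (d + 1)) ℝ) := by
    ext i j; simp [b.inner_eq_ite, Matrix.one_apply]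
  have h6 : (ContinuousLinearMap.id ℝ (Euc d)).det = 1 := LinearMap.det_id
  rw [hgram, h6, Matrix.det_one, mul_one, mul_one] at h7
  rw [← h7]
  have h8 : (Matrix.of fun i j => ⟪(S + (innerSL ℝ (q : Euc d)).smulRight (q : Euc d)) (b i),
      ContinuousLinearMap.id ℝ (Euc d) (b j)⟫) =
      Matrix.diagonal (Fin.cons 1 l : Fin (d + 1) → ℝ) := by
    have h9 : ∀ i j, ⟪(S + (innerSL ℝ (q : Euc d)).smulRight (q : Euc d)) (b i),
      ContinuousLinearMap.id ℝ (Euc d) (b j)⟫ = ⟪S (b i), b j⟫ + ⟪b 0, b i⟫ * ⟪b 0, b j⟫ := by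
      intro i j
      rw [hb]
      simp [inner_add_left, real_inner_smul_left]
    ext i j
    rw [Matrix.of_apply, h9]
    refine Fin.cases ?_ (fun i => ?_) i <;> refine Fin.cases ?_ (fun j => ?_) j
    · rw [hb, hSq]; simp
    · rw [b.inner_eq_ite, b.inner_eq_ite, hb, hSq]
      simp [(Fin.succ_ne_zero j).symm]
    · rw [b.inner_eq_ite, b.inner_eq_ite, hb, h.spHess_symm (sph_ne_zero q) ht]
      change ⟪S (q : Euc d), _⟫ + _ = _
      rw [hSq]
      simp [Fin.succ_ne_zero, (Fin.succ_ne_zero i).symm]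
    · rw [hl, b.inner_eq_ite]
      by_cases hij : i = j
      · simp [hij, (Fin.succ_ne_zero j).symm]
      · simp [hij, (Fin.succ_ne_zero i).symm]
  rw [h8, Matrix.det_diagonal, Fin.prod_univ_succ]
  simp

end SupportSolution

lemma hasDerivAt_spGrad_line {U : Set (Euc d × ℝ)} {F : Euc d × ℝ → ℝ} (hU : IsOpen U)
    (hF : ContDiffOn ℝ ∞ F U) {p : Euc d × ℝ} {w : Euc d} {s : ℝ}
    (hp : p + s • ((w, 0) : Euc d × ℝ) ∈ U) :
    HasDerivAt (fun s => spGrad F (p + s • ((w, 0) : Euc d × ℝ)))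
      (spGrad (ds w F) (p + s • ((w, 0) : Euc d × ℝ))) s := by
  unfold spGrad
  refine HasDerivAt.fun_sum fun i _ => ?_
  have h1 := hasDerivAt_line hU
    (contDiffOn_ds hU hF (EuclideanSpace.basisFun (Fin (d + 1)) ℝ i)) hp
  refine (h1.smul_const _).congr_deriv ?_
  congr 1
  exact ds_comm hU hF hp _ _

lemma HasJet.eventually_pos {f : ℝ → ℝ} {a b c : ℝ} (hf : HasJet f a b c) (ha : 0 < a) :
    ∀ᶠ s in 𝓝 0, 0 < f s := by
  apply hf.hasDerivAt.continuousAt.eventually_const_lt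
  rwa [hf.1]

lemma hasJet_log_norm {q w : Euc d} (hq : ‖q‖ = 1) (hw : ⟪q, w⟫ = 0) :
    HasJet (fun s : ℝ => Real.log ‖q + s • w‖) 0 0 (‖w‖ ^ 2) := by
  have h1 : HasJet (fun s : ℝ => 1 + ‖w‖ ^ 2 * (s * s)) 1 0 (2 * ‖w‖ ^ 2) := by
    have := (HasJet.const 1).add ((HasJet.id.mul HasJet.id).const_mul (‖w‖ ^ 2))
    convert this using 1 <;> ring
  have h2 := (h1.log one_pos).const_mul (1 / 2)
  have h3 : (fun s : ℝ => Real.log ‖q + s • w‖) =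
      fun s : ℝ => 1 / 2 * Real.log (1 + ‖w‖ ^ 2 * (s * s)) := by
    funext s
    have : ‖q + s • w‖ ^ 2 = 1 + ‖w‖ ^ 2 * (s * s) := by
      rw [norm_add_sq_real, inner_smul_right, hw, hq, norm_smul, mul_pow, Real.norm_eq_abs, sq_abs]
      ring
    rw [← this, Real.log_pow]; push_cast; ring
  rw [h3]
  convert h2 using 1
  · simp
  · simp
  · ring

namespace SupportSolution

variable {f g : Sph d → ℝ} {C₀ : ℝ} {I : Set ℝ} {H : Euc d × ℝ → ℝ}
  (h : SupportSolution f g C₀ I H)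
include h

/-- Quadratic form of the Hessian in a sheared direction. -/
lemma inner_spHess_sheared {p : Euc d × ℝ} (hp : p ∈ ({0}ᶜ : Set (Euc d)) ×ˢ I) (e w : Euc d)
    (r : ℝ) : ⟪spHess H p (e + r • w), e + r • w⟫ =
      ds e (ds e H) p + 2 * r * ds e (ds w H) p + r ^ 2 * ds w (ds w H) p := by
  have hS := fun u v => inner_spHess h.isOpen h.smooth hp u v
  have h1 := ds_comm h.isOpenU h.smooth hp e w
  rw [map_add, map_smul, inner_add_left, inner_add_right, inner_add_right, real_inner_smul_left,
    real_inner_smul_left, inner_smul_right, inner_smul_right, hS, hS, hS, hS, h1]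
  ring

/-- First and second derivatives of the logarithm of the equation. -/
lemma log_equation_jet (hC₀ : 0 < C₀) (hf : ContMDiff (𝓡 d) 𝓘(ℝ, ℝ) ∞ f)
    (hf_pos : ∀ x, 0 < f x) (hg : ContMDiff (𝓡 d) 𝓘(ℝ, ℝ) ∞ g) (hg_pos : ∀ x, 0 < g x)
    (b : OrthonormalBasis (Fin (d + 1)) ℝ (Euc d)) {q : Sph d} (hb : b 0 = q)
    {t : ℝ} (ht : t ∈ I) {l : Fin d → ℝ} (hl0 : ∀ k, 0 < l k)
    (hl : ∀ i j : Fin d, ⟪spHess H ((q : Euc d), t) (b i.succ), b j.succ⟫ =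
      if i = j then l i else 0)
    {w : Euc d} (hw : ⟪(q : Euc d), w⟫ = 0) (c : Fin d → ℝ)
    (hc : ∑ k : Fin d, c k * ⟪b k.succ, w⟫ = 0) {p : Euc d × ℝ} (hp : p = ((q : Euc d), t))
    {V : Euc d × ℝ → ℝ} (hV : V = fun p => H p - dt H p) {a e : Fin d → ℝ}
    (ha : a = fun k => ds w (ds (b k.succ) (ds (b k.succ) H)) p
      + 2 * c k * ds (b k.succ) (ds w H) p)
    (he : e = fun k => ds w (ds w (ds (b k.succ) (ds (b k.succ) H))) p
      + 4 * c k * ds w (ds (b k.succ) (ds w H)) p + 2 * c k ^ 2 * ds w (ds w H) p) :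
    0 < V p ∧
    fderiv ℝ (logDensity f) q w + fderiv ℝ (logFactor g) (spGrad H p) (spGrad (ds w H) p) =
      ds w V p / V p + ∑ k, a k / l k ∧
    fderiv ℝ (fderiv ℝ (logDensity f)) q w w +
      (fderiv ℝ (fderiv ℝ (logFactor g)) (spGrad H p) (spGrad (ds w H) p) (spGrad (ds w H) p) +
        fderiv ℝ (logFactor g) (spGrad H p) (spGrad (ds w (ds w H)) p)) ≤
      ds w (ds w V) p / V p - (ds w V p / V p) ^ 2 + (d + 1) * ‖w‖ ^ 2 +
        ∑ k, (e k / l k - (a k / l k) ^ 2) := by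
  have hq0 := sph_ne_zero q
  have hU := h.isOpenU
  have hpU : p ∈ ({0}ᶜ : Set (Euc d)) ×ˢ I := by rw [hp]; exact ⟨hq0, ht⟩
  have hVs : ContDiffOn ℝ ∞ V ({0}ᶜ ×ˢ I) := by
    rw [hV]; exact h.smooth.sub (contDiffOn_dd hU h.smooth _)
  have hX0 : spGrad H p ≠ 0 := by
    rw [← norm_pos_iff, hp]; exact lt_of_lt_of_le (by positivity) (h.grad_ge q ht)
  have hlP : 0 < ∏ k, l k := Finset.prod_pos fun k _ => hl0 k
  have hVeq : V p * ∏ k, l k = f q * (‖spGrad H p‖ ^ (d + 1) / g (direction (spGrad H p))) := by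
    rw [hV, hp]; exact h.diag_equation b hb ht hl
  have hVp : 0 < V p := by
    have h1 := hf_pos q
    have h2 := hg_pos (direction (spGrad H p))
    have h3 := norm_pos_iff.2 hX0
    have h4 : 0 < V p * ∏ k, l k := by rw [hVeq]; positivity
    exact pos_of_mul_pos_left h4 hlP.le
  refine ⟨hVp, ?_⟩
  set ε : Euc d × ℝ := (w, 0) with hε
  have hline : ∀ s : ℝ, p + s • ε = (b 0 + s • w, t) := by
    intro s; rw [hp, hε, hb]; ext <;> simp
  have jf := hasJet_comp (contDiffOn_logDensity hf hf_pos) (c := fun s : ℝ => b 0 + s • w)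
    (c' := fun _ => w) (x := (q : Euc d)) (x₁ := w) (x₂ := 0) (by simp [hb]) hq0
    (.of_forall fun s => by simpa using ((hasDerivAt_id s).smul_const w).const_add (b 0)) rfl
    (hasDerivAt_const _ _)
  have jg := hasJet_comp (contDiffOn_logFactor hg hg_pos)
    (c := fun s : ℝ => spGrad H (p + s • ε)) (c' := fun s => spGrad (ds w H) (p + s • ε))
    (x := spGrad H p) (x₁ := spGrad (ds w H) p) (x₂ := spGrad (ds w (ds w H)) p) (by simp) hX0
    ((eventually_line_mem hU hpU ε).mono fun s hs => hasDerivAt_spGrad_line hU h.smooth hs)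
    (by simp) (by
      have := hasDerivAt_spGrad_line (w := w) (s := 0) hU (contDiffOn_ds hU h.smooth w)
        (p := p) (by simpa using hpU)
      rw [← hε, zero_smul, add_zero] at this
      exact this)
  have jV := hasJet_line hU hVs hpU ε
  have jN : HasJet (fun s : ℝ => Real.log ‖b 0 + s • w‖) 0 0 (‖w‖ ^ 2) :=
    hasJet_log_norm (by simp) (by rw [hb]; exact hw)
  have jS : ∀ k : Fin d, HasJet (fun s : ℝ => ⟪spHess H (b 0 + s • w, t)
      (b k.succ + (s * c k) • w), b k.succ + (s * c k) • w⟫) (l k) (a k) (e k) := by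
    intro k
    have j1 := hasJet_line hU (contDiffOn_ds hU (contDiffOn_ds hU h.smooth (b k.succ)) (b k.succ))
      hpU ε
    have j2 := hasJet_line hU (contDiffOn_ds hU (contDiffOn_ds hU h.smooth w) (b k.succ)) hpU ε
    have j3 := hasJet_line hU (contDiffOn_ds hU (contDiffOn_ds hU h.smooth w) w) hpU ε
    have j4 := (HasJet.id.mul j2).const_mul (2 * c k)
    have j5 := ((HasJet.id.mul HasJet.id).mul j3).const_mul (c k ^ 2)
    have hlk : ds (b k.succ) (ds (b k.succ) H) p = l k := by
      rw [← inner_spHess h.isOpen h.smooth hpU, hp, hl, if_pos rfl]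
    have j6 := ((j1.add j4).add j5).congr (g := fun s : ℝ => ⟪spHess H (b 0 + s • w, t)
      (b k.succ + (s * c k) • w), b k.succ + (s * c k) • w⟫) (by
        filter_upwards [eventually_line_mem hU hpU ε] with s hs
        rw [hline] at hs ⊢
        rw [h.inner_spHess_sheared hs]
        ring)
    convert j6 using 1
    · rw [hlk]; ring
    · rw [ha]; simp only [ds]; ring
    · rw [he]; simp only [ds]; ring
  have jlogS := HasJet.sum Finset.univ fun k _ => (jS k).log (hl0 k)
  -- Along the line the logarithm of the equation becomes an inequality, while `hval` below gives
  -- equality at `s = 0` since the Hessian is diagonal there. Touching then gives an identity for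
  -- first derivatives and an inequality for second ones.
  have hle : ∀ᶠ s in 𝓝 (0 : ℝ), logDensity f (b 0 + s • w) + logFactor g (spGrad H (p + s • ε)) ≤
      Real.log (V (p + s • ε)) + (d + 1) * Real.log ‖b 0 + s • w‖ +
        ∑ k : Fin d, Real.log ⟪spHess H (b 0 + s • w, t) (b k.succ + (s * c k) • w),
          b k.succ + (s * c k) • w⟫ := by
    filter_upwards [jV.eventually_pos hVp,
      Filter.eventually_all.2 fun k => (jS k).eventually_pos (hl0 k)] with s h1 h2
    rw [hline, hV] at *
    exact h.log_equation_le hC₀ hf_pos hg_pos b ht (by rw [hb]; exact hw) c hc h1 h2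
  have hval : logDensity f q + logFactor g (spGrad H p) =
      Real.log (V p) + (d + 1) * 0 + ∑ k, Real.log (l k) := by
    have h1 := hf_pos q
    have h2 := hg_pos (direction (spGrad H p))
    have h3 := norm_pos_iff.2 hX0
    have h4 := congrArg Real.log hVeq
    rw [Real.log_mul hVp.ne' hlP.ne', Real.log_mul h1.ne' (by positivity),
      Real.log_div (by positivity) h2.ne', Real.log_pow, Real.log_prod fun k _ => (hl0 k).ne'] at h4
    rw [logDensity, logFactor, direction_coe]
    push_cast at h4
    linarith
  have jL := jf.add jg
  have jR := ((jV.log hVp).add (jN.const_mul (d + 1))).add jlogS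
  rw [hval] at jL
  have hcmp := jL.compare jR hle
  obtain ⟨h1, h2⟩ := hcmp
  constructor
  · rw [h1]; simp [ds, hε]
  · have h3 : fderiv ℝ (logDensity f) (q : Euc d) 0 = 0 := map_zero _
    rw [h3, add_zero] at h2
    exact h2

end SupportSolution

/-! ### The maximum principle for the curvature radii -/

/-- The algebra behind the curvature estimate: the third order terms cancel. -/
lemma two_mul_sum_le_of_max {l τ μ ρ η φ c a e : Fin d → ℝ} {m : Fin d}
    {h V Vmm Vw Vm A B X2 ψmm ψw φ0 φmm : ℝ}
    (hl : ∀ k, 0 < l k) (hV : 0 < V) (hh : 0 < h) (hA : 0 ≤ A)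
    (E1 : ∀ k, τ k / l m - A * (η k / h) + B * (2 * (η k * l k)) = 0)
    (E2 : ∀ k, μ k / l m - (τ k / l m) ^ 2 - A * (l k / h - (η k / h) ^ 2) +
      B * (2 * (l k ^ 2 + ρ k - h * l k)) ≤ 0)
    (T : 0 ≤ (l m - Vmm) / l m - A * ((h - V) / h) + B * (2 * (X2 - h * V - Vw)))
    (hX : 1 + 2 * B * X2 ≤ A)
    (I1 : ψmm + (l m ^ 2 * φmm + (∑ k, τ k * φ k - l m * φ0)) ≤
      Vmm / V - (Vm / V) ^ 2 + (d + 1) + ∑ k, (e k / l k - (a k / l k) ^ 2))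
    (hc : c = fun k => if k = m then 0 else -(τ k / l m))
    (he : ∀ k, e k = μ k + 4 * c k * τ k + 2 * c k ^ 2 * l m) (ham : a m = τ m)
    (I2 : ψw + ∑ k, l k * (η k * φ k) = Vw / V + ∑ k, ρ k / l k) :
    2 * B * ∑ k, l k ≤ (d + 1 - ψmm) / l m - l m * φmm + φ0 + (d + 1) * (A / h) +
      2 * B * d * h - 2 * B * h - 2 * B * ψw - A / h * ∑ k, η k * φ k := by
  have hm := hl m
  -- For k ≠ m the choice c = -τ/l_m produces -2τ²/(l_m l_k), of which half suffices; for k = m the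
  -- same quantity comes from the square of `a m / l m`.
  have s1 : ∑ k, (e k / l k - (a k / l k) ^ 2) ≤
      ∑ k, (μ k / l k - τ k ^ 2 / (l m * l k)) := by
    refine Finset.sum_le_sum fun k _ => ?_
    have hk := hl k
    rw [he k, hc]
    by_cases hkm : k = m
    · subst hkm
      simp only [if_true, ham]
      apply le_of_eq
      field_simp
      ring
    · simp only [if_neg hkm]
      have h1 : (μ k + 4 * -(τ k / l m) * τ k + 2 * (-(τ k / l m)) ^ 2 * l m) / l k =
          μ k / l k - τ k ^ 2 / (l m * l k) - τ k ^ 2 / (l m * l k) := by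
        field_simp
        ring
      rw [h1]
      have h2 : 0 ≤ τ k ^ 2 / (l m * l k) := by positivity
      have h3 := sq_nonneg (a k / l k)
      linarith
  -- The second order condition multiplied by l_m/l_k: its third order part is exactly the one kept
  -- in the previous step.
  have s2 : ∑ k, (μ k / l k - τ k ^ 2 / (l m * l k)) ≤
      ∑ k, l m * (A / h - 2 * B * l k - 2 * B * (ρ k / l k) + 2 * B * h) := by
    refine Finset.sum_le_sum fun k _ => ?_
    have hk := hl k
    have h1 : (μ k / l m - (τ k / l m) ^ 2 - A * (l k / h - (η k / h) ^ 2) +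
      B * (2 * (l k ^ 2 + ρ k - h * l k))) * (l m / l k) ≤ 0 :=
      mul_nonpos_of_nonpos_of_nonneg (E2 k) (by positivity)
    have h2 : (μ k / l m - (τ k / l m) ^ 2 - A * (l k / h - (η k / h) ^ 2) +
      B * (2 * (l k ^ 2 + ρ k - h * l k))) * (l m / l k) =
      μ k / l k - τ k ^ 2 / (l m * l k) - l m * (A / h) + A * (η k / h) ^ 2 * (l m / l k) +
        l m * (2 * B * l k + 2 * B * (ρ k / l k) - 2 * B * h) := by
      field_simp
      ring
    have h3 : 0 ≤ A * (η k / h) ^ 2 * (l m / l k) := by positivity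
    linarith
  have s3 : ∑ k, l m * (A / h - 2 * B * l k - 2 * B * (ρ k / l k) + 2 * B * h) =
      l m * (d * (A / h) - 2 * B * ∑ k, l k - 2 * B * ∑ k, ρ k / l k + 2 * B * d * h) := by
    rw [← Finset.mul_sum]
    simp only [Finset.sum_add_distrib, Finset.sum_sub_distrib, ← Finset.mul_sum,
      Finset.sum_const, Finset.card_univ, Fintype.card_fin, nsmul_eq_mul]
    ring
  -- The first order condition expresses τ through first derivatives, removing the third derivatives
  -- that enter through the gradient factor.
  have s4 : ∑ k, τ k * φ k = l m * (A / h * ∑ k, η k * φ k) -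
      l m * (2 * B * ∑ k, l k * (η k * φ k)) := by
    rw [Finset.mul_sum, Finset.mul_sum, Finset.mul_sum, Finset.mul_sum, ← Finset.sum_sub_distrib]
    refine Finset.sum_congr rfl fun k _ => ?_
    have : τ k = l m * (A * (η k / h) - B * (2 * (η k * l k))) := by
      have := E1 k
      field_simp at this ⊢
      linarith
    rw [this]; ring
  -- In the time condition the terms without V sum to 1 + 2B|∇H|² - A, which is nonpositive by `hX`;
  -- the rest is divisible by V > 0.
  have s5 : 0 ≤ l m * (-(Vmm / V / l m) + A / h - 2 * B * h - 2 * B * (Vw / V)) := by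
    have h1 : (l m - Vmm) / l m - A * ((h - V) / h) + B * (2 * (X2 - h * V - Vw)) =
        (1 + 2 * B * X2 - A) + V * (-(Vmm / V / l m) + A / h - 2 * B * h - 2 * B * (Vw / V)) := by
      field_simp
      ring
    rw [h1] at T
    have h2 : 0 ≤ V * (-(Vmm / V / l m) + A / h - 2 * B * h - 2 * B * (Vw / V)) := by linarith
    exact mul_nonneg hm.le (nonneg_of_mul_nonneg_right h2 hV)
  have s6 : Vw / V = ψw + ∑ k, l k * (η k * φ k) - ∑ k, ρ k / l k := by linarith
  have s7 : l m * (Vmm / V / l m) = Vmm / V := by field_simp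
  have s8 : l m * ((d + 1 - ψmm) / l m) = d + 1 - ψmm := by field_simp
  rw [s6] at s5
  rw [s4] at I1
  have hVm := sq_nonneg (Vm / V)
  refine le_of_mul_le_mul_left ?_ hm
  have key := (s1.trans s2).trans_eq s3
  nlinarith [key, I1, s5, s7, s8, hVm]

namespace SupportSolution

variable {f g : Sph d → ℝ} {C₀ : ℝ} {I : Set ℝ} {H : Euc d × ℝ → ℝ}
  (h : SupportSolution f g C₀ I H)
include h

/-- The auxiliary function in the curvature estimate. -/
def _root_.GaussFlow.testFn (A B : ℝ) (H : Euc d × ℝ → ℝ) (w : Euc d) (p : Euc d × ℝ) : ℝ :=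
  Real.log (ds w (ds w H) p) - A * Real.log (H p) + B * ‖spGrad H p‖ ^ 2

/-- The quadratic gain from differentiating |∇H|² twice becomes, after division by the radii, the
left side here. On the right the only term growing with the radius `l m` comes from `logFactor g`
and carries no `B`, so a large `B` turns the inequality into a bound. The relation between `A` and
`B` gives the time condition its sign. -/
lemma two_mul_sum_le (hC₀ : 0 < C₀) (hf : ContMDiff (𝓡 d) 𝓘(ℝ, ℝ) ∞ f)
    (hf_pos : ∀ x, 0 < f x) (hg : ContMDiff (𝓡 d) 𝓘(ℝ, ℝ) ∞ g) (hg_pos : ∀ x, 0 < g x)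
    (b : OrthonormalBasis (Fin (d + 1)) ℝ (Euc d)) {q : Sph d} (hb : b 0 = q)
    {t : ℝ} (ht : t ∈ I) {l : Fin d → ℝ} (hl0 : ∀ k, 0 < l k)
    (hl : ∀ i j : Fin d, ⟪spHess H ((q : Euc d), t) (b i.succ), b j.succ⟫ =
      if i = j then l i else 0) (m : Fin d) {A B : ℝ} (hA : 1 + 2 * B * C₀ ^ 2 = A) (hB : 0 ≤ B)
    (hmax : ∀ k : Fin d, ∀ᶠ s in 𝓝 (0 : ℝ), testFn A B H (b m.succ) (q + s • b k.succ, t) ≤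
      testFn A B H (b m.succ) (q, t))
    (htime : ∀ᶠ s in 𝓝[<] t, testFn A B H (b m.succ) (q, s) ≤ testFn A B H (b m.succ) (q, t)) :
    2 * B * ∑ k, l k ≤ (d + 1 - fderiv ℝ (fderiv ℝ (logDensity f)) q (b m.succ) (b m.succ)) / l m -
      l m * fderiv ℝ (fderiv ℝ (logFactor g)) (spGrad H (q, t)) (b m.succ) (b m.succ) +
      fderiv ℝ (logFactor g) (spGrad H (q, t)) q + (d + 1) * (A / H (q, t)) +
      2 * B * d * H (q, t) - 2 * B * H (q, t) -
      2 * B * fderiv ℝ (logDensity f) q (∑ k : Fin d, ds (b k.succ) H (q, t) • b k.succ) -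
      A / H (q, t) * fderiv ℝ (logFactor g) (spGrad H (q, t))
        (∑ k : Fin d, ds (b k.succ) H (q, t) • b k.succ) := by
  set p : Euc d × ℝ := ((q : Euc d), t) with hp
  have hq0 := sph_ne_zero q
  have hU := h.isOpenU
  have hpU : p ∈ ({0}ᶜ : Set (Euc d)) ×ˢ I := ⟨hq0, ht⟩
  have hs := h.smooth
  set V : Euc d × ℝ → ℝ := fun p => H p - dt H p with hV
  have hts : ContDiffOn ℝ ∞ (dt H) ({0}ᶜ ×ˢ I) := contDiffOn_dd hU hs _
  have hVs : ContDiffOn ℝ ∞ V ({0}ᶜ ×ˢ I) := hs.sub hts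
  have S1 : ∀ v, ContDiffOn ℝ ∞ (ds v H) ({0}ᶜ ×ˢ I) := fun v => contDiffOn_ds hU hs v
  have S2 : ∀ u v, ContDiffOn ℝ ∞ (ds u (ds v H)) ({0}ᶜ ×ˢ I) :=
    fun u v => contDiffOn_ds hU (S1 v) u
  have hh : 0 < H p := lt_of_lt_of_le (by positivity) (h.lower q t ht)
  have hb0 : ∀ k : Fin d, ⟪(q : Euc d), b k.succ⟫ = 0 := fun k => by
    rw [← hb]; exact b.inner_eq_zero (Fin.succ_ne_zero k).symm
  set w : Euc d := ∑ k : Fin d, ds (b k.succ) H p • b k.succ with hw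
  have hw0 : ⟪(q : Euc d), w⟫ = 0 := by
    rw [hw, inner_sum]
    exact Finset.sum_eq_zero fun k _ => by rw [inner_smul_right, hb0, mul_zero]
  -- derivatives at the point
  have e1 : ds (b 0) H p = H p := by
    rw [hb, h.hom.euler h.isOpen hs hq0 ht]; simp [hp]
  have e2 : ∀ v, ds (b 0) (ds v H) p = 0 := fun v => by
    rw [hb, (h.hom_ds v).euler h.isOpen (S1 v) hq0 ht]; simp
  have e3 : ∀ u v, ds (b 0) (ds u (ds v H)) p = -ds u (ds v H) p := fun u v => by
    rw [hb, (h.hom_ds_ds u v).euler h.isOpen (S2 u v) hq0 ht]; simp [hp]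
  have e4 : ∀ i j : Fin d, ds (b i.succ) (ds (b j.succ) H) p = if i = j then l i else 0 :=
    fun i j => by rw [← inner_spHess h.isOpen hs hpU, hl]
  have eV : ds (b 0) V p = V p := by
    have hhom : HomDeg 1 I V := by
      intro c hc q hq t ht
      have h1 := h.hom c hc q hq t ht
      have h2 := (h.hom.dt h.isOpen hs) c hc q hq t ht
      simp only [hV, h1, h2]; ring
    rw [hb, hhom.euler h.isOpen hVs hq0 ht]; simp [hp]
  have e3' : ∀ u v v', ds u (ds v (ds v' H)) p = ds v (ds u (ds v' H)) p := fun u v v' =>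
    ds_comm hU (S1 v') hpU _ _
  have e3'' : ∀ u v v', ds u (ds v (ds v' H)) p = ds u (ds v' (ds v H)) p := fun u v v' =>
    ds_congr hU (fun z hz => ds_comm hU hs hz _ _) u hpU
  have e4'' : ∀ u v, ds u (ds u (ds v (ds v H))) p = ds v (ds v (ds u (ds u H))) p := by
    intro u v
    have a1 : EqOn (ds u (ds v (ds v H))) (ds v (ds v (ds u H))) ({0}ᶜ ×ˢ I) := by
      intro z hz
      rw [ds_comm hU (S1 v) hz]
      exact ds_congr hU (fun y hy => ds_comm hU hs hy _ _) v hz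
    rw [ds_congr hU a1 u hpU, ds_comm hU (S2 _ _) hpU]
    refine ds_congr hU (fun z hz => ?_) v hpU
    rw [ds_comm hU (S1 _) hz]
  have sgw : ∀ F : Euc d × ℝ → ℝ, spGrad F p =
      ds (b 0) F p • (q : Euc d) + ∑ k : Fin d, ds (b k.succ) F p • b k.succ := fun F => by
    rw [spGrad_eq_sum b, Fin.sum_univ_succ, hb]
  have hwd : ∀ F : Euc d × ℝ → ℝ, ds w F p = ∑ k : Fin d, ds (b k.succ) H p * ds (b k.succ) F p :=
    fun F => ds_sum_smul _ _ _ _ _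
  -- the equation
  obtain ⟨c, hc⟩ : ∃ c : Fin d → ℝ, c = fun k => if k = m then 0 else
      -(ds (b k.succ) (ds (b m.succ) (ds (b m.succ) H)) p / l m) := ⟨_, rfl⟩
  obtain ⟨a, ha⟩ : ∃ a : Fin d → ℝ, a = fun k => ds (b m.succ) (ds (b k.succ) (ds (b k.succ) H)) p
      + 2 * c k * ds (b k.succ) (ds (b m.succ) H) p := ⟨_, rfl⟩
  obtain ⟨e, he⟩ : ∃ e : Fin d → ℝ, e = fun k =>
      ds (b m.succ) (ds (b m.succ) (ds (b k.succ) (ds (b k.succ) H))) p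
      + 4 * c k * ds (b m.succ) (ds (b k.succ) (ds (b m.succ) H)) p
      + 2 * c k ^ 2 * ds (b m.succ) (ds (b m.succ) H) p := ⟨_, rfl⟩
  -- Second derivative of the equation in the maximising direction, with the shear that absorbs
  -- third derivatives. The coefficient at `m` is zero, which makes the constraint on `c` hold
  -- trivially.
  obtain ⟨hVp, -, I1⟩ := h.log_equation_jet hC₀ hf hf_pos hg hg_pos b hb ht hl0 hl (w := b m.succ)
    (hb0 m) c (by
      rw [hc]
      refine Finset.sum_eq_zero fun k _ => ?_
      by_cases hk : k = m
      · simp [hk]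
      · rw [b.inner_eq_zero (by simpa using hk), mul_zero]) hp hV ha he
  -- First derivative of the equation along the tangential gradient. It is needed to remove the
  -- third derivatives produced by |∇H|², and no shear is required.
  obtain ⟨-, I2, -⟩ := h.log_equation_jet hC₀ hf hf_pos hg hg_pos b hb ht hl0 hl (w := w)
    hw0 (fun _ => 0) (by simp) hp hV rfl rfl
  -- the jets of the test function
  have hlm : ds (b m.succ) (ds (b m.succ) H) p = l m := by rw [e4, if_pos rfl]
  have jets : ∀ k : Fin d, HasJet (fun s => testFn A B H (b m.succ) (p + s • (b k.succ, (0 : ℝ))))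
      (testFn A B H (b m.succ) p)
      (ds (b k.succ) (ds (b m.succ) (ds (b m.succ) H)) p / l m -
        A * (ds (b k.succ) H p / H p) + B * (2 * (ds (b k.succ) H p * l k)))
      (ds (b m.succ) (ds (b m.succ) (ds (b k.succ) (ds (b k.succ) H))) p / l m -
        (ds (b k.succ) (ds (b m.succ) (ds (b m.succ) H)) p / l m) ^ 2 -
        A * (l k / H p - (ds (b k.succ) H p / H p) ^ 2) +
        B * (2 * (l k ^ 2 + ds w (ds (b k.succ) (ds (b k.succ) H)) p - H p * l k))) := by
    intro k
    have j1 := (hasJet_line hU (S2 (b m.succ) (b m.succ)) hpU (b k.succ, (0 : ℝ))).log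
      (by rw [hlm]; exact hl0 m)
    have j2 := ((hasJet_line hU hs hpU (b k.succ, (0 : ℝ))).log hh).const_mul A
    have j3 := (HasJet.sum Finset.univ fun i _ =>
      (hasJet_line hU (S1 (b i)) hpU (b k.succ, (0 : ℝ))).mul
        (hasJet_line hU (S1 (b i)) hpU (b k.succ, (0 : ℝ)))).const_mul B
    have j4 := (j1.sub j2).add j3
    have d1 : ∀ F, dd (b k.succ, (0 : ℝ)) F = ds (b k.succ) F := fun F => rfl
    simp only [d1] at j4
    convert j4 using 1
    · funext s
      rw [testFn, norm_spGrad_sq b]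
    · rw [testFn, norm_spGrad_sq b]
    · rw [hlm, Fin.sum_univ_succ, ds_comm hU hs hpU (b k.succ) (b 0), e2]
      congr 2
      simp only [e4]
      rw [Finset.sum_eq_single k]
      · simp; ring
      · intro j _ hj; simp [hj.symm]
      · simp
    · rw [hlm, Fin.sum_univ_succ, ds_comm hU hs hpU (b k.succ) (b 0), e2, e4'' (b m.succ)]
      congr 1
      · congr 2; rw [e4, if_pos rfl]
      · congr 1
        simp only [e4]
        have r1 : ds (b k.succ) (ds (b k.succ) (ds (b 0) H)) p = -l k := by
          rw [e3'', e3', e3, e4, if_pos rfl]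
        have r2 : ∀ j : Fin d, ds (b k.succ) (ds (b k.succ) (ds (b j.succ) H)) p =
          ds (b j.succ) (ds (b k.succ) (ds (b k.succ) H)) p := fun j => by rw [e3'', e3']
        simp only [r2]
        rw [r1, e1, hwd, Finset.sum_add_distrib, Finset.sum_add_distrib, ← Finset.mul_sum]
        rw [Finset.sum_eq_single (f := fun j => (if k = j then l k else 0) *
          if k = j then l k else 0) k (by intro j _ hj; simp [hj.symm]) (by simp)]
        simp only [if_true, mul_comm (ds (b _) (ds (b k.succ) (ds (b k.succ) H)) p)]
        ring
  have E := fun k => (jets k).compare (HasJet.const (testFn A B H (b m.succ) p)) (by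
    filter_upwards [hmax k] with s hs
    simpa [hp] using hs)
  -- the time derivative
  have T : 0 ≤ (l m - ds (b m.succ) (ds (b m.succ) V) p) / l m - A * ((H p - V p) / H p) +
      B * (2 * (‖spGrad H p‖ ^ 2 - H p * V p - ds w V p)) := by
    have j1 := (hasJet_line hU (S2 (b m.succ) (b m.succ)) hpU ((0 : Euc d), (1 : ℝ))).log
      (by rw [hlm]; exact hl0 m)
    have j2 := ((hasJet_line hU hs hpU ((0 : Euc d), (1 : ℝ))).log hh).const_mul A
    have j3 := (HasJet.sum Finset.univ fun i _ =>
      (hasJet_line hU (S1 (b i)) hpU ((0 : Euc d), (1 : ℝ))).mul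
        (hasJet_line hU (S1 (b i)) hpU ((0 : Euc d), (1 : ℝ)))).const_mul B
    have j4 := ((j1.sub j2).add j3).hasDerivAt
    have d1 : ∀ v, dd ((0 : Euc d), (1 : ℝ)) (ds v H) p = ds v H p - ds v V p := fun v => by
      have r1 : dd ((0 : Euc d), (1 : ℝ)) (ds v H) p = ds v (dt H) p := dd_comm hU hs hpU _ _
      have r2 : ds v V p = ds v H p - ds v (dt H) p := by
        change fderiv ℝ (fun p => H p - dt H p) p _ = _
        rw [fderiv_fun_sub (differentiableAt_of_contDiffOn hU hs hpU)
          (differentiableAt_of_contDiffOn hU hts hpU)]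
        rfl
      rw [r1, r2]; ring
    have d2 : dd ((0 : Euc d), (1 : ℝ)) (ds (b m.succ) (ds (b m.succ) H)) p =
        l m - ds (b m.succ) (ds (b m.succ) V) p := by
      have r0 : EqOn (dd ((0 : Euc d), (1 : ℝ)) (ds (b m.succ) H)) (ds (b m.succ) (dt H))
        ({0}ᶜ ×ˢ I) := fun z hz => dd_comm hU hs hz _ _
      have r1 : dd ((0 : Euc d), (1 : ℝ)) (ds (b m.succ) (ds (b m.succ) H)) p =
          ds (b m.succ) (ds (b m.succ) (dt H)) p := by
        rw [ds, dd_comm hU (S1 _) hpU]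
        exact dd_congr hU r0 _ hpU
      have r2 : EqOn (ds (b m.succ) V) (fun z => ds (b m.succ) H z - ds (b m.succ) (dt H) z)
          ({0}ᶜ ×ˢ I) := fun z hz => by
        change fderiv ℝ (fun p => H p - dt H p) z _ = _
        rw [fderiv_fun_sub (differentiableAt_of_contDiffOn hU hs hz)
          (differentiableAt_of_contDiffOn hU hts hz)]
        rfl
      have r3 : ds (b m.succ) (ds (b m.succ) V) p = ds (b m.succ) (ds (b m.succ) H) p -
          ds (b m.succ) (ds (b m.succ) (dt H)) p := by
        rw [ds_congr hU r2 _ hpU]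
        change fderiv ℝ (fun z => ds (b m.succ) H z - ds (b m.succ) (dt H) z) p _ = _
        rw [fderiv_fun_sub (differentiableAt_of_contDiffOn hU (S1 _) hpU)
          (differentiableAt_of_contDiffOn hU (contDiffOn_ds hU hts _) hpU)]
        rfl
      rw [r1, r3, hlm]; ring
    have d3 : dd ((0 : Euc d), (1 : ℝ)) H p = H p - V p := by simp only [hV, dt]; ring
    simp only [d1, d2, d3, hlm] at j4
    have j5 : (l m - ds (b m.succ) (ds (b m.succ) V) p) / l m - A * ((H p - V p) / H p) +
        B * ∑ i, ((ds (b i) H p - ds (b i) V p) * ds (b i) H p +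
          ds (b i) H p * (ds (b i) H p - ds (b i) V p)) =
        (l m - ds (b m.succ) (ds (b m.succ) V) p) / l m - A * ((H p - V p) / H p) +
      B * (2 * (‖spGrad H p‖ ^ 2 - H p * V p - ds w V p)) := by
      congr 2
      rw [norm_spGrad_sq b, hwd, Fin.sum_univ_succ, Fin.sum_univ_succ, e1, eV]
      have : ∀ j : Fin d, (ds (b j.succ) H p - ds (b j.succ) V p) * ds (b j.succ) H p +
          ds (b j.succ) H p * (ds (b j.succ) H p - ds (b j.succ) V p) =
          2 * (ds (b j.succ) H p * ds (b j.succ) H p) -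
            2 * (ds (b j.succ) H p * ds (b j.succ) V p) := fun j => by ring
      simp only [this, Finset.sum_sub_distrib, ← Finset.mul_sum]
      ring
    rw [← j5]
    -- Only earlier times are compared, so the time derivative is taken as a limit of slopes from
    -- the left, each a quotient of a nonpositive by a negative number.
    refine ge_of_tendsto (j4.tendsto_slope.mono_left
      (nhdsWithin_mono (0 : ℝ) (s := Iio 0) fun s hs => (ne_of_lt hs : s ≠ 0))) ?_
    have hsh : Tendsto (fun s : ℝ => t + s) (𝓝[<] 0) (𝓝[<] t) := by
      refine tendsto_nhdsWithin_of_tendsto_nhds_of_eventually_within _ ?_ ?_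
      · have : Tendsto (fun s : ℝ => t + s) (𝓝 0) (𝓝 (t + 0)) :=
          (continuous_const.add continuous_id).tendsto 0
        rw [add_zero] at this
        exact this.mono_left nhdsWithin_le_nhds
      · filter_upwards [self_mem_nhdsWithin] with s hs
        simp only [mem_Iio] at hs ⊢
        linarith
    filter_upwards [hsh.eventually htime, self_mem_nhdsWithin] with s hs1 hs2
    rw [slope_def_field, sub_zero]
    apply div_nonneg_of_nonpos _ (le_of_lt hs2)
    have h1 : ∀ s : ℝ, p + s • ((0 : Euc d), (1 : ℝ)) = ((q : Euc d), t + s) := fun s => by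
      rw [hp]; ext <;> simp
    have h2 : ∀ s : ℝ, Real.log (ds (b m.succ) (ds (b m.succ) H) (p + s • ((0 : Euc d), (1 : ℝ))))
        - A * Real.log (H (p + s • ((0 : Euc d), (1 : ℝ)))) +
        B * ∑ i, ds (b i) H (p + s • ((0 : Euc d), (1 : ℝ))) *
          ds (b i) H (p + s • ((0 : Euc d), (1 : ℝ))) =
        testFn A B H (b m.succ) ((q : Euc d), t + s) := fun s => by
      rw [h1, testFn, norm_spGrad_sq b]
    have h3 := h2 0
    rw [add_zero] at h3
    rw [h2, h3]
    exact sub_nonpos.2 hs1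
  have hA0 : 0 ≤ A := by rw [← hA]; positivity
  have sg1 : spGrad (ds (b m.succ) H) p = l m • b m.succ := by
    rw [sgw, e2, zero_smul, zero_add, Finset.sum_eq_single m]
    · rw [hlm]
    · intro k _ hk; rw [e4, if_neg hk, zero_smul]
    · simp
  have sg2 : spGrad (ds (b m.succ) (ds (b m.succ) H)) p = -l m • (q : Euc d) +
      ∑ k : Fin d, ds (b k.succ) (ds (b m.succ) (ds (b m.succ) H)) p • b k.succ := by
    rw [sgw, e3, hlm]
  have sg3 : spGrad (ds w H) p = ∑ k : Fin d, (l k * ds (b k.succ) H p) • b k.succ := by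
    rw [sgw, e2, zero_smul, zero_add]
    refine Finset.sum_congr rfl fun k _ => ?_
    congr 1
    rw [ds_comm hU hs hpU, hwd, Finset.sum_eq_single k]
    · rw [e4, if_pos rfl, mul_comm]
    · intro j _ hj; rw [e4, if_neg hj, mul_zero]
    · simp
  have hX : 1 + 2 * B * ‖spGrad H p‖ ^ 2 ≤ A := by
    rw [← hA]
    have := pow_le_pow_left₀ (norm_nonneg _) (h.grad_le q t ht) 2
    nlinarith [mul_le_mul_of_nonneg_left this hB]
  have hDw : fderiv ℝ (logFactor g) (spGrad H p) w = ∑ k : Fin d, ds (b k.succ) H p *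
      fderiv ℝ (logFactor g) (spGrad H p) (b k.succ) := by
    rw [hw, map_sum]; simp
  rw [hDw]
  rw [sg1, sg2] at I1
  rw [sg3] at I2
  have hbn : ‖b m.succ‖ = 1 := b.orthonormal.1 _
  simp only [map_add, map_smul, map_sum, smul_apply, smul_eq_mul, hbn, one_pow, mul_one] at I1
  simp only [map_smul, map_sum, smul_eq_mul, mul_zero, zero_mul, add_zero] at I2
  refine two_mul_sum_le_of_max (τ := fun k => ds (b k.succ) (ds (b m.succ) (ds (b m.succ) H)) p)
    (μ := fun k => ds (b m.succ) (ds (b m.succ) (ds (b k.succ) (ds (b k.succ) H))) p)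
    (ρ := fun k => ds w (ds (b k.succ) (ds (b k.succ) H)) p) (X2 := ‖spGrad H p‖ ^ 2)
    (φ := fun k => fderiv ℝ (logFactor g) (spGrad H p) (b k.succ))
    (a := a) (e := e) (Vm := ds (b m.succ) V p)
    hl0 hVp hh hA0 (fun k => (E k).1) (fun k => (E k).2) T hX ?_ hc ?_ ?_ ?_
  rotate_left
  · intro k
    have h1 := e3' (b m.succ) (b k.succ) (b m.succ)
    rw [he, hlm, ← h1]
  · simp only [ha, hc, if_pos, mul_zero, zero_mul, add_zero]
  · rw [← I2]
    simp only [mul_assoc]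
  · refine le_trans (le_of_eq ?_) I1
    ring

end SupportSolution

lemma continuousOn_spGrad {U : Set (Euc d × ℝ)} (hU : IsOpen U) {F : Euc d × ℝ → ℝ}
    (hF : ContDiffOn ℝ ∞ F U) : ContinuousOn (spGrad F) U := by
  unfold spGrad
  exact continuousOn_finsetSum _ fun i _ => (contDiffOn_ds hU hF _).continuousOn.smul
    continuousOn_const

lemma continuousOn_spHess {U : Set (Euc d × ℝ)} (hU : IsOpen U) {F : Euc d × ℝ → ℝ}
    (hF : ContDiffOn ℝ ∞ F U) : ContinuousOn (spHess F) U := by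
  unfold spHess
  refine continuousOn_finsetSum _ fun i _ => ?_
  have h1 : ContinuousOn (fderiv ℝ (ds (EuclideanSpace.basisFun (Fin (d + 1)) ℝ i) F)) U :=
    ((contDiffOn_ds hU hF _).fderiv_of_isOpen hU (m := ∞) (by simp)).continuousOn
  have h2 : Continuous fun L : Euc d × ℝ →L[ℝ] ℝ =>
      (L.comp (ContinuousLinearMap.inl ℝ (Euc d) ℝ)).smulRight
        (EuclideanSpace.basisFun (Fin (d + 1)) ℝ i) := by
    have : Continuous fun L : Euc d × ℝ →L[ℝ] ℝ =>
        ContinuousLinearMap.smulRightL ℝ (Euc d) (Euc d)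
          (L.comp (ContinuousLinearMap.inl ℝ (Euc d) ℝ))
          (EuclideanSpace.basisFun (Fin (d + 1)) ℝ i) := by fun_prop
    exact this
  exact h2.comp_continuousOn h1

lemma exists_bound_fderiv {φ : Euc d → ℝ} (hφ : ContDiffOn ℝ ∞ φ {0}ᶜ) {K : Set (Euc d)}
    (hK : IsCompact K) (h0 : (0 : Euc d) ∉ K) :
    ∃ C : ℝ, 0 ≤ C ∧ ∀ y ∈ K, ‖fderiv ℝ φ y‖ ≤ C ∧ ‖fderiv ℝ (fderiv ℝ φ) y‖ ≤ C := by
  have hsub : K ⊆ {0}ᶜ := fun y hy h => h0 (h ▸ hy)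
  have hU : IsOpen ({0}ᶜ : Set (Euc d)) := isOpen_compl_singleton
  have s1 : ContDiffOn ℝ ∞ (fderiv ℝ φ) {0}ᶜ := hφ.fderiv_of_isOpen hU (m := ∞) (by simp)
  have s2 : ContDiffOn ℝ ∞ (fderiv ℝ (fderiv ℝ φ)) {0}ᶜ := s1.fderiv_of_isOpen hU (m := ∞) (by simp)
  obtain ⟨C1, h1⟩ := hK.exists_bound_of_continuousOn (s1.continuousOn.mono hsub)
  have hn : ∀ {F : Type} [NormedAddCommGroup F] {s : Euc d → F}, ContinuousOn s {0}ᶜ →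
      ∃ C, ∀ y ∈ K, ‖s y‖ ≤ C := fun hs => hK.exists_bound_of_continuousOn (hs.mono hsub)
  obtain ⟨C2, h2⟩ := hn s2.continuousOn
  exact ⟨max 0 (max C1 C2), le_max_left _ _, fun y hy =>
    ⟨(h1 y hy).trans ((le_max_left _ _).trans (le_max_right _ _)),
      (h2 y hy).trans ((le_max_right _ _).trans (le_max_right _ _))⟩⟩

/-- Bound for the curvature radius at a maximum of the test function. -/
lemma exists_bound_at_max (f g : Sph d → ℝ) {C₀ : ℝ} (hC₀ : 0 < C₀)
    (hf : ContMDiff (𝓡 d) 𝓘(ℝ, ℝ) ∞ f)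
    (hf_pos : ∀ x, 0 < f x) (hg : ContMDiff (𝓡 d) 𝓘(ℝ, ℝ) ∞ g) (hg_pos : ∀ x, 0 < g x) :
    ∃ A B Λ : ℝ, 0 ≤ A ∧ 0 ≤ B ∧ 0 < Λ ∧ ∀ (I : Set ℝ) (H : Euc d × ℝ → ℝ),
      SupportSolution f g C₀ I H →
      ∀ (b : OrthonormalBasis (Fin (d + 1)) ℝ (Euc d)) (q : Sph d), b 0 = q →
      ∀ t ∈ I, ∀ l : Fin d → ℝ, (∀ k, 0 < l k) →
      (∀ i j : Fin d, ⟪spHess H ((q : Euc d), t) (b i.succ), b j.succ⟫ = if i = j then l i else 0) →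
      ∀ m : Fin d,
      (∀ k : Fin d, ∀ᶠ s in 𝓝 (0 : ℝ), testFn A B H (b m.succ) (q + s • b k.succ, t) ≤
        testFn A B H (b m.succ) (q, t)) →
      (∀ᶠ s in 𝓝[<] t, testFn A B H (b m.succ) (q, s) ≤ testFn A B H (b m.succ) (q, t)) →
      l m ≤ Λ := by
  obtain ⟨K, hK0, hK⟩ := exists_bound_fderiv (contDiffOn_logDensity hf hf_pos)
    (isCompact_sphere (0 : Euc d) 1) (by simp)
  have hcomp : IsCompact (Metric.closedBall (0 : Euc d) C₀ ∩ {y | 1 / C₀ ≤ ‖y‖}) :=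
    (isCompact_closedBall _ _).inter_right (isClosed_le continuous_const continuous_norm)
  obtain ⟨L, hL0, hL⟩ := exists_bound_fderiv (contDiffOn_logFactor hg hg_pos) hcomp (by
    rintro ⟨-, h⟩
    simp only [mem_ofPred_eq, norm_zero] at h
    have : 0 < 1 / C₀ := by positivity
    linarith)
  -- Chosen so that 2B - L ≥ 1: after absorbing the term from `logFactor g`, at least one copy of `l
  -- m` survives on the left.
  set B : ℝ := L + 1 with hB
  have hB0 : 0 ≤ B := by positivity
  set A : ℝ := 1 + 2 * B * C₀ ^ 2 with hA
  have hA0 : 0 ≤ A := by positivity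
  set R : ℝ := L + (d + 1) * (A * C₀) + 2 * B * d * C₀ + 2 * B * (K * (2 * C₀)) +
    A * C₀ * (L * (2 * C₀)) with hR
  have hR0 : 0 ≤ R := by positivity
  -- `R` collects the bounds of all terms independent of the radii. The leading 1 forces `1 ≤ l m`
  -- in the contrary case, which makes the term divided by `l m` harmless.
  refine ⟨A, B, 1 + (d + 1 + K + R), hA0, hB0, by positivity, ?_⟩
  intro I H h b q hb t ht l hl0 hl m hmax htime
  have key := h.two_mul_sum_le hC₀ hf hf_pos hg hg_pos b hb ht hl0 hl m hA.symm hB0 hmax htime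
  set p : Euc d × ℝ := ((q : Euc d), t) with hp
  set w : Euc d := ∑ k : Fin d, ds (b k.succ) H p • b k.succ with hw
  have hq0 := sph_ne_zero q
  have hlow : 1 / C₀ ≤ H p := h.lower q t ht
  have hh : 0 < H p := lt_of_lt_of_le (by positivity) hlow
  have hup : H p ≤ C₀ := h.upper q t ht
  have hXle : ‖spGrad H p‖ ≤ C₀ := h.grad_le q t ht
  have hX : spGrad H p ∈ Metric.closedBall (0 : Euc d) C₀ ∩ {y | 1 / C₀ ≤ ‖y‖} :=
    ⟨by simpa using hXle, h.grad_ge q ht⟩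
  have hwn : ‖w‖ ≤ 2 * C₀ := by
    have h1 : w = spGrad H p - H p • (q : Euc d) := by
      rw [spGrad_eq_sum b, Fin.sum_univ_succ, hb, h.hom.euler h.isOpen h.smooth hq0 ht]
      simp [hw, hp]
    rw [h1]
    calc _ ≤ ‖spGrad H p‖ + ‖H p • (q : Euc d)‖ := norm_sub_le _ _
      _ ≤ C₀ + C₀ := by
        rw [norm_smul, norm_sph, mul_one, Real.norm_of_nonneg hh.le]; linarith
      _ = 2 * C₀ := by ring
  have hbn : ‖b m.succ‖ = 1 := b.orthonormal.1 _
  obtain ⟨hK1, hK2⟩ := hK q q.2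
  obtain ⟨hL1, hL2⟩ := hL _ hX
  have i1 : |fderiv ℝ (fderiv ℝ (logDensity f)) q (b m.succ) (b m.succ)| ≤ K := by
    have := ContinuousLinearMap.le_opNorm₂ (fderiv ℝ (fderiv ℝ (logDensity f)) (q : Euc d))
      (b m.succ) (b m.succ)
    rw [hbn, mul_one, mul_one, Real.norm_eq_abs] at this
    exact this.trans hK2
  have i2 : |fderiv ℝ (fderiv ℝ (logFactor g)) (spGrad H p) (b m.succ) (b m.succ)| ≤ L := by
    have := ContinuousLinearMap.le_opNorm₂ (fderiv ℝ (fderiv ℝ (logFactor g)) (spGrad H p))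
      (b m.succ) (b m.succ)
    rw [hbn, mul_one, mul_one, Real.norm_eq_abs] at this
    exact this.trans hL2
  have i3 : |fderiv ℝ (logFactor g) (spGrad H p) q| ≤ L := by
    have := (fderiv ℝ (logFactor g) (spGrad H p)).le_opNorm (q : Euc d)
    rw [norm_sph, mul_one, Real.norm_eq_abs] at this
    exact this.trans hL1
  have i4 : |fderiv ℝ (logDensity f) q w| ≤ K * (2 * C₀) :=
    ((fderiv ℝ (logDensity f) (q : Euc d)).le_opNorm w).trans (by gcongr)
  have i5 : |fderiv ℝ (logFactor g) (spGrad H p) w| ≤ L * (2 * C₀) :=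
    ((fderiv ℝ (logFactor g) (spGrad H p)).le_opNorm w).trans (by gcongr)
  have i6 : A / H p ≤ A * C₀ := by
    rw [div_le_iff₀ hh, mul_assoc]
    refine le_mul_of_one_le_right hA0 ?_
    rwa [div_le_iff₀ hC₀, mul_comm] at hlow
  have hm := hl0 m
  by_contra hcon
  push Not at hcon
  have hm1 : 1 ≤ l m := by
    have : 0 ≤ (d : ℝ) + 1 + K + R := by positivity
    linarith
  have hsum : l m ≤ ∑ k, l k := Finset.single_le_sum (fun k _ => (hl0 k).le) (Finset.mem_univ m)
  have j1 : (d + 1 - fderiv ℝ (fderiv ℝ (logDensity f)) q (b m.succ) (b m.succ)) / l m ≤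
      d + 1 + K := by
    rw [div_le_iff₀ hm]
    have : (d + 1 + K) * 1 ≤ (d + 1 + K) * l m := by gcongr
    linarith [neg_abs_le (fderiv ℝ (fderiv ℝ (logDensity f)) q (b m.succ) (b m.succ))]
  have j2 : -(l m * fderiv ℝ (fderiv ℝ (logFactor g)) (spGrad H p) (b m.succ) (b m.succ)) ≤
      l m * L := by
    rw [← mul_neg]
    exact mul_le_mul_of_nonneg_left ((neg_le_abs _).trans i2) hm.le
  have j3 : -(2 * B * fderiv ℝ (logDensity f) q w) ≤ 2 * B * (K * (2 * C₀)) := by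
    rw [← mul_neg]
    exact mul_le_mul_of_nonneg_left ((neg_le_abs _).trans i4) (by positivity)
  have j4 : -(A / H p * fderiv ℝ (logFactor g) (spGrad H p) w) ≤ A * C₀ * (L * (2 * C₀)) := by
    rw [← mul_neg]
    calc _ ≤ A / H p * (L * (2 * C₀)) :=
          mul_le_mul_of_nonneg_left ((neg_le_abs _).trans i5) (by positivity)
      _ ≤ _ := by gcongr
  have j5 : (d + 1) * (A / H p) ≤ (d + 1) * (A * C₀) := by gcongr
  have j6 : 2 * B * d * H p ≤ 2 * B * d * C₀ := by gcongr
  have j7 : 0 ≤ 2 * B * H p := by positivity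
  have j8 : 2 * B * l m ≤ 2 * B * ∑ k, l k := by gcongr
  have j9 := (le_abs_self _).trans i3
  have j10 : 2 * B * l m - l m * L ≥ l m := by
    rw [hB]; nlinarith
  linarith

/-- A symmetric operator with a unit vector in its kernel is diagonal in an orthonormal basis
containing this vector. -/
lemma exists_eigenbasis {S : Euc d →L[ℝ] Euc d} (hS : ∀ u v, ⟪S u, v⟫ = ⟪S v, u⟫) {q : Sph d}
    (hq : S q = 0) : ∃ (b : OrthonormalBasis (Fin (d + 1)) ℝ (Euc d)) (l : Fin d → ℝ),
      b 0 = q ∧ ∀ i j : Fin d, ⟪S (b i.succ), b j.succ⟫ = if i = j then l i else 0 := by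
  set W : Submodule ℝ (Euc d) := (ℝ ∙ (q : Euc d))ᗮ with hW
  have hmem : ∀ v, v ∈ W ↔ ⟪(q : Euc d), v⟫ = 0 := fun v =>
    Submodule.mem_orthogonal_singleton_iff_inner_right
  have hinv : ∀ v ∈ W, (S : Euc d →ₗ[ℝ] Euc d) v ∈ W := fun v _ => by
    rw [hmem, real_inner_comm]
    change ⟪S v, (q : Euc d)⟫ = 0
    rw [hS, hq, inner_zero_left]
  have hsymm : (S : Euc d →ₗ[ℝ] Euc d).IsSymmetric := fun u v => by
    change ⟪S u, v⟫ = ⟪u, S v⟫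
    rw [hS, real_inner_comm]
  have hsymm' := hsymm.restrict_invariant hinv
  have hfin : Module.finrank ℝ W = d := by
    have : Fact (Module.finrank ℝ (Euc d) = d + 1) := ⟨by simp⟩
    exact Submodule.finrank_orthogonal_span_singleton (sph_ne_zero q)
  set e := hsymm'.eigenvectorBasis hfin with he
  set l := hsymm'.eigenvalues hfin with hl
  have hSe : ∀ i, S (e i : Euc d) = l i • (e i : Euc d) := fun i => by
    exact congrArg (Subtype.val) (hsymm'.apply_eigenvectorBasis hfin i)
  have horth : ∀ i j, ⟪(e i : Euc d), (e j : Euc d)⟫ = if i = j then (1 : ℝ) else 0 := fun i j => by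
    have := orthonormal_iff_ite.1 e.orthonormal i j
    simpa using this
  have hqe : ∀ i, ⟪(q : Euc d), (e i : Euc d)⟫ = 0 := fun i => (hmem _).1 (e i).2
  let v : Fin (d + 1) → Euc d := Fin.cons (q : Euc d) fun i => (e i : Euc d)
  have hv : Orthonormal ℝ v := by
    rw [orthonormal_iff_ite]
    intro i j
    refine Fin.cases ?_ (fun i => ?_) i <;> refine Fin.cases ?_ (fun j => ?_) j
    · simp [v]
    · simp [v, hqe, (Fin.succ_ne_zero j).symm]
    · simp [v, real_inner_comm, hqe, Fin.succ_ne_zero]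
    · simp [v, horth]
  refine ⟨OrthonormalBasis.mk hv ?_, l, by rw [OrthonormalBasis.coe_mk]; rfl, fun i j => ?_⟩
  · rw [hv.linearIndependent.span_eq_top_of_card_eq_finrank (by simp)]
  · simp only [OrthonormalBasis.coe_mk, v, Fin.cons_succ]
    rw [hSe, real_inner_smul_left, horth]
    split_ifs <;> simp

namespace SupportSolution

variable {f g : Sph d → ℝ} {C₀ : ℝ} {I : Set ℝ} {H : Euc d × ℝ → ℝ}
  (h : SupportSolution f g C₀ I H)
include h

/-- The test function at an arbitrary point is controlled by its values on unit vectors. -/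
lemma testFn_le {A B M : ℝ} (hA : 0 ≤ A) {t : ℝ} (ht : t ∈ I)
    (hM : ∀ q w : Sph d, ⟪(q : Euc d), (w : Euc d)⟫ = 0 → testFn A B H w (q, t) ≤ M)
    (hC₀ : 0 < C₀) {q : Sph d} {e w : Euc d} (he : ⟪(q : Euc d), e⟫ = 0) (hw : ‖w‖ = 1)
    (hqw : ⟪(q : Euc d), w⟫ = 0) : testFn A B H w (q + e, t) ≤ M := by
  set y : Euc d := q + e with hy
  have hqy : ⟪(q : Euc d), y⟫ = 1 := by rw [hy, inner_add_right, inner_sph_self, he, add_zero]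
  have hy0 : y ≠ 0 := fun h0 => by rw [h0, inner_zero_right] at hqy; exact zero_ne_one hqy
  set r := ‖y‖ with hr
  have hr0 : 0 < r := norm_pos_iff.2 hy0
  have hr1 : 1 ≤ r := by
    have := real_inner_le_norm (q : Euc d) y
    rwa [hqy, norm_sph, one_mul] at this
  set z := direction y with hz
  have hzy : r • (z : Euc d) = y := norm_smul_direction hy0
  -- Moving off the sphere along a tangent vector, `w` stops being tangent at the new direction `z`.
  -- Its projection `u` has length at most one and `r ≥ 1`, so both the Hessian term and the term -A
  -- log H can only be smaller than at the unit vectors `z`, `direction u`.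
  set u := w - ⟪(z : Euc d), w⟫ • (z : Euc d) with hu
  have hzu : ⟪(z : Euc d), u⟫ = 0 := by
    rw [hu, inner_sub_right, inner_smul_right, inner_sph_self]; ring
  have hu0 : u ≠ 0 := by
    intro h0
    have h1 : w = ⟪(z : Euc d), w⟫ • (z : Euc d) := sub_eq_zero.1 h0
    have h2 : ⟪(q : Euc d), (z : Euc d)⟫ ≠ 0 := by
      intro h3
      rw [← hzy, inner_smul_right, h3, mul_zero] at hqy
      exact zero_ne_one hqy
    have h3 : ⟪(z : Euc d), w⟫ = 0 := by
      have := congrArg (fun v => ⟪(q : Euc d), v⟫) h1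
      simp only [inner_smul_right, hqw] at this
      exact (mul_eq_zero.1 this.symm).resolve_right h2
    rw [h3, zero_smul] at h1
    rw [h1, norm_zero] at hw
    exact zero_ne_one hw
  have hun : ‖u‖ ≤ 1 := by
    have h1 : ‖u‖ ^ 2 = 1 - ⟪(z : Euc d), w⟫ ^ 2 := by
      rw [hu, norm_sub_sq_real, inner_smul_right, norm_smul, norm_sph, hw, real_inner_comm,
        Real.norm_eq_abs, mul_one, sq_abs]
      ring
    nlinarith [sq_nonneg ⟪(z : Euc d), w⟫, norm_nonneg u]
  have hun0 : 0 < ‖u‖ := norm_pos_iff.2 hu0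
  set v := direction u with hv
  have hvu : ‖u‖ • (v : Euc d) = u := norm_smul_direction hu0
  have hzv : ⟪(z : Euc d), (v : Euc d)⟫ = 0 := by
    rw [hv, coe_direction hu0, inner_smul_right, hzu, mul_zero]
  have hz0 := sph_ne_zero z
  have hSz := h.spHess_self hz0 ht
  have hq1 : ⟪spHess H ((z : Euc d), t) w, w⟫ = ‖u‖ ^ 2 * ⟪spHess H ((z : Euc d), t) v, v⟫ := by
    have h1 : w = u + ⟪(z : Euc d), w⟫ • (z : Euc d) := by rw [hu]; abel
    have h2 : spHess H ((z : Euc d), t) w = spHess H ((z : Euc d), t) u := by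
      conv_lhs => rw [h1]
      rw [map_add, map_smul, hSz, smul_zero, add_zero]
    have h3 : ⟪spHess H ((z : Euc d), t) u, w⟫ = ⟪spHess H ((z : Euc d), t) u, u⟫ := by
      conv_lhs => rw [h1]
      rw [inner_add_right, inner_smul_right, h.spHess_symm hz0 ht u z, hSz, inner_zero_left]
      ring
    rw [h2, h3, ← hvu, map_smul, real_inner_smul_left, inner_smul_right, norm_smul, norm_norm,
      norm_sph]
    ring
  have hvpos : 0 < ⟪spHess H ((z : Euc d), t) v, v⟫ := h.hess_pos z t ht v hzv (sph_ne_zero v)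
  have hHz : 0 < H ((z : Euc d), t) := lt_of_lt_of_le (by positivity) (h.lower z t ht)
  refine le_trans ?_ (hM z v hzv)
  rw [testFn, testFn, ← inner_spHess h.isOpen h.smooth (p := (y, t)) ⟨hy0, ht⟩,
    ← inner_spHess h.isOpen h.smooth (p := ((z : Euc d), t)) ⟨hz0, ht⟩, ← hzy,
    h.spHess_smul hr0 hz0 ht, h.spGrad_smul hr0 hz0 ht, h.hom r hr0 _ hz0 t ht, zpow_one,
    smul_apply, real_inner_smul_left, hq1, Real.log_mul hr0.ne' hHz.ne']
  have k1 : Real.log (r⁻¹ * (‖u‖ ^ 2 * ⟪spHess H ((z : Euc d), t) v, v⟫)) ≤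
      Real.log ⟪spHess H ((z : Euc d), t) v, v⟫ := by
    apply Real.log_le_log (by positivity)
    have a1 : r⁻¹ ≤ 1 := inv_le_one_of_one_le₀ hr1
    have a2 : ‖u‖ ^ 2 ≤ 1 := pow_le_one₀ hun0.le hun
    calc r⁻¹ * (‖u‖ ^ 2 * ⟪spHess H ((z : Euc d), t) v, v⟫)
        ≤ 1 * (1 * ⟪spHess H ((z : Euc d), t) v, v⟫) := by gcongr
      _ = _ := by ring
  have k2 : 0 ≤ A * Real.log r := mul_nonneg hA (Real.log_nonneg hr1)
  linarith

end SupportSolution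

/-- The curvature radii of a solution are bounded in terms of their initial bound. -/
theorem exists_spHess_bound (f g : Sph d → ℝ) {C₀ : ℝ} (hC₀ : 0 < C₀)
    (hf : ContMDiff (𝓡 d) 𝓘(ℝ, ℝ) ∞ f)
    (hf_pos : ∀ x, 0 < f x) (hg : ContMDiff (𝓡 d) 𝓘(ℝ, ℝ) ∞ g) (hg_pos : ∀ x, 0 < g x)
    {Λ₀ : ℝ} (hΛ₀ : 0 < Λ₀) : ∃ Λ : ℝ, 0 < Λ ∧ ∀ (I : Set ℝ) (H : Euc d × ℝ → ℝ),
      SupportSolution f g C₀ I H → ∀ τ t₁ : ℝ, Icc τ t₁ ⊆ I →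
      (∀ q w : Sph d, ⟪(q : Euc d), (w : Euc d)⟫ = 0 →
        ⟪spHess H ((q : Euc d), τ) w, w⟫ ≤ Λ₀) →
      ∀ t ∈ Icc τ t₁, ∀ q w : Sph d, ⟪(q : Euc d), (w : Euc d)⟫ = 0 →
        ⟪spHess H ((q : Euc d), t) w, w⟫ ≤ Λ := by
  obtain ⟨A, B, Λ, hA, hB, hΛ, hest⟩ := exists_bound_at_max f g hC₀ hf hf_pos hg hg_pos
  -- The exponent dominates the oscillation of -A log H + B|∇H|² under the bounds by `C₀`, which is
  -- what is lost in going from the maximum of the test function to the Hessian elsewhere.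
  refine ⟨max Λ₀ Λ * Real.exp (2 * A * Real.log C₀ + B * C₀ ^ 2),
    mul_pos (lt_max_of_lt_left hΛ₀) (Real.exp_pos _), ?_⟩
  intro I H h τ t₁ hI hini t ht q w hqw
  -- The unit tangent bundle of the sphere times the closed time interval: compact, so the test
  -- function attains its maximum.
  set K : Set ((Sph d × Sph d) × ℝ) :=
    {x | ⟪(x.1.1 : Euc d), (x.1.2 : Euc d)⟫ = 0} ∩ (univ ×ˢ Icc τ t₁) with hKdef
  have hK : IsCompact K := by
    refine IsCompact.inter_left (isCompact_univ.prod isCompact_Icc) ?_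
    exact isClosed_eq (by fun_prop) continuous_const
  have hne : K.Nonempty := ⟨((q, w), t), hqw, mem_univ _, ht⟩
  have hmaps : MapsTo (fun x : (Sph d × Sph d) × ℝ => ((x.1.1 : Euc d), x.2)) K ({0}ᶜ ×ˢ I) :=
    fun x hx => ⟨sph_ne_zero _, hI hx.2.2⟩
  have hproj : ContinuousOn (fun x : (Sph d × Sph d) × ℝ => ((x.1.1 : Euc d), x.2)) K := by
    fun_prop
  have hlog : ∀ q w : Sph d, ∀ t ∈ I, testFn A B H w ((q : Euc d), t) =
      Real.log ⟪spHess H ((q : Euc d), t) w, w⟫ - A * Real.log (H ((q : Euc d), t)) +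
        B * ‖spGrad H ((q : Euc d), t)‖ ^ 2 := fun q w t ht => by
    rw [testFn, inner_spHess h.isOpen h.smooth (p := ((q : Euc d), t)) ⟨sph_ne_zero q, ht⟩]
  have hcont : ContinuousOn (fun x : (Sph d × Sph d) × ℝ =>
      testFn A B H x.1.2 ((x.1.1 : Euc d), x.2)) K := by
    have c1 := (continuousOn_spHess h.isOpenU h.smooth).comp hproj hmaps
    have c2 := (continuousOn_spGrad h.isOpenU h.smooth).comp hproj hmaps
    have c3 := h.smooth.continuousOn.comp hproj hmaps
    have c4 : ContinuousOn (fun x : (Sph d × Sph d) × ℝ => (x.1.2 : Euc d)) K := by fun_prop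
    refine ContinuousOn.congr (f := fun x : (Sph d × Sph d) × ℝ =>
      Real.log ⟪spHess H ((x.1.1 : Euc d), x.2) (x.1.2 : Euc d), (x.1.2 : Euc d)⟫ -
        A * Real.log (H ((x.1.1 : Euc d), x.2)) + B * ‖spGrad H ((x.1.1 : Euc d), x.2)‖ ^ 2) ?_
      fun x hx => hlog _ _ _ (hI hx.2.2)
    refine ((ContinuousOn.log ((c1.clm_apply c4).inner c4) fun x hx => ?_).sub
      (continuousOn_const.mul (c3.log fun x hx => ?_))).add
      (continuousOn_const.mul (c2.norm.pow 2))
    · exact (h.hess_pos x.1.1 x.2 (hI hx.2.2) _ hx.1 (sph_ne_zero _)).ne'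
    · exact (lt_of_lt_of_le (by positivity) (h.lower x.1.1 x.2 (hI hx.2.2))).ne'
  obtain ⟨⟨⟨q₀, w₀⟩, t₀⟩, ⟨hqw₀, -, ht₀⟩, hmax⟩ := hK.exists_isMaxOn hne hcont
  change ⟪(q₀ : Euc d), (w₀ : Euc d)⟫ = 0 at hqw₀
  change t₀ ∈ Icc τ t₁ at ht₀
  have hmax' : ∀ q w : Sph d, ⟪(q : Euc d), (w : Euc d)⟫ = 0 → ∀ t ∈ Icc τ t₁,
      testFn A B H w ((q : Euc d), t) ≤ testFn A B H w₀ ((q₀ : Euc d), t₀) :=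
    fun q w hqw t ht => hmax (a := ((q, w), t)) ⟨hqw, mem_univ _, ht⟩
  have ht₀I : t₀ ∈ I := hI ht₀
  have hlogle : ∀ q : Sph d, ∀ t ∈ I, |Real.log (H ((q : Euc d), t))| ≤ Real.log C₀ :=
    fun q t ht => by
      have h1 := h.lower q t ht
      have h0 : 0 < H ((q : Euc d), t) := lt_of_lt_of_le (by positivity) h1
      rw [abs_le]
      constructor
      · have := Real.log_le_log (by positivity) h1
        rwa [one_div, Real.log_inv] at this
      · exact Real.log_le_log h0 (h.upper q t ht)
  -- bound at the maximum
  have hval : ⟪spHess H ((q₀ : Euc d), t₀) w₀, w₀⟫ ≤ max Λ₀ Λ := by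
    rcases eq_or_lt_of_le ht₀.1 with h0 | h0
    · rw [← h0]; exact (hini q₀ w₀ hqw₀).trans (le_max_left _ _)
    refine le_trans ?_ (le_max_right _ _)
    have hq0 := sph_ne_zero q₀
    obtain ⟨b, l, hb, hl⟩ := exists_eigenbasis (h.spHess_symm hq0 ht₀I) (h.spHess_self hq0 ht₀I)
    have hb0 : ∀ k : Fin d, ⟪(q₀ : Euc d), b k.succ⟫ = 0 := fun k => by
      rw [← hb]; exact b.inner_eq_zero (Fin.succ_ne_zero k).symm
    have hbn : ∀ k, ‖b k‖ = 1 := b.orthonormal.1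
    have hl0 : ∀ k, 0 < l k := fun k => by
      have := h.hess_pos q₀ t₀ ht₀I (b k.succ) (hb0 k) (by rw [← norm_pos_iff, hbn]; exact one_pos)
      rwa [hl, if_pos rfl] at this
    have hw0 : (w₀ : Euc d) = ∑ k : Fin d, ⟪b k.succ, (w₀ : Euc d)⟫ • b k.succ := by
      conv_lhs => rw [← b.sum_repr' (w₀ : Euc d)]
      rw [Fin.sum_univ_succ, hb, hqw₀, zero_smul, zero_add]
    have hsq : ∑ k : Fin d, ⟪b k.succ, (w₀ : Euc d)⟫ ^ 2 = 1 := by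
      have := b.sum_sq_norm_inner_right (w₀ : Euc d)
      rw [Fin.sum_univ_succ, hb, hqw₀, norm_sph] at this
      simpa using this
    have hd : Nonempty (Fin d) := by
      by_contra hemp
      rw [not_nonempty_iff] at hemp
      rw [Finset.univ_eq_empty, Finset.sum_empty] at hsq
      exact zero_ne_one hsq
    obtain ⟨m, hm⟩ := Finite.exists_max l
    have hle : ⟪spHess H ((q₀ : Euc d), t₀) w₀, w₀⟫ ≤ l m := by
      have h1 : ⟪spHess H ((q₀ : Euc d), t₀) w₀, w₀⟫ =
          ∑ k : Fin d, l k * ⟪b k.succ, (w₀ : Euc d)⟫ ^ 2 := by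
        conv_lhs => rw [hw0]
        rw [map_sum, sum_inner]
        refine Finset.sum_congr rfl fun k _ => ?_
        rw [map_smul, real_inner_smul_left, inner_sum, Finset.sum_eq_single k]
        · rw [inner_smul_right, hl, if_pos rfl]; ring
        · intro j _ hj; rw [inner_smul_right, hl, if_neg hj.symm, mul_zero]
        · simp
      rw [h1]
      calc _ ≤ ∑ k : Fin d, l m * ⟪b k.succ, (w₀ : Euc d)⟫ ^ 2 :=
            Finset.sum_le_sum fun k _ => mul_le_mul_of_nonneg_right (hm k) (sq_nonneg _)
        _ = l m := by rw [← Finset.mul_sum, hsq, mul_one]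
    refine hle.trans ?_
    have hpos : 0 < ⟪spHess H ((q₀ : Euc d), t₀) w₀, w₀⟫ :=
      h.hess_pos q₀ t₀ ht₀I _ hqw₀ (sph_ne_zero _)
    -- Replacing the maximising vector by an eigenvector of the largest eigenvalue does not lower
    -- the test function; the maximum may thus be taken at a frame vector of a diagonalising basis.
    have htop : testFn A B H w₀ ((q₀ : Euc d), t₀) ≤ testFn A B H (b m.succ) ((q₀ : Euc d), t₀) := by
      rw [hlog q₀ w₀ t₀ ht₀I, testFn,
        ← inner_spHess h.isOpen h.smooth (p := ((q₀ : Euc d), t₀)) ⟨hq0, ht₀I⟩, hl, if_pos rfl]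
      have := Real.log_le_log hpos hle
      linarith
    have hM : ∀ t ∈ Icc τ t₁, ∀ q w : Sph d, ⟪(q : Euc d), (w : Euc d)⟫ = 0 →
        testFn A B H w ((q : Euc d), t) ≤ testFn A B H (b m.succ) ((q₀ : Euc d), t₀) :=
      fun t ht q w hqw => (hmax' q w hqw t ht).trans htop
    refine hest I H h b q₀ hb t₀ ht₀I l hl0 hl m (fun k => .of_forall fun s => ?_) ?_
    · exact h.testFn_le hA ht₀I (hM t₀ ht₀) hC₀ (by rw [inner_smul_right, hb0, mul_zero])
        (hbn _) (hb0 m)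
    · filter_upwards [Ioo_mem_nhdsLT h0] with s hs
      have hs' : s ∈ Icc τ t₁ := ⟨hs.1.le, hs.2.le.trans ht₀.2⟩
      have := h.testFn_le hA (hI hs') (hM s hs') hC₀ (q := q₀) (e := 0) (by simp) (hbn m.succ)
        (hb0 m)
      rwa [add_zero] at this
  have hpos : 0 < ⟪spHess H ((q : Euc d), t) w, w⟫ :=
    h.hess_pos q t (hI ht) _ hqw (sph_ne_zero _)
  have hpos₀ : 0 < ⟪spHess H ((q₀ : Euc d), t₀) w₀, w₀⟫ :=
    h.hess_pos q₀ t₀ ht₀I _ hqw₀ (sph_ne_zero _)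
  have hfin := hmax' q w hqw t ht
  rw [hlog q w t (hI ht), hlog q₀ w₀ t₀ ht₀I] at hfin
  have a1 := abs_le.1 (hlogle q t (hI ht))
  have a2 := abs_le.1 (hlogle q₀ t₀ ht₀I)
  have a3 := Real.log_le_log hpos₀ hval
  have a4 : B * ‖spGrad H ((q₀ : Euc d), t₀)‖ ^ 2 ≤ B * C₀ ^ 2 := by
    have := h.grad_le q₀ t₀ ht₀I
    gcongr
  have a5 : 0 ≤ B * ‖spGrad H ((q : Euc d), t)‖ ^ 2 := by positivity
  have a6 := mul_le_mul_of_nonneg_left a1.2 hA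
  have a7 := mul_le_mul_of_nonneg_left a2.1 hA
  have hm0 : 0 < max Λ₀ Λ := lt_max_of_lt_left hΛ₀
  rw [← Real.log_le_log_iff hpos (by positivity), Real.log_mul hm0.ne' (Real.exp_pos _).ne',
    Real.log_exp]
  linarith

/-! ### From the flow to the equation of the support function -/

namespace IsStrictlyConvexEmbedding

variable {Y : Sph d → Euc d} (hY : IsStrictlyConvexEmbedding Y)
include hY

lemma fderiv_conic_dualPt (x : Sph d) (v : Euc d) :
    fderiv ℝ (conicExt (dualPt Y)) (x : Euc d) v =
      fderiv ℝ (radialExt (dualPt Y)) (x : Euc d) v + ⟪(x : Euc d), v⟫ • dualPt Y x :=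
  fderiv_conicExt (hY.differentiableAt_dualPt (sph_ne_zero x)) v

lemma fderiv_conic_self (x : Sph d) (v : Euc d) :
    fderiv ℝ (conicExt Y) (x : Euc d) v =
      fderiv ℝ (radialExt Y) (x : Euc d) v + ⟪(x : Euc d), v⟫ • Y x :=
  fderiv_conicExt (hY.differentiableAt (sph_ne_zero x)) v

lemma inner_conic_fderiv_dualPt (x : Sph d) (v : Euc d) :
    ⟪Y x, fderiv ℝ (conicExt (dualPt Y)) (x : Euc d) v⟫ = ⟪(x : Euc d), v⟫ := by
  have h1 := hY.inner_fderiv_dualPt_right (sph_ne_zero x) v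
  rw [direction_coe] at h1
  rw [hY.fderiv_conic_dualPt, inner_add_right, h1, inner_smul_right, hY.inner_dualPt_self]
  ring

lemma fderiv_conic_dualPt_self (x : Sph d) :
    fderiv ℝ (conicExt (dualPt Y)) (x : Euc d) x = dualPt Y x := by
  rw [hY.fderiv_conic_dualPt, fderiv_radialExt_self _ (sph_ne_zero x)
    (hY.differentiableAt_dualPt (sph_ne_zero x)), inner_sph_self, one_smul, zero_add]

/-- The polar dual of a hypersurface of positive curvature is immersed. -/
lemma fderiv_conic_dualPt_injective {c : ℝ} (hc : 0 < c) (hb : CurvatureBound Y c) (x : Sph d) :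
    Function.Injective (fderiv ℝ (conicExt (dualPt Y)) (x : Euc d)) := by
  rw [injective_iff_map_eq_zero]
  intro v hv
  have h1 := hY.inner_conic_fderiv_dualPt x v
  rw [hv, inner_zero_right] at h1
  have h2 := hY.fderiv_conic_dualPt x v
  rw [hv, ← h1, zero_smul, add_zero] at h2
  have h3 := hb x v h1.symm
  rw [← h2, inner_zero_left, mul_zero] at h3
  refine hY.fderiv_eq_zero h1.symm ?_
  have h4 : ‖fderiv ℝ (radialExt Y) (x : Euc d) v‖ ^ 2 ≤ 0 := by
    by_contra h5
    push Not at h5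
    have := mul_pos hc h5
    linarith
  have h5 := pow_eq_zero_iff (two_ne_zero) |>.1 (le_antisymm h4 (sq_nonneg _))
  exact norm_eq_zero.1 h5

/-- The Gauss curvature is the reciprocal of the determinant of the Hessian of the support
function. -/
lemma gaussCurvature_mul_det_hess (x : Sph d)
    (hinj : Function.Injective (fderiv ℝ (conicExt (dualPt Y)) (x : Euc d)))
    {S : Euc d →L[ℝ] Euc d}
    (hS : ∀ v, ⟪Y x, (gaussMap Y x : Euc d)⟫ • S (fderiv ℝ (conicExt (dualPt Y)) (x : Euc d) v) =
      fderiv ℝ (radialExt Y) (x : Euc d) v) :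
    gaussCurvature Y x *
      (S + (innerSL ℝ (gaussMap Y x : Euc d)).smulRight (gaussMap Y x : Euc d)).det = 1 := by
  set h := ⟪Y x, (gaussMap Y x : Euc d)⟫ with hh
  set ν : Euc d := (gaussMap Y x : Euc d) with hν
  have hpos : 0 < h := hY.height_pos x
  set A := fderiv ℝ (conicExt Y) (x : Euc d) with hA
  set P := fderiv ℝ (conicExt (dualPt Y)) (x : Euc d) with hP
  set D := fderiv ℝ (radialExt Y) (x : Euc d) with hD
  have hDx : D x = 0 := fderiv_radialExt_self _ (sph_ne_zero x)
    (hY.differentiableAt (sph_ne_zero x))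
  have hPx : P x = dualPt Y x := hY.fderiv_conic_dualPt_self x
  have hp : dualPt Y x = h⁻¹ • ν := rfl
  have hνν : ⟪ν, ν⟫ = (1 : ℝ) := inner_sph_self _
  have hνp : h * ⟪ν, dualPt Y x⟫ = 1 := by
    rw [hp, inner_smul_right, hνν]; field_simp
  obtain ⟨hA0, hK⟩ := hY.gaussCurvature_mul_det x
  rw [← hA, ← hP, ← hh] at hK
  rw [← hA] at hA0
  -- a tangential primitive of the tangential part of the position
  obtain ⟨τ, hτ⟩ := hY.exists_fderiv_conic_eq x (Y x - h • ν)
  have hxτ : ⟪(x : Euc d), τ⟫ = 0 := by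
    rw [← hY.inner_conic_dualPt x τ, hτ, inner_sub_left, hY.inner_dualPt_self,
      real_inner_smul_left, hνp, sub_self]
  have hDτ : D τ = Y x - h • ν := by
    rw [← hτ, hY.fderiv_conic_self, hxτ, zero_smul, add_zero]
  -- `L` acts as dY on tangent vectors and sends the radial vector to ν. Both the cone differential
  -- `A` and the composition of S + ν ⊗ ν with h P are rank one perturbations of `L`, so the two
  -- determinants are compared through that of `L`.
  set L := D + (innerSL ℝ (x : Euc d)).smulRight ν with hL
  have hLv : ∀ v, L v = D v + ⟪(x : Euc d), v⟫ • ν := fun v => by simp [hL]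
  have e1 : A = L + (innerSL ℝ (x : Euc d)).smulRight (L ((h - 1) • (x : Euc d) + τ)) := by
    ext1 v
    rw [add_apply, ContinuousLinearMap.smulRight_apply, innerSL_apply_apply, hLv, hLv, map_add,
      map_smul, hDx, smul_zero, zero_add, hDτ, inner_add_right, inner_smul_right, inner_sph_self,
      hxτ, hA, hY.fderiv_conic_self]
    module
  set b := h • P.adjoint ν - (x : Euc d) with hb
  have hbv : ∀ v, ⟪b, v⟫ = h * ⟪ν, P v⟫ - ⟪(x : Euc d), v⟫ := fun v => by
    rw [hb, inner_sub_left, real_inner_smul_left, ContinuousLinearMap.adjoint_inner_left]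
  have e2 : (S + (innerSL ℝ ν).smulRight ν).comp (h • P) =
      L + (innerSL ℝ b).smulRight (L (x : Euc d)) := by
    ext1 v
    have h1 := hS v
    rw [add_apply, ContinuousLinearMap.smulRight_apply, innerSL_apply_apply, hLv, hLv,
      ContinuousLinearMap.comp_apply, smul_apply, map_smul, add_apply,
      ContinuousLinearMap.smulRight_apply, innerSL_apply_apply, smul_add, h1, hDx, inner_sph_self,
      hbv]
    module
  have d1 : A.det = L.det * h := by
    rw [e1, det_comp_one_add_rankOne, inner_add_right, inner_smul_right, inner_sph_self, hxτ]
    ring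
  have d2 : (S + (innerSL ℝ ν).smulRight ν).det * (h ^ (d + 1) * P.det) = L.det := by
    have h1 : ((S + (innerSL ℝ ν).smulRight ν).comp (h • P)).det =
        (S + (innerSL ℝ ν).smulRight ν).det * (h ^ (d + 1) * P.det) := by
      have : (h • P).det = h ^ (d + 1) * P.det := by
        rw [ContinuousLinearMap.det, ContinuousLinearMap.toLinearMap_smul, LinearMap.det_smul]
        simp [ContinuousLinearMap.det]
      rw [← this]
      exact LinearMap.det_comp _ _
    rw [← h1, e2, det_comp_one_add_rankOne, hbv, hPx, hνp, inner_sph_self]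
    ring
  have hP0 : P.det ≠ 0 := by
    intro h0
    exact absurd (LinearMap.det_eq_zero_iff_ker_ne_bot.1 h0)
      (not_not.2 (LinearMap.ker_eq_bot.2 hinj))
  rw [d1] at hK
  have h3 : h * (h ^ (d + 1) * P.det) ≠ 0 := by positivity
  apply mul_right_cancel₀ h3
  calc _ = gaussCurvature Y x * (((S + (innerSL ℝ ν).smulRight ν).det * (h ^ (d + 1) * P.det)) * h)
        := by ring
    _ = _ := by rw [d2, hK]; ring

/-- Norm bound by the support function. -/
lemma norm_le_of_supportFn_le {C : ℝ} (hC : ∀ q, supportFn (range Y) q ≤ C) (x : Sph d) :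
    ‖Y x‖ ≤ C := by
  have h1 := le_supExt hY.continuous (direction (Y x) : Euc d) x
  rw [← supportFn_eq_supExt] at h1
  refine le_trans (le_of_eq ?_) (h1.trans (hC _))
  rw [coe_direction (hY.ne_zero x), inner_smul_right, real_inner_self_eq_norm_sq]
  have := norm_pos_iff.2 (hY.ne_zero x)
  field_simp

end IsStrictlyConvexEmbedding

namespace DualFamily

variable {Y p : Sph d → ℝ → Euc d} {I : Set ℝ} (h : DualFamily Y p I)
include h

lemma spGrad_supExt (hI : IsOpen I) {t : ℝ} (ht : t ∈ I) {y : Euc d} (hy : y ≠ 0) :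
    spGrad (fun w : Euc d × ℝ => supExt (fun z => Y z w.2) w.1) (conicExt (fun z => p z t) y, t) =
      Y (direction y) t := by
  apply ext_inner_right ℝ
  intro v
  rw [inner_spGrad, ds, dd, h.hasFDerivAt_supExt hI ht hy]
  ring

lemma dt_supExt (hI : IsOpen I) {t : ℝ} (ht : t ∈ I) {y : Euc d} (hy : y ≠ 0) :
    dt (fun w : Euc d × ℝ => supExt (fun z => Y z w.2) w.1) (conicExt (fun z => p z t) y, t) =
      ⟪deriv (fun s => Y (direction y) s) t, conicExt (fun z => p z t) y⟫ := by
  rw [dt, dd, h.hasFDerivAt_supExt hI ht hy]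
  simp

lemma conicExt_right_ne_zero {t : ℝ} (ht : t ∈ I) {y : Euc d} (hy : y ≠ 0) :
    conicExt (fun z => p z t) y ≠ 0 :=
  smul_ne_zero (norm_ne_zero_iff.2 hy) (h.right_ne_zero ht _)

/-- The gradient of the support function at a point of the dual cone is the corresponding point of
Y; the chain rule applied to this identity gives the Hessian on the image of the cone differential.
-/
lemma spHess_supExt (hI : IsOpen I) {t : ℝ} (ht : t ∈ I) {y : Euc d} (hy : y ≠ 0) (v : Euc d) :
    spHess (fun w : Euc d × ℝ => supExt (fun z => Y z w.2) w.1) (conicExt (fun z => p z t) y, t)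
      (fderiv ℝ (conicExt fun z => p z t) y v) = fderiv ℝ (radialExt fun z => Y z t) y v := by
  set H : Euc d × ℝ → ℝ := fun w => supExt (fun z => Y z w.2) w.1 with hH
  have hU := isOpen_domain (d := d) hI
  have hHs : ContDiffOn ℝ ∞ H ({0}ᶜ ×ˢ I) := h.contDiffOn_supExt hI
  have hP := ((h.contDiffAt_right_slice hI ht hy).differentiableAt (by simp)).hasFDerivAt
  have hmem : (conicExt (fun z => p z t) y, t) ∈ ({0}ᶜ : Set (Euc d)) ×ˢ I :=
    ⟨h.conicExt_right_ne_zero ht hy, ht⟩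
  have hYd : DifferentiableAt ℝ (radialExt fun z => Y z t) y := by
    have h1 := contDiffOn_radial_of_conic_family h.smooth_left
    have h2 : ContDiffAt ℝ ∞ (fun q : Euc d × ℝ => Y (direction q.1) q.2) (y, t) :=
      h1.contDiffAt (hU.mem_nhds ⟨hy, ht⟩)
    have h3 : ContDiffAt ℝ ∞ (fun y : Euc d => ((y, t) : Euc d × ℝ)) y :=
      contDiffAt_id.prodMk contDiffAt_const
    exact (h2.comp y h3).differentiableAt (by simp)
  apply ext_inner_right ℝ
  intro u
  rw [inner_spHess hI hHs hmem]
  have h1 : HasFDerivAt (fun z : Euc d => ds u H (conicExt (fun z => p z t) z, t))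
      ((fderiv ℝ (ds u H) (conicExt (fun z => p z t) y, t)).comp
        ((fderiv ℝ (conicExt fun z => p z t) y).prod (0 : Euc d →L[ℝ] ℝ))) y :=
    HasFDerivAt.comp (g := ds u H) y
      (differentiableAt_of_contDiffOn hU (contDiffOn_ds hU hHs u) hmem).hasFDerivAt
      (hP.prodMk (hasFDerivAt_const t y))
  have h2 : HasFDerivAt (fun z : Euc d => ⟪radialExt (fun z => Y z t) z, u⟫)
      ((fderivInnerCLM ℝ (radialExt (fun z => Y z t) y, u)).comp
        ((fderiv ℝ (radialExt fun z => Y z t) y).prod (0 : Euc d →L[ℝ] Euc d))) y :=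
    hYd.hasFDerivAt.inner ℝ (hasFDerivAt_const u y)
  have h3 : (fun z : Euc d => ds u H (conicExt (fun z => p z t) z, t)) =ᶠ[𝓝 y]
      fun z : Euc d => ⟪radialExt (fun z => Y z t) z, u⟫ := by
    filter_upwards [isOpen_compl_singleton.mem_nhds hy] with z hz
    rw [← inner_spGrad, h.spGrad_supExt hI ht hz]
    rfl
  have h4 := h1.unique (h2.congr_of_eventuallyEq h3)
  have h5 := congrArg (fun L => L v) h4
  simp only [ContinuousLinearMap.comp_apply, ContinuousLinearMap.prod_apply, zero_apply,
    fderivInnerCLM_apply, inner_zero_right, zero_add] at h5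
  exact h5

end DualFamily

lemma timeInterval_convex (T : EReal) : Convex ℝ (timeInterval T) := by
  apply Set.OrdConnected.convex
  refine ⟨fun a ha b hb c hc => ⟨ha.1.trans hc.1, lt_of_le_of_lt ?_ hb.2⟩⟩
  exact_mod_cast hc.2

lemma Icc_subset_timeInterval {T : EReal} {t : ℝ} (ht : t ∈ timeInterval T) :
    Icc 0 t ⊆ timeInterval T := fun s hs =>
  ⟨hs.1, lt_of_le_of_lt (by exact_mod_cast hs.2) ht.2⟩

lemma exists_gt_mem_timeInterval {T : EReal} {t : ℝ} (ht : t ∈ timeInterval T) :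
    ∃ s ∈ timeInterval T, t < s := by
  obtain ⟨s, hs1, hs2⟩ := EReal.lt_iff_exists_real_btwn.1 ht.2
  have : t < s := by exact_mod_cast hs1
  exact ⟨s, ⟨ht.1.trans this.le, hs2⟩, this⟩

lemma uniqueDiffOn_timeInterval (T : EReal) : UniqueDiffOn ℝ (timeInterval T) := by
  rcases (timeInterval T).eq_empty_or_nonempty with h | ⟨t, ht⟩
  · rw [h]; exact uniqueDiffOn_empty
  · obtain ⟨s, hs, hts⟩ := exists_gt_mem_timeInterval ht
    apply uniqueDiffOn_convex (timeInterval_convex T)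
    refine ⟨s / 2, ?_⟩
    rw [mem_interior_iff_mem_nhds]
    have h0 : 0 < s := lt_of_le_of_lt ht.1 hts
    exact Filter.mem_of_superset (Icc_mem_nhds (by linarith) (by linarith))
      (Icc_subset_timeInterval hs)

namespace IsConvexSolution

variable {f g : Sph d → ℝ} {X₀ : Sph d → Euc d} {T : EReal} {X : Sph d → ℝ → Euc d}
  (h : IsConvexSolution f g X₀ T X)
include h

lemma contDiffOn_radial :
    ContDiffOn ℝ ∞ (fun p : Euc d × ℝ => X (direction p.1) p.2) ({0}ᶜ ×ˢ timeInterval T) :=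
  contDiffOn_radialExt_family h.smooth

lemma contDiffOn_conic_dual :
    ContDiffOn ℝ ∞ (fun p : Euc d × ℝ => conicExt (dualPt fun z => X z p.2) p.1)
      ({0}ᶜ ×ˢ timeInterval T) :=
  contDiffOn_conicExt_dualPt_family (uniqueDiffOn_timeInterval T) h.contDiffOn_radial h.convex

/-- Positive curvature enters in one place: it makes the dual hypersurface immersed. -/
lemma dualFamily {I : Set ℝ} (hI : I ⊆ timeInterval T)
    (hb : ∀ t ∈ I, ∃ c > 0, CurvatureBound (fun z => X z t) c) :
    DualFamily X (fun x t => dualPt (fun z => X z t) x) I where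
  smooth_left := (contDiffOn_conicExt_family h.contDiffOn_radial).mono
    (prod_mono_right hI)
  smooth_right := h.contDiffOn_conic_dual.mono (prod_mono_right hI)
  inner_self t ht x := (h.convex t (hI ht)).inner_dualPt_self x
  inner_lt t ht x z hxz := (h.convex t (hI ht)).inner_dualPt_lt hxz
  injective t ht x := by
    obtain ⟨c, hc, hcb⟩ := hb t ht
    exact (h.convex t (hI ht)).fderiv_conic_dualPt_injective hc hcb x
  surj t ht q := by
    obtain ⟨x, hx⟩ := (h.convex t (hI ht)).exists_gaussMap_eq q
    exact ⟨x, by rw [(h.convex t (hI ht)).direction_dualPt, hx]⟩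

lemma deriv_eq {I : Set ℝ} (hIo : IsOpen I) (hI : I ⊆ timeInterval T) {t : ℝ} (ht : t ∈ I)
    (x : Sph d) : HasDerivAt (fun s => X x s)
      (-(f (gaussMap (fun z => X z t) x) / g (direction (X x t)) * ‖X x t‖ ^ (d + 1)
          * gaussCurvature (fun z => X z t) x) • (gaussMap (fun z => X z t) x : Euc d)
        + X x t) t :=
  (h.evolution x t (hI ht)).hasDerivAt (Filter.mem_of_superset (hIo.mem_nhds ht) hI)

end IsConvexSolution

lemma fderiv_radialExt_smul {F : Type*} [NormedAddCommGroup F] [NormedSpace ℝ F] (Y : Sph d → F)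
    {c : ℝ} (hc : 0 < c) (y : Euc d) :
    c • fderiv ℝ (radialExt Y) (c • y) = fderiv ℝ (radialExt Y) y := by
  have h : (fun z => radialExt Y (c • z)) = radialExt Y := by
    funext z
    by_cases hz : z = 0
    · simp [hz]
    · simp [radialExt, direction_smul hc z hz]
  conv_rhs => rw [← h]
  rw [fderiv_comp_smul]

namespace IsConvexSolution

variable {f g : Sph d → ℝ} {X₀ : Sph d → Euc d} {T : EReal} {X : Sph d → ℝ → Euc d}
  (h : IsConvexSolution f g X₀ T X) {I : Set ℝ} (hIo : IsOpen I) (hI : I ⊆ timeInterval T)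
  (D : DualFamily X (fun x t => dualPt (fun z => X z t) x) I) {t : ℝ} (ht : t ∈ I) (x : Sph d)

/-- The support function of the evolving hypersurface. -/
def _root_.GaussFlow.flowSupport (X : Sph d → ℝ → Euc d) (w : Euc d × ℝ) : ℝ :=
  supExt (fun z => X z w.2) w.1

include h hI ht in
lemma conic_dual_eq : conicExt (dualPt fun z => X z t)
    (⟪X x t, (gaussMap (fun z => X z t) x : Euc d)⟫ • (x : Euc d)) =
      gaussMap (fun z => X z t) x := by
  have hpos := (h.convex t (hI ht)).height_pos x
  rw [conicExt_smul _ hpos, conicExt_coe, dualPt, smul_smul, mul_inv_cancel₀ hpos.ne', one_smul]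

include h hI ht in
lemma flowSupport_gaussMap : flowSupport X ((gaussMap (fun z => X z t) x : Euc d), t) =
    ⟪X x t, (gaussMap (fun z => X z t) x : Euc d)⟫ := by
  rw [flowSupport, ← supportFn_eq_supExt, (h.convex t (hI ht)).supportFn_gaussMap]

include h hIo hI D ht

lemma spGrad_flowSupport :
    spGrad (flowSupport X) ((gaussMap (fun z => X z t) x : Euc d), t) = X x t := by
  have hpos := (h.convex t (hI ht)).height_pos x
  have h1 := D.spGrad_supExt hIo ht (smul_ne_zero hpos.ne' (sph_ne_zero x))
  rw [h.conic_dual_eq hI ht, direction_smul_coe hpos] at h1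
  exact h1

lemma dt_flowSupport :
    dt (flowSupport X) ((gaussMap (fun z => X z t) x : Euc d), t) =
      ⟪X x t, (gaussMap (fun z => X z t) x : Euc d)⟫ -
      f (gaussMap (fun z => X z t) x) / g (direction (X x t)) * ‖X x t‖ ^ (d + 1)
          * gaussCurvature (fun z => X z t) x := by
  have hpos := (h.convex t (hI ht)).height_pos x
  have h1 := D.dt_supExt hIo ht (smul_ne_zero hpos.ne' (sph_ne_zero x))
  rw [h.conic_dual_eq hI ht, direction_smul_coe hpos, (h.deriv_eq hIo hI ht x).deriv,
    inner_add_left, real_inner_smul_left, inner_sph_self] at h1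
  refine Eq.trans h1 ?_
  ring

lemma spHess_flowSupport (v : Euc d) :
    ⟪X x t, (gaussMap (fun z => X z t) x : Euc d)⟫ •
      spHess (flowSupport X) ((gaussMap (fun z => X z t) x : Euc d), t)
        (fderiv ℝ (conicExt (dualPt fun z => X z t)) (x : Euc d) v) =
      fderiv ℝ (radialExt fun z => X z t) (x : Euc d) v := by
  have hpos := (h.convex t (hI ht)).height_pos x
  have h1 := D.spHess_supExt hIo ht (smul_ne_zero hpos.ne' (sph_ne_zero x)) v
  have h2 := h.conic_dual_eq hI ht x
  have h3 := fderiv_radialExt_smul (fun z => X z t) hpos (x : Euc d)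
  rw [← h3, smul_apply]
  congr 1
  rw [h2, fderiv_conicExt_smul _ hpos] at h1
  exact h1

/-- The Hessian of the support function in terms of the curvature form. -/
lemma exists_tangent_spHess (u : Euc d) : ∃ w : Euc d, ⟪(x : Euc d), w⟫ = 0 ∧
    (⟪(gaussMap (fun z => X z t) x : Euc d), u⟫ = 0 → w = 0 → u = 0) ∧
    ⟪X x t, (gaussMap (fun z => X z t) x : Euc d)⟫ •
      spHess (flowSupport X) ((gaussMap (fun z => X z t) x : Euc d), t) u =
        fderiv ℝ (radialExt fun z => X z t) (x : Euc d) w ∧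
    ⟪fderiv ℝ (radialExt fun z => X z t) (x : Euc d) w, u⟫ =
      ⟪fderiv ℝ (radialExt (dualPt fun z => X z t)) (x : Euc d) w,
        fderiv ℝ (radialExt fun z => X z t) (x : Euc d) w⟫ := by
  have hY := h.convex t (hI ht)
  set ν : Euc d := (gaussMap (fun z => X z t) x : Euc d) with hν
  obtain ⟨v, hv⟩ := (LinearMap.injective_iff_surjective
    (f := (fderiv ℝ (conicExt (dualPt fun z => X z t)) (x : Euc d)).toLinearMap)).1
      (D.injective t ht x) u
  change fderiv ℝ (conicExt (dualPt fun z => X z t)) (x : Euc d) v = u at hv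
  set a := ⟪(x : Euc d), v⟫ with ha
  have hD0 : fderiv ℝ (radialExt fun z => X z t) (x : Euc d) x = 0 :=
    fderiv_radialExt_self _ (sph_ne_zero x) (hY.differentiableAt (sph_ne_zero x))
  have hP0 : fderiv ℝ (radialExt (dualPt fun z => X z t)) (x : Euc d) x = 0 :=
    fderiv_radialExt_self _ (sph_ne_zero x) (hY.differentiableAt_dualPt (sph_ne_zero x))
  have hw1 : fderiv ℝ (radialExt fun z => X z t) (x : Euc d) (v - a • (x : Euc d)) =
      fderiv ℝ (radialExt fun z => X z t) (x : Euc d) v := by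
    rw [map_sub, map_smul, hD0, smul_zero, sub_zero]
  have hw2 : fderiv ℝ (radialExt (dualPt fun z => X z t)) (x : Euc d) (v - a • (x : Euc d)) =
      fderiv ℝ (radialExt (dualPt fun z => X z t)) (x : Euc d) v := by
    rw [map_sub, map_smul, hP0, smul_zero, sub_zero]
  have hu : u = fderiv ℝ (radialExt (dualPt fun z => X z t)) (x : Euc d) v +
      a • dualPt (fun z => X z t) x := by rw [← hv, hY.fderiv_conic_dualPt]
  refine ⟨v - a • (x : Euc d), ?_, ?_, ?_, ?_⟩
  · rw [inner_sub_right, inner_smul_right, inner_sph_self, mul_one, ← ha, sub_self]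
  · intro hu0 hw
    rw [hw, map_zero] at hw2
    rw [← hw2, zero_add] at hu
    have hp : dualPt (fun z => X z t) x = (⟪X x t, ν⟫)⁻¹ • ν := rfl
    have hpos := hY.height_pos x
    have hνν : ⟪ν, ν⟫ = (1 : ℝ) := inner_sph_self _
    rw [hu, hp, inner_smul_right, inner_smul_right, hνν, mul_one] at hu0
    rw [hu, (mul_eq_zero.1 hu0).resolve_right (inv_ne_zero hpos.ne'), zero_smul]
  · rw [hw1, ← hv, ← h.spHess_flowSupport hIo hI D ht]
  · have h4 := hY.inner_fderiv_dualPt (sph_ne_zero x) v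
    rw [direction_coe] at h4
    rw [hw1, hw2, hu, inner_add_right, inner_smul_right, h4, mul_zero, add_zero, real_inner_comm]

/-- Writing S for the Hessian, the curvature bound reads c|Su|² ≤ ⟨Su, u⟩, while ⟨Su, u⟩ ≤ |Su| for
a unit vector; together they bound ⟨Su, u⟩ by 1/c. -/
lemma inner_spHess_le {c : ℝ} (hc : 0 < c) (hb : CurvatureBound (fun z => X z t) c) {u : Euc d}
    (hu : ‖u‖ = 1) :
    ⟪spHess (flowSupport X) ((gaussMap (fun z => X z t) x : Euc d), t) u, u⟫ ≤ 1 / c := by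
  obtain ⟨w, hw, -, h1, h2⟩ := h.exists_tangent_spHess hIo hI D ht x u
  have hY := h.convex t (hI ht)
  have hpos := hY.height_pos x
  have h3 := hb x w hw
  set ν : Euc d := (gaussMap (fun z => X z t) x : Euc d) with hν
  set η := ⟪X x t, ν⟫ with hη
  set S := spHess (flowSupport X) (ν, t) with hS
  rw [← h2, ← h1, real_inner_smul_left, norm_smul, Real.norm_of_nonneg hpos.le] at h3
  have h4 : ⟪S u, u⟫ ≤ ‖S u‖ := by
    have := real_inner_le_norm (S u) u
    rwa [hu, mul_one] at this
  have h5 : c * ‖S u‖ ^ 2 ≤ ⟪S u, u⟫ := by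
    have : η ^ 2 * (c * ‖S u‖ ^ 2) ≤ η ^ 2 * ⟪S u, u⟫ := by nlinarith
    exact le_of_mul_le_mul_left this (by positivity)
  rw [le_div_iff₀ hc]
  by_cases h0 : ⟪S u, u⟫ ≤ 0
  · nlinarith
  push Not at h0
  have h6 : ⟪S u, u⟫ ^ 2 ≤ ‖S u‖ ^ 2 := pow_le_pow_left₀ h0.le h4 2
  have h7 : ⟪S u, u⟫ * (⟪S u, u⟫ * c) ≤ ⟪S u, u⟫ * 1 := by nlinarith
  exact le_of_mul_le_mul_left h7 h0

omit ht in
/-- The support function of a solution of positive curvature solves the evolution equation. -/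
lemma supportSolution {C₀ : ℝ}
    (hb : ∀ t ∈ I, ∃ c > 0, CurvatureBound (fun z => X z t) c)
    (hC : ∀ x, ∀ t ∈ I, 1 / C₀ ≤ supportFn (range fun z => X z t) x ∧
      supportFn (range fun z => X z t) x ≤ C₀) :
    SupportSolution f g C₀ I (flowSupport X) where
  isOpen := hIo
  smooth := D.contDiffOn_supExt hIo
  hom c hc q _ t ht := by
    rw [flowSupport, zpow_one]
    exact supExt_smul (h.convex t (hI ht)).continuous hc.le q
  hess_pos q t ht u hu hu0 := by
    have hY := h.convex t (hI ht)
    obtain ⟨x, rfl⟩ := hY.exists_gaussMap_eq q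
    obtain ⟨w, hw, h0, h1, h2⟩ := h.exists_tangent_spHess hIo hI D ht x u
    have hpos := hY.height_pos x
    obtain ⟨c, hc, hcb⟩ := hb t ht
    have h3 := hcb x w hw
    rw [← h2, ← h1, real_inner_smul_left, h1] at h3
    have h4 : 0 < ‖fderiv ℝ (radialExt fun z => X z t) (x : Euc d) w‖ := by
      rw [norm_pos_iff]
      intro h5
      exact hu0 (h0 hu (hY.fderiv_eq_zero hw h5))
    have h5 : 0 < c * ‖fderiv ℝ (radialExt fun z => X z t) (x : Euc d) w‖ ^ 2 := by positivity
    have h6 := h5.trans_le h3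
    rw [← mul_assoc] at h6
    exact pos_of_mul_pos_right h6 (by positivity)
  equation q t ht := by
    have hY := h.convex t (hI ht)
    obtain ⟨x, rfl⟩ := hY.exists_gaussMap_eq q
    have h1 := hY.gaussCurvature_mul_det_hess x (D.injective t ht x)
      (h.spHess_flowSupport hIo hI D ht x)
    rw [h.flowSupport_gaussMap hI ht, h.dt_flowSupport hIo hI D ht,
      h.spGrad_flowSupport hIo hI D ht]
    calc _ = f (gaussMap (fun z => X z t) x) / g (direction (X x t)) * ‖X x t‖ ^ (d + 1) *
        (gaussCurvature (fun z => X z t) x *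
        (spHess (flowSupport X) ((gaussMap (fun z => X z t) x : Euc d), t) +
          (innerSL ℝ (gaussMap (fun z => X z t) x : Euc d)).smulRight
            (gaussMap (fun z => X z t) x : Euc d)).det) := by ring
      _ = _ := by rw [h1]; ring
  lower q t ht := by
    rw [flowSupport, ← supportFn_eq_supExt]; exact (hC q t ht).1
  upper q t ht := by
    rw [flowSupport, ← supportFn_eq_supExt]; exact (hC q t ht).2
  grad_le q t ht := by
    have hY := h.convex t (hI ht)
    obtain ⟨x, rfl⟩ := hY.exists_gaussMap_eq q
    rw [h.spGrad_flowSupport hIo hI D ht]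
    exact hY.norm_le_of_supportFn_le (fun q => (hC q t ht).2) x

/-- Converse passage from radii to curvatures: a positive semidefinite S bounded by Λ satisfies
|Su|² ≤ Λ⟨Su, u⟩, and Su is the tangent vector divided by the height. -/
lemma curvatureBound_of_spHess_le {C₀ Λ : ℝ} (hΛ : 0 < Λ)
    (hs : SupportSolution f g C₀ I (flowSupport X))
    (hb : ∀ q w : Sph d, ⟪(q : Euc d), (w : Euc d)⟫ = 0 →
      ⟪spHess (flowSupport X) ((q : Euc d), t) w, w⟫ ≤ Λ) :
    CurvatureBound (fun z => X z t) (1 / Λ) := by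
  intro x w hw
  have hY := h.convex t (hI ht)
  have hpos := hY.height_pos x
  have h1 := h.spHess_flowSupport hIo hI D ht x w
  rw [hY.fderiv_conic_dualPt, hw, zero_smul, add_zero] at h1
  set q := gaussMap (fun z => X z t) x with hq
  set S := spHess (flowSupport X) ((q : Euc d), t) with hS
  set u := fderiv ℝ (radialExt (dualPt fun z => X z t)) (x : Euc d) w with hu
  have hq0 := sph_ne_zero q
  have hsymm := hs.spHess_symm hq0 ht
  have hSq := hs.spHess_self hq0 ht
  have hnn := hs.spHess_nonneg hq0 ht
  set z := S u with hz
  have hzq : ⟪(q : Euc d), z⟫ = 0 := by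
    rw [real_inner_comm, hz, hsymm, hSq, inner_zero_left]
  have hzle : ⟪S z, z⟫ ≤ Λ * ‖z‖ ^ 2 := by
    by_cases hz0 : z = 0
    · simp [hz0]
    have hn := norm_pos_iff.2 hz0
    have h3 := hb q (direction z) (by rw [coe_direction hz0, inner_smul_right, hzq, mul_zero])
    have h4 : ⟪S z, z⟫ = ‖z‖ ^ 2 * ⟪S (direction z : Euc d), (direction z : Euc d)⟫ := by
      conv_lhs => rw [← norm_smul_direction hz0]
      rw [map_smul, real_inner_smul_left, inner_smul_right]; ring
    rw [h4, mul_comm]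
    gcongr
  have hcs : ‖z‖ ^ 2 ≤ Λ * ⟪z, u⟫ := by
    -- Expanding this square gives Λ²⟨z, u⟩ - 2Λ|z|² + ⟨Sz, z⟩ ≥ 0, and the last term is at most
    -- Λ|z|².
    have h3 := hnn (Λ • u - z)
    rw [map_sub, map_smul, ← hz, inner_sub_left, inner_sub_right, inner_sub_right,
      real_inner_smul_left, real_inner_smul_left, inner_smul_right, inner_smul_right,
      hsymm z u, ← hz, real_inner_self_eq_norm_sq] at h3
    have h4 : Λ * ‖z‖ ^ 2 ≤ Λ * (Λ * ⟪z, u⟫) := by nlinarith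
    exact le_of_mul_le_mul_left h4 hΛ
  rw [← h1, norm_smul, inner_smul_right, Real.norm_of_nonneg hpos.le, real_inner_comm z u,
    div_mul_eq_mul_div, div_le_iff₀ hΛ, one_mul]
  set η := ⟪X x t, (q : Euc d)⟫ with hη
  calc (η * ‖z‖) ^ 2 = η ^ 2 * ‖z‖ ^ 2 := by ring
    _ ≤ η ^ 2 * (Λ * ⟪z, u⟫) := by gcongr
    _ = _ := by ring

end IsConvexSolution

/-! ### Persistence of lower curvature bounds in time -/

lemma CurvatureBound.mono {Y : Sph d → Euc d} {c c' : ℝ} (h : CurvatureBound Y c) (hc : c' ≤ c) :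
    CurvatureBound Y c' := fun x w hw =>
  (mul_le_mul_of_nonneg_right hc (sq_nonneg _)).trans (h x w hw)

namespace IsConvexSolution

variable {f g : Sph d → ℝ} {X₀ : Sph d → Euc d} {T : EReal} {X : Sph d → ℝ → Euc d}
  (h : IsConvexSolution f g X₀ T X)
include h

/-- Joint continuity up to the initial time, with no curvature assumption, because dual points
depend smoothly on all variables. It makes curvature bounds both closed in time and stable, with a
small loss, for short times. -/
lemma continuousOn_curvatureForm :
    ContinuousOn (fun z : (Sph d × Euc d) × ℝ =>
      ⟪X z.1.1 z.2, (gaussMap (fun y => X y z.2) z.1.1 : Euc d)⟫ *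
      ⟪fderiv ℝ (radialExt (dualPt fun y => X y z.2)) (z.1.1 : Euc d) z.1.2,
        fderiv ℝ (radialExt fun y => X y z.2) (z.1.1 : Euc d) z.1.2⟫) (univ ×ˢ timeInterval T) ∧
    ContinuousOn (fun z : (Sph d × Euc d) × ℝ =>
      ‖fderiv ℝ (radialExt fun y => X y z.2) (z.1.1 : Euc d) z.1.2‖ ^ 2)
      (univ ×ˢ timeInterval T) := by
  have hu := uniqueDiffOn_timeInterval T
  have hproj : ContinuousOn (fun z : (Sph d × Euc d) × ℝ => ((z.1.1 : Euc d), z.2))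
    (univ ×ˢ timeInterval T) := by fun_prop
  have hmaps : MapsTo (fun z : (Sph d × Euc d) × ℝ => ((z.1.1 : Euc d), z.2))
    (univ ×ˢ timeInterval T) ({0}ᶜ ×ˢ timeInterval T) := fun z hz => ⟨sph_ne_zero _, hz.2⟩
  have hw : ContinuousOn (fun z : (Sph d × Euc d) × ℝ => z.1.2) (univ ×ˢ timeInterval T) := by
    fun_prop
  have c1 : ContinuousOn (fun z : (Sph d × Euc d) × ℝ =>
      fderiv ℝ (radialExt fun y => X y z.2) (z.1.1 : Euc d) z.1.2) (univ ×ˢ timeInterval T) :=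
    ((contDiffOn_fderiv_slice hu h.contDiffOn_radial).continuousOn.comp hproj hmaps).clm_apply hw
  have c2 : ContinuousOn (fun z : (Sph d × Euc d) × ℝ =>
      fderiv ℝ (radialExt (dualPt fun y => X y z.2)) (z.1.1 : Euc d) z.1.2)
      (univ ×ˢ timeInterval T) :=
    ((contDiffOn_fderiv_slice hu (contDiffOn_radial_of_conic_family
      (X := fun x t => dualPt (fun y => X y t) x) h.contDiffOn_conic_dual)).continuousOn.comp
      hproj hmaps).clm_apply hw
  have c3 : ContinuousOn (fun z : (Sph d × Euc d) × ℝ => dualPt (fun y => X y z.2) z.1.1)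
      (univ ×ˢ timeInterval T) := by
    refine (h.contDiffOn_conic_dual.continuousOn.comp hproj hmaps).congr fun z _ => ?_
    simp
  have c4 : ContinuousOn (fun z : (Sph d × Euc d) × ℝ =>
      ⟪X z.1.1 z.2, (gaussMap (fun y => X y z.2) z.1.1 : Euc d)⟫) (univ ×ˢ timeInterval T) := by
    refine (c3.norm.inv₀ fun z hz => ?_).congr fun z hz => ?_
    · exact norm_ne_zero_iff.2 ((h.convex z.2 hz.2).dualPt_ne_zero z.1.1)
    · have h1 := (h.convex z.2 hz.2).norm_dualPt z.1.1
      rw [Pi.inv_apply, h1, inv_inv]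
  exact ⟨c4.mul (c2.inner c1), c1.norm.pow 2⟩

/-- A lower curvature bound persists, with a slightly worse constant, for a short time. -/
lemma eventually_curvatureBound {s : ℝ} (hs : s ∈ timeInterval T) {c c' : ℝ} (hc : c' < c)
    (hb : CurvatureBound (fun z => X z s) c) :
    ∀ᶠ t in 𝓝[timeInterval T] s, CurvatureBound (fun z => X z t) c' := by
  obtain ⟨c1, c2⟩ := h.continuousOn_curvatureForm
  set Φ : (Sph d × Euc d) × ℝ → ℝ := fun z =>
      ⟪X z.1.1 z.2, (gaussMap (fun y => X y z.2) z.1.1 : Euc d)⟫ *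
      ⟪fderiv ℝ (radialExt (dualPt fun y => X y z.2)) (z.1.1 : Euc d) z.1.2,
        fderiv ℝ (radialExt fun y => X y z.2) (z.1.1 : Euc d) z.1.2⟫ with hΦ
  set Ψ : (Sph d × Euc d) × ℝ → ℝ := fun z =>
      ‖fderiv ℝ (radialExt fun y => X y z.2) (z.1.1 : Euc d) z.1.2‖ ^ 2 with hΨ
  set K : Set (Sph d × Sph d) := {y | ⟪(y.1 : Euc d), (y.2 : Euc d)⟫ = 0} with hK
  have hKc : IsCompact K := by
    apply IsClosed.isCompact
    exact isClosed_eq (by fun_prop) continuous_const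
  -- Both sides are quadratic in the tangent vector, so unit vectors suffice; on their compact set
  -- the strict inequality at time `s` persists uniformly.
  have key : ∀ᶠ t in 𝓝 s, ∀ y ∈ K, t ∈ timeInterval T →
      c' * Ψ ((y.1, (y.2 : Euc d)), t) < Φ ((y.1, (y.2 : Euc d)), t) := by
    apply hKc.eventually_forall_of_forall_eventually
    intro y hy
    have hmem : ((y.1, (y.2 : Euc d)), s) ∈ (univ : Set (Sph d × Euc d)) ×ˢ timeInterval T :=
      ⟨mem_univ _, hs⟩
    have hlt : c' * Ψ ((y.1, (y.2 : Euc d)), s) < Φ ((y.1, (y.2 : Euc d)), s) := by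
      refine lt_of_lt_of_le (mul_lt_mul_of_pos_right hc ?_) (hb y.1 y.2 hy)
      have : 0 < ‖fderiv ℝ (radialExt fun z => X z s) (y.1 : Euc d) y.2‖ := by
        rw [norm_pos_iff]
        intro h0
        exact sph_ne_zero y.2 ((h.convex s hs).fderiv_eq_zero hy h0)
      positivity
    have h1 := ((continuousOn_const.mul c2) _ hmem).eventually_lt (c1 _ hmem) hlt
    rw [eventually_nhdsWithin_iff] at h1
    have h2 : Tendsto (fun z : ℝ × (Sph d × Sph d) => ((z.2.1, (z.2.2 : Euc d)), z.1))
        (𝓝 (s, y)) (𝓝 ((y.1, (y.2 : Euc d)), s)) :=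
      Continuous.tendsto (f := fun z : ℝ × (Sph d × Sph d) => ((z.2.1, (z.2.2 : Euc d)), z.1))
        (by fun_prop) (s, y)
    filter_upwards [h2.eventually h1] with z hz hzT
    exact hz ⟨mem_univ _, hzT⟩
  rw [eventually_nhdsWithin_iff]
  filter_upwards [key] with t ht htT x w hw
  by_cases hw0 : w = 0
  · simp [hw0]
  have h1 := ht (x, direction w) (by
    change ⟪(x : Euc d), (direction w : Euc d)⟫ = 0
    rw [coe_direction hw0, inner_smul_right, hw, mul_zero]) htT
  have h2 := norm_pos_iff.2 hw0
  rw [← norm_smul_direction hw0]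
  simp only [hΦ, hΨ] at h1
  simp only [map_smul, norm_smul, norm_norm, real_inner_smul_left, inner_smul_right, mul_pow]
  have h3 := mul_le_mul_of_nonneg_left h1.le (sq_nonneg ‖w‖)
  linarith

lemma curvatureBound_of_mem_closure {s : ℝ} (hs : s ∈ timeInterval T) {c : ℝ}
    (hcl : s ∈ closure {t | t ∈ timeInterval T ∧ CurvatureBound (fun z => X z t) c}) :
    CurvatureBound (fun z => X z s) c := by
  intro x w hw
  obtain ⟨c1, c2⟩ := h.continuousOn_curvatureForm
  have hproj : ContinuousOn (fun t : ℝ => (((x, w), t) : (Sph d × Euc d) × ℝ))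
    {t | t ∈ timeInterval T ∧ CurvatureBound (fun z => X z t) c} := by fun_prop
  have hmem : ((x, w), s) ∈ (univ : Set (Sph d × Euc d)) ×ˢ timeInterval T := ⟨mem_univ _, hs⟩
  have hpw : ContinuousWithinAt (fun t : ℝ => (((x, w), t) : (Sph d × Euc d) × ℝ))
    {t | t ∈ timeInterval T ∧ CurvatureBound (fun z => X z t) c} s :=
    Continuous.continuousWithinAt (by fun_prop)
  have hmaps : MapsTo (fun t : ℝ => (((x, w), t) : (Sph d × Euc d) × ℝ))
    {t | t ∈ timeInterval T ∧ CurvatureBound (fun z => X z t) c} (univ ×ˢ timeInterval T) :=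
    fun t ht => ⟨mem_univ _, ht.1⟩
  have k1 := ContinuousWithinAt.comp (t := univ ×ˢ timeInterval T) (c1 _ hmem) hpw hmaps
  have k2 := ContinuousWithinAt.comp (t := univ ×ˢ timeInterval T) (c2 _ hmem) hpw hmaps
  exact ContinuousWithinAt.closure_le hcl (continuousWithinAt_const.mul k2) k1
    fun t ht => ht.2 x w hw

end IsConvexSolution

/-- Lower curvature bounds are preserved, with constants depending only on the bounds of the
support function. -/
theorem exists_curvatureBound (f g : Sph d → ℝ)
    (hf : ContMDiff (𝓡 d) 𝓘(ℝ, ℝ) ∞ f) (hf_pos : ∀ x, 0 < f x)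
    (hg : ContMDiff (𝓡 d) 𝓘(ℝ, ℝ) ∞ g) (hg_pos : ∀ x, 0 < g x)
    {C₀ κ₀ : ℝ} (hC₀ : 0 < C₀) (hκ₀ : 0 < κ₀) :
    ∃ c : ℝ, 0 < c ∧ ∀ (X₀ : Sph d → Euc d) (T : EReal) (X : Sph d → ℝ → Euc d),
      IsConvexSolution f g X₀ T X → CurvatureBound X₀ κ₀ →
      (∀ t ∈ timeInterval T, (∀ r ∈ Icc 0 t, ∃ a > 0, CurvatureBound (fun z => X z r) a) →
        ∀ x, 1 / C₀ ≤ supportFn (range fun z => X z t) x ∧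
          supportFn (range fun z => X z t) x ≤ C₀) →
      ∀ t ∈ timeInterval T, CurvatureBound (fun z => X z t) c := by
  -- The equation is only used on open time intervals, so the estimate starts at a small positive
  -- time, where the initial bound has dropped at most to κ₀/2.
  obtain ⟨Λ, hΛ, hest⟩ := exists_spHess_bound f g hC₀ hf hf_pos hg hg_pos
    (Λ₀ := 1 / (κ₀ / 2)) (by positivity)
  set c := min (κ₀ / 2) (1 / Λ) with hc
  have hc0 : 0 < c := lt_min (by positivity) (by positivity)
  refine ⟨c, hc0, ?_⟩
  intro X₀ T X h hini hC t₁ ht₁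
  have hJ := Icc_subset_timeInterval ht₁
  have h0J : (0 : ℝ) ∈ timeInterval T := hJ ⟨le_rfl, ht₁.1⟩
  have hini0 : CurvatureBound (fun z => X z 0) κ₀ := by
    have : (fun z => X z 0) = X₀ := funext h.initial
    rwa [this]
  have hext : ∀ {s a b : ℝ}, s ∈ timeInterval T → b < a → CurvatureBound (fun z => X z s) a →
      ∃ δ > 0, ∀ t ∈ timeInterval T, |t - s| < δ → CurvatureBound (fun z => X z t) b := by
    intro s a b hs hab hb
    obtain ⟨δ, hδ, hsub⟩ := Metric.mem_nhdsWithin_iff.1 (h.eventually_curvatureBound hs hab hb)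
    exact ⟨δ, hδ, fun t ht hts => hsub ⟨by rwa [Metric.mem_ball, Real.dist_eq], ht⟩⟩
  obtain ⟨δ₀, hδ₀, hb₀⟩ := hext h0J (half_lt_self hκ₀) hini0
  -- Continuity method: this set of times is closed, contains 0 and extends to the right of each of
  -- its points before `t₁`.
  set s : Set ℝ := {t | ∀ r ∈ Icc 0 t, CurvatureBound (fun z => X z r) c} with hs
  have hclosed : IsClosed (s ∩ Icc 0 t₁) := by
    rw [← closure_subset_iff_isClosed]
    intro t ht
    have htI : t ∈ Icc 0 t₁ := closure_minimal inter_subset_right isClosed_Icc ht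
    refine ⟨fun r hr => ?_, htI⟩
    rcases hr.2.lt_or_eq with hrt | hrt
    · obtain ⟨t', ht', ht's⟩ := mem_closure_iff.1 ht (Ioi r) isOpen_Ioi hrt
      exact ht's.1 r ⟨hr.1, le_of_lt ht'⟩
    · rw [hrt]
      refine h.curvatureBound_of_mem_closure (hJ htI) (closure_mono ?_ ht)
      exact fun t' ht' => ⟨hJ ht'.2, ht'.1 t' ⟨ht'.2.1, le_rfl⟩⟩
  have hsub : Icc 0 t₁ ⊆ s := by
    refine hclosed.Icc_subset_of_forall_exists_gt ?_ ?_
    · intro r hr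
      obtain rfl : r = 0 := le_antisymm hr.2 hr.1
      exact hini0.mono ((min_le_left _ _).trans (by linarith))
    · rintro x ⟨hxs, hx⟩ y hy
      have hxy : x < y := hy
      have hxJ : x ∈ timeInterval T := hJ ⟨hx.1, hx.2.le⟩
      rcases hx.1.eq_or_lt with hx0 | hx0
      · refine ⟨min (δ₀ / 2) (min y t₁), fun r hr => ?_, ?_, ?_⟩
        · have h1 : r ≤ δ₀ / 2 := hr.2.trans (min_le_left _ _)
          have h2 : r ≤ t₁ := hr.2.trans ((min_le_right _ _).trans (min_le_right _ _))
          refine (hb₀ r (hJ ⟨hr.1, h2⟩) ?_).mono (min_le_left _ _)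
          rw [sub_zero, abs_of_nonneg hr.1]; linarith
        · rw [← hx0]
          exact lt_min (by positivity) (lt_min (hx0 ▸ hxy) (hx0 ▸ hx.2))
        · exact (min_le_right _ _).trans (min_le_left _ _)
      · obtain ⟨δ, hδ, hbδ⟩ := hext hxJ (half_lt_self hc0) (hxs x ⟨hx.1, le_rfl⟩)
        set e := min (x + δ) t₁ with he
        have hxe : x < e := lt_min (by linarith) hx.2
        have hIJ : Ioo 0 e ⊆ timeInterval T := fun r hr =>
          hJ ⟨hr.1.le, hr.2.le.trans (min_le_right _ _)⟩
        have hbI : ∀ r ∈ Ioo 0 e, CurvatureBound (fun z => X z r) (c / 2) := by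
          intro r hr
          by_cases hrx : r ≤ x
          · exact (hxs r ⟨hr.1.le, hrx⟩).mono (by linarith)
          · push Not at hrx
            refine hbδ r (hIJ hr) ?_
            rw [abs_of_pos (by linarith)]
            have := hr.2.trans_le (min_le_left _ _)
            linarith
        have hbI' : ∀ r ∈ Ioo 0 e, ∃ c > 0, CurvatureBound (fun z => X z r) c :=
          fun r hr => ⟨c / 2, by positivity, hbI r hr⟩
        have D := h.dualFamily hIJ hbI'
        -- The bounds on the support function are granted only while the curvature has been
        -- positive, which holds here: κ₀ at time 0 and c/2 afterwards.
        have hsol := h.supportSolution isOpen_Ioo hIJ D hbI' (C₀ := C₀) fun q r hr =>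
          hC r (hIJ hr) (fun s hs' => by
            rcases hs'.1.eq_or_lt with rfl | hs0
            · exact ⟨κ₀, hκ₀, hini0⟩
            · exact hbI' s ⟨hs0, hs'.2.trans_lt hr.2⟩) q
        set τ := min (δ₀ / 2) x with hτ
        have hτ0 : 0 < τ := lt_min (by positivity) hx0
        have hτx : τ ≤ x := min_le_right _ _
        have hτI : τ ∈ Ioo 0 e := ⟨hτ0, hτx.trans_lt hxe⟩
        have hbτ : CurvatureBound (fun z => X z τ) (κ₀ / 2) := by
          refine hb₀ τ (hIJ hτI) ?_
          rw [sub_zero, abs_of_pos hτ0]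
          have : τ ≤ δ₀ / 2 := min_le_left _ _
          linarith
        set z := min y ((x + e) / 2) with hz
        have hxz : x < z := lt_min hxy (by linarith)
        have hze : z < e := (min_le_right _ _).trans_lt (by linarith)
        -- The a priori estimate does not see the weakened constant c/2: it depends only on `C₀` and
        -- on the bound at time `τ`, so it returns the full constant beyond `x`.
        have hbound := hest (Ioo 0 e) _ hsol τ z
          (fun r hr => ⟨hτ0.trans_le hr.1, hr.2.trans_lt hze⟩) (by
            intro q w hqw
            obtain ⟨x', rfl⟩ := (h.convex τ (hIJ hτI)).exists_gaussMap_eq q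
            exact h.inner_spHess_le isOpen_Ioo hIJ D hτI x' (by positivity) hbτ (norm_sph w))
        refine ⟨z, fun r hr => ?_, hxz, min_le_left _ _⟩
        by_cases hrx : r ≤ x
        · exact hxs r ⟨hr.1, hrx⟩
        · push Not at hrx
          have hrI : r ∈ Ioo 0 e := ⟨hx0.trans hrx, hr.2.trans_lt hze⟩
          exact (h.curvatureBound_of_spHess_le isOpen_Ioo hIJ D hrI hΛ hsol
            (hbound r ⟨hτx.trans hrx.le, hr.2⟩)).mono (min_le_right _ _)
  exact hsub ⟨ht₁.1, le_rfl⟩ t₁ ⟨ht₁.1, le_rfl⟩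

/-! ### Integration and change of variables on the sphere -/

instance instIsFiniteMeasureSphMeasure : IsFiniteMeasure (sphMeasure d) := by
  unfold sphMeasure; infer_instance

lemma continuousOn_direction : ContinuousOn (direction : Euc d → Sph d) {0}ᶜ := fun _ hy =>
  (contMDiffAt_direction hy).continuousAt.continuousWithinAt

lemma measurableSet_puncturedBall : MeasurableSet (Metric.ball (0 : Euc d) 1 \ {0}) :=
  measurableSet_ball.diff (measurableSet_singleton 0)

lemma aemeasurable_direction :
    AEMeasurable (direction : Euc d → Sph d) (volume.restrict (Metric.ball 0 1 \ {0})) :=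
  (continuousOn_direction.mono fun _ hy => hy.2).aemeasurable measurableSet_puncturedBall

open scoped Pointwise in
/-- The spherical measure is the image of Lebesgue measure on the unit ball. -/
lemma sphMeasure_eq_map : sphMeasure d = ((d + 1 : ℕ) : ENNReal) •
    Measure.map direction (volume.restrict (Metric.ball (0 : Euc d) 1 \ {0})) := by
  ext s hs
  rw [sphMeasure, Measure.toSphere_apply' _ hs, Measure.smul_apply,
    Measure.map_apply_of_aemeasurable aemeasurable_direction hs,
    Measure.restrict_apply' measurableSet_puncturedBall]
  have h1 : Ioo (0 : ℝ) 1 • ((↑) '' s : Set (Euc d)) =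
      direction ⁻¹' s ∩ (Metric.ball (0 : Euc d) 1 \ {0}) := by
    ext y
    constructor
    · rintro ⟨r, hr, _, ⟨x, hx, rfl⟩, rfl⟩
      refine ⟨?_, ?_, smul_ne_zero hr.1.ne' (sph_ne_zero x)⟩
      · simpa only [mem_preimage, direction_smul_coe hr.1] using hx
      · simpa [norm_smul, abs_of_pos hr.1] using hr.2
    · rintro ⟨h1, h2, h3⟩
      refine ⟨‖y‖, ⟨norm_pos_iff.2 h3, by simpa using h2⟩, _, ⟨direction y, h1, rfl⟩,
        norm_smul_direction h3⟩
  rw [h1]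
  simp

lemma integral_sphMeasure {φ : Sph d → ℝ} (hφ : Continuous φ) :
    ∫ x, φ x ∂(sphMeasure d) =
      (d + 1) * ∫ z in Metric.ball (0 : Euc d) 1 \ {0}, φ (direction z) := by
  rw [sphMeasure_eq_map, integral_smul_measure,
    integral_map aemeasurable_direction hφ.aestronglyMeasurable, ENNReal.toReal_natCast]
  simp

/-- Change of variables on the sphere. -/
lemma integral_comp_mul_abs_det {ψ : Sph d → Sph d} (hψ : Function.Bijective ψ)
    (hs : ContDiffOn ℝ ∞ (conicExt fun x => (ψ x : Euc d)) {0}ᶜ) {φ : Sph d → ℝ}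
    (hφ : Continuous φ) :
    ∫ x, φ (ψ x) * |(fderiv ℝ (conicExt fun x => (ψ x : Euc d)) (x : Euc d)).det| ∂(sphMeasure d) =
      ∫ x, φ x ∂(sphMeasure d) := by
  -- The conic extension of a bijection of the sphere preserves norms, hence permutes the punctured
  -- unit ball. The Euclidean formula applies there, and the Jacobian depends only on the direction.
  set Ψ : Euc d → Euc d := conicExt fun x => (ψ x : Euc d) with hΨ
  have hU : IsOpen ({0}ᶜ : Set (Euc d)) := isOpen_compl_singleton
  have hnorm : ∀ y : Euc d, ‖Ψ y‖ = ‖y‖ := fun y => by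
    rw [hΨ, conicExt, norm_smul, norm_norm, norm_sph, mul_one]
  have hdir : ∀ y : Euc d, y ≠ 0 → direction (Ψ y) = ψ (direction y) := fun y hy => by
    rw [hΨ, conicExt, direction_smul_coe (norm_pos_iff.2 hy)]
  have hψc : Continuous ψ := by
    rw [continuous_induced_rng]
    have h1 : Continuous fun x : Sph d => Ψ (x : Euc d) :=
      hs.continuousOn.comp_continuous continuous_subtype_val fun x => sph_ne_zero x
    simpa [hΨ, Function.comp_def] using h1
  have hdet : Continuous fun x : Sph d => (fderiv ℝ Ψ (x : Euc d)).det := by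
    have h1 : ContinuousOn (fderiv ℝ Ψ) {0}ᶜ :=
      (hs.fderiv_of_isOpen hU (m := ∞) (by simp)).continuousOn
    exact ContinuousLinearMap.continuous_det.comp
      (h1.comp_continuous continuous_subtype_val fun x => sph_ne_zero x)
  have himage : Ψ '' (Metric.ball (0 : Euc d) 1 \ {0}) = Metric.ball (0 : Euc d) 1 \ {0} := by
    ext z
    constructor
    · rintro ⟨y, ⟨hy1, hy2⟩, rfl⟩
      refine ⟨by simpa [hnorm] using hy1, ?_⟩
      have : Ψ y ≠ 0 := by rw [← norm_pos_iff, hnorm]; exact norm_pos_iff.2 hy2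
      simpa using this
    · rintro ⟨hz1, hz2⟩
      have hz0 : z ≠ 0 := hz2
      have hzn := norm_pos_iff.2 hz0
      obtain ⟨x, hx⟩ := hψ.2 (direction z)
      have e : Ψ (‖z‖ • (x : Euc d)) = z := by
        rw [hΨ, conicExt_smul _ hzn, conicExt_coe, hx, norm_smul_direction hz0]
      refine ⟨‖z‖ • (x : Euc d), ⟨?_, smul_ne_zero hzn.ne' (sph_ne_zero x)⟩, e⟩
      simpa [norm_smul] using hz1
  have hinj : InjOn Ψ (Metric.ball (0 : Euc d) 1 \ {0}) := by
    intro y hy z hz hyz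
    have h1 : ‖y‖ = ‖z‖ := by rw [← hnorm, hyz, hnorm]
    have h2 : direction y = direction z := by
      apply hψ.1
      rw [← hdir y hy.2, hyz, hdir z hz.2]
    rw [← norm_smul_direction hy.2, h1, h2, norm_smul_direction hz.2]
  have hcov := integral_image_eq_integral_abs_det_fderiv_smul (volume : Measure (Euc d))
    measurableSet_puncturedBall (f := Ψ) (f' := fderiv ℝ Ψ)
    (fun y hy => ((hs.contDiffAt (hU.mem_nhds hy.2)).differentiableAt
      (by simp)).hasFDerivAt.hasFDerivWithinAt) hinj (fun z => φ (direction z))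
  rw [himage] at hcov
  rw [integral_sphMeasure hφ, hcov, integral_sphMeasure (by fun_prop)]
  congr 1
  refine setIntegral_congr_fun measurableSet_puncturedBall fun y hy => ?_
  have hy0 : y ≠ 0 := hy.2
  have h1 : fderiv ℝ Ψ y = fderiv ℝ Ψ (direction y : Euc d) := by
    conv_lhs => rw [← norm_smul_direction hy0]
    exact fderiv_conicExt_smul _ (norm_pos_iff.2 hy0) _
  simp only [smul_eq_mul]
  rw [hdir y hy0, h1, mul_comm]

/-- Differentiation under the integral over the sphere. -/
lemma hasDerivAt_integral_sph {I : Set ℝ} (hI : IsOpen I) {F : Euc d × ℝ → ℝ}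
    (hF : ContDiffOn ℝ ∞ F ({0}ᶜ ×ˢ I)) {φ : Sph d → ℝ} (hφ : Continuous φ) {t : ℝ} (ht : t ∈ I) :
    HasDerivAt (fun t => ∫ q, φ q * F ((q : Euc d), t) ∂(sphMeasure d))
      (∫ q, φ q * dt F ((q : Euc d), t) ∂(sphMeasure d)) t := by
  have hU := isOpen_domain (d := d) hI
  have hFt : ContDiffOn ℝ ∞ (dt F) ({0}ᶜ ×ˢ I) := contDiffOn_dd hU hF _
  obtain ⟨ε, hε, hball⟩ := Metric.nhds_basis_closedBall.mem_iff.1 (hI.mem_nhds ht)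
  have hc : ∀ {G : Euc d × ℝ → ℝ}, ContDiffOn ℝ ∞ G ({0}ᶜ ×ˢ I) → ∀ s ∈ I,
      Continuous fun q : Sph d => φ q * G ((q : Euc d), s) := fun hG s hs =>
    hφ.mul (hG.continuousOn.comp_continuous (f := fun q : Sph d => ((q : Euc d), s))
      (by fun_prop) fun q => ⟨sph_ne_zero q, hs⟩)
  have hint : ∀ {u : Sph d → ℝ}, Continuous u → Integrable u (sphMeasure d) := fun hu =>
    hu.integrable_of_hasCompactSupport (HasCompactSupport.of_compactSpace _)
  have hK : IsCompact ((univ : Set (Sph d)) ×ˢ Metric.closedBall t ε) :=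
    isCompact_univ.prod (isCompact_closedBall t ε)
  have hcont : ContinuousOn (fun z : Sph d × ℝ => φ z.1 * dt F ((z.1 : Euc d), z.2))
      ((univ : Set (Sph d)) ×ˢ Metric.closedBall t ε) :=
    (hφ.comp continuous_fst).continuousOn.mul
      (hFt.continuousOn.comp (f := fun z : Sph d × ℝ => ((z.1 : Euc d), z.2)) (by fun_prop)
        fun z hz => ⟨sph_ne_zero _, hball hz.2⟩)
  obtain ⟨C, hC⟩ := hK.exists_bound_of_continuousOn hcont
  refine (hasDerivAt_integral_of_dominated_loc_of_deriv_le (s := Metric.closedBall t ε)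
    (F := fun s q => φ q * F ((q : Euc d), s)) (F' := fun s q => φ q * dt F ((q : Euc d), s))
    (bound := fun _ => C)
    (Metric.closedBall_mem_nhds t hε) ?_ (hint (hc hF t ht)) (hc hFt t ht).aestronglyMeasurable
    ?_ (integrable_const C) ?_).2
  · filter_upwards [hI.mem_nhds ht] with s hs using (hc hF s hs).aestronglyMeasurable
  · exact .of_forall fun q s hs => hC (q, s) ⟨mem_univ _, hs⟩
  · refine .of_forall fun q s hs => ?_
    have hmem : ((q : Euc d), s) ∈ ({0}ᶜ : Set (Euc d)) ×ˢ I := ⟨sph_ne_zero q, hball hs⟩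
    have h1 : HasDerivAt (fun s : ℝ => ((q : Euc d), s)) ((0 : Euc d), (1 : ℝ)) s :=
      (hasDerivAt_const s (q : Euc d)).prodMk (hasDerivAt_id s)
    exact (HasFDerivAt.comp_hasDerivAt s
      (differentiableAt_of_contDiffOn hU hF hmem).hasFDerivAt h1).const_mul _

lemma contDiffOn_radialExt_of_conicExt {F : Type*} [NormedAddCommGroup F] [NormedSpace ℝ F]
    {p : Sph d → F} (hp : ContDiffOn ℝ ∞ (conicExt p) {0}ᶜ) :
    ContDiffOn ℝ ∞ (radialExt p) {0}ᶜ := by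
  have h1 : ContDiffOn ℝ ∞ (fun y : Euc d => ‖y‖⁻¹) {0}ᶜ := fun y hy =>
    ((contDiffAt_norm ℝ hy).inv (norm_ne_zero_iff.2 hy)).contDiffWithinAt
  refine (h1.smul hp).congr fun y hy => ?_
  change radialExt p y = ‖y‖⁻¹ • conicExt p y
  rw [conicExt_eq, smul_smul, inv_mul_cancel₀ (norm_ne_zero_iff.2 hy), one_smul]

lemma conicExt_direction {p : Sph d → Euc d} (h0 : ∀ x, p x ≠ 0) :
    (conicExt fun x => (direction (p x) : Euc d)) =
      fun y => radialExt (fun x => ‖p x‖⁻¹) y • conicExt p y := by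
  funext y
  rw [conicExt, conicExt, radialExt, coe_direction (h0 _), smul_comm]

lemma contDiffOn_radialExt_norm_inv {p : Sph d → Euc d} (h0 : ∀ x, p x ≠ 0)
    (hp : ContDiffOn ℝ ∞ (conicExt p) {0}ᶜ) :
    ContDiffOn ℝ ∞ (radialExt fun x => ‖p x‖⁻¹) {0}ᶜ := by
  have h1 := contDiffOn_radialExt_of_conicExt hp
  exact (h1.norm ℝ fun y _ => h0 (direction y)).inv fun y _ => norm_ne_zero_iff.2 (h0 _)

lemma contDiffOn_conicExt_direction {p : Sph d → Euc d} (h0 : ∀ x, p x ≠ 0)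
    (hp : ContDiffOn ℝ ∞ (conicExt p) {0}ᶜ) :
    ContDiffOn ℝ ∞ (conicExt fun x => (direction (p x) : Euc d)) {0}ᶜ := by
  rw [conicExt_direction h0]
  exact (contDiffOn_radialExt_norm_inv h0 hp).smul hp

/-- The Jacobian of the direction of a hypersurface. -/
lemma det_fderiv_conicExt_direction {p : Sph d → Euc d} (h0 : ∀ x, p x ≠ 0)
    (hp : ContDiffOn ℝ ∞ (conicExt p) {0}ᶜ) (x : Sph d) :
    (fderiv ℝ (conicExt fun x => (direction (p x) : Euc d)) (x : Euc d)).det =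
      ‖p x‖⁻¹ ^ (d + 1) * (fderiv ℝ (conicExt p) (x : Euc d)).det := by
  have hx := sph_ne_zero x
  have hU : ({0}ᶜ : Set (Euc d)) ∈ 𝓝 (x : Euc d) := isOpen_compl_singleton.mem_nhds hx
  have d1 : DifferentiableAt ℝ (radialExt fun x => ‖p x‖⁻¹) (x : Euc d) :=
    ((contDiffOn_radialExt_norm_inv h0 hp).contDiffAt hU).differentiableAt (by simp)
  have d2 : DifferentiableAt ℝ (conicExt p) (x : Euc d) :=
    (hp.contDiffAt hU).differentiableAt (by simp)
  have d3 : DifferentiableAt ℝ (radialExt p) (x : Euc d) :=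
    ((contDiffOn_radialExt_of_conicExt hp).contDiffAt hU).differentiableAt (by simp)
  have e1 : fderiv ℝ (conicExt p) (x : Euc d) x = p x := by
    rw [fderiv_conicExt d3, fderiv_radialExt_self _ hx d3, inner_sph_self, one_smul, zero_add]
  have e2 : fderiv ℝ (radialExt fun x => ‖p x‖⁻¹) (x : Euc d) x = 0 :=
    fderiv_radialExt_self _ hx d1
  set c := ‖p x‖⁻¹ with hc
  have hc0 : c ≠ 0 := inv_ne_zero (norm_ne_zero_iff.2 (h0 x))
  set P := fderiv ℝ (conicExt p) (x : Euc d) with hP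
  set L := fderiv ℝ (radialExt fun x => ‖p x‖⁻¹) (x : Euc d) with hL
  set a := (InnerProductSpace.toDual ℝ (Euc d)).symm L with ha
  have hav : ∀ v, ⟪a, v⟫ = L v := fun v => InnerProductSpace.toDual_symm_apply
  -- The normalising factor is constant along rays, so differentiating it adds a rank one term whose
  -- covector kills `x` and whose range is spanned by the image of `x`; the determinant is
  -- unaffected.
  have e3 : fderiv ℝ (conicExt fun x => (direction (p x) : Euc d)) (x : Euc d) =
      c • P + (innerSL ℝ a).smulRight ((c • P) (c⁻¹ • (x : Euc d))) := by
    rw [conicExt_direction h0]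
    have := (d1.hasFDerivAt.smul d2.hasFDerivAt).fderiv
    rw [show (fun y => radialExt (fun x => ‖p x‖⁻¹) y • conicExt p y) =
      (radialExt fun x => ‖p x‖⁻¹) • conicExt p from rfl, this]
    ext1 v
    simp only [add_apply, smul_apply, ContinuousLinearMap.smulRight_apply, innerSL_apply_apply, hav,
      map_smul, radialExt_coe, conicExt_coe]
    rw [e1, smul_smul, smul_smul, inv_mul_cancel_right₀ hc0]
  rw [e3, det_comp_one_add_rankOne, inner_smul_right, hav, e2, mul_zero, add_zero, mul_one,
    ContinuousLinearMap.det, ContinuousLinearMap.toLinearMap_smul, LinearMap.det_smul]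
  simp [ContinuousLinearMap.det]

namespace DualFamily

variable {Y p : Sph d → ℝ → Euc d} {I : Set ℝ} (h : DualFamily Y p I)
include h

lemma contDiffOn_right {t : ℝ} (ht : t ∈ I) : ContDiffOn ℝ ∞ (conicExt fun z => p z t) {0}ᶜ :=
  h.smooth_right.comp (f := fun y : Euc d => (y, t)) (by fun_prop) fun _ hy => ⟨hy, ht⟩

/-- Two different dual points on one ray would each have to be shorter than the other, by the strict
inequality between the pairings. -/
lemma bijective_direction {t : ℝ} (ht : t ∈ I) :
    Function.Bijective fun x => direction (p x t) := by
  refine ⟨fun x z hxz => ?_, fun q => h.surj t ht q⟩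
  by_contra hne
  have n1 := norm_pos_iff.2 (h.right_ne_zero ht x)
  have n2 := norm_pos_iff.2 (h.right_ne_zero ht z)
  have e1 := norm_smul_direction (h.right_ne_zero ht x)
  have e2 := norm_smul_direction (h.right_ne_zero ht z)
  replace hxz : direction (p x t) = direction (p z t) := hxz
  rw [hxz] at e1
  have a1 := h.inner_self t ht x
  have a2 := h.inner_self t ht z
  have a3 := h.inner_lt t ht x z hne
  have a4 := h.inner_lt t ht z x (Ne.symm hne)
  rw [← e1, inner_smul_right] at a1 a4
  rw [← e2, inner_smul_right] at a2 a3
  set s := ⟪Y x t, (direction (p z t) : Euc d)⟫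
  set r := ⟪Y z t, (direction (p z t) : Euc d)⟫
  have hs : 0 < s := by
    by_contra hs; push Not at hs
    nlinarith
  have hr : 0 < r := by
    by_contra hr; push Not at hr
    nlinarith
  have b1 : ‖p z t‖ * s < ‖p x t‖ * s := by linarith
  have b2 : ‖p x t‖ * r < ‖p z t‖ * r := by linarith
  have c1 := lt_of_mul_lt_mul_right b1 hs.le
  have c2 := lt_of_mul_lt_mul_right b2 hr.le
  linarith

lemma supExt_pos {t : ℝ} (ht : t ∈ I) {q : Euc d} (hq : q ≠ 0) : 0 < supExt (fun z => Y z t) q := by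
  obtain ⟨y, hy, rfl⟩ := h.exists_conicExt_eq ht hq
  rw [h.supExt_conicExt ht]
  exact norm_pos_iff.2 hy

/-- Derivative of the entropy of a family of hypersurfaces. -/
lemma hasDerivAt_integral_log_supExt (hI : IsOpen I) {φ : Sph d → ℝ} (hφ : Continuous φ) {t : ℝ}
    (ht : t ∈ I) :
    HasDerivAt (fun s => ∫ q, φ q * Real.log (supExt (fun z => Y z s) (q : Euc d)) ∂(sphMeasure d))
      (∫ x, φ (direction (p x t)) * ⟪deriv (fun s => Y x s) t, p x t⟫ *
        (‖p x t‖⁻¹ ^ (d + 1) * |(fderiv ℝ (conicExt fun z => p z t) (x : Euc d)).det|)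
        ∂(sphMeasure d)) t := by
  set H : Euc d × ℝ → ℝ := fun w => supExt (fun z => Y z w.2) w.1 with hH
  have hU := isOpen_domain (d := d) hI
  have hHs : ContDiffOn ℝ ∞ H ({0}ᶜ ×ˢ I) := h.contDiffOn_supExt hI
  have hF : ContDiffOn ℝ ∞ (fun w => Real.log (H w)) ({0}ᶜ ×ˢ I) :=
    hHs.log fun w hw => (h.supExt_pos hw.2 hw.1).ne'
  have h0 : ∀ x, p x t ≠ 0 := h.right_ne_zero ht
  have key := hasDerivAt_integral_sph hI hF hφ ht
  have hcont : Continuous fun q : Sph d =>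
      φ q * dt (fun w => Real.log (H w)) ((q : Euc d), t) :=
    hφ.mul ((contDiffOn_dd hU hF _).continuousOn.comp_continuous
      (f := fun q : Sph d => ((q : Euc d), t)) (by fun_prop) fun q => ⟨sph_ne_zero q, ht⟩)
  refine key.congr_deriv ?_
  -- Substituting the direction of p for q, where the envelope formula turns the time derivative of
  -- log H into ⟨∂_t Y, p⟩.
  rw [← integral_comp_mul_abs_det (h.bijective_direction ht)
    (contDiffOn_conicExt_direction h0 (h.contDiffOn_right ht)) hcont]
  refine integral_congr_ae (.of_forall fun x => ?_)
  have hn := norm_pos_iff.2 (h0 x)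
  have hy : ‖p x t‖⁻¹ • (x : Euc d) ≠ 0 := smul_ne_zero (inv_ne_zero hn.ne') (sph_ne_zero x)
  have e1 : conicExt (fun z => p z t) (‖p x t‖⁻¹ • (x : Euc d)) = (direction (p x t) : Euc d) := by
    rw [conicExt_smul _ (inv_pos.2 hn), conicExt_coe, coe_direction (h0 x)]
  have e2 := h.dt_supExt hI ht hy
  have e3 := h.supExt_conicExt ht (‖p x t‖⁻¹ • (x : Euc d))
  rw [direction_smul_coe (inv_pos.2 hn)] at e2
  rw [e1] at e2 e3
  have e4 : dt (fun w => Real.log (H w)) ((direction (p x t) : Euc d), t) =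
      ⟪deriv (fun s => Y x s) t, p x t⟫ := by
    have hd := differentiableAt_of_contDiffOn hU hHs
      (p := ((direction (p x t) : Euc d), t)) ⟨sph_ne_zero _, ht⟩
    have hne : H ((direction (p x t) : Euc d), t) ≠ 0 :=
      (h.supExt_pos ht (sph_ne_zero (direction (p x t)))).ne'
    have e5 := (hd.hasFDerivAt.log hne).fderiv
    change fderiv ℝ (fun w => Real.log (H w)) _ _ = _
    rw [e5, smul_apply]
    change (H _)⁻¹ • dt H _ = _
    rw [e2, coe_direction (h0 x), inner_smul_right, smul_eq_mul]
    have e6 : H (‖p x t‖⁻¹ • p x t, t) = ‖p x t‖⁻¹ := by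
      rw [← coe_direction (h0 x)]
      refine e3.trans ?_
      rw [norm_smul, norm_sph, mul_one, norm_inv, norm_norm]
    rw [e6, inv_inv]
    field_simp
  simp only
  rw [e4, det_fderiv_conicExt_direction h0 (h.contDiffOn_right ht), abs_mul,
    abs_of_pos (pow_pos (inv_pos.2 hn) _)]

end DualFamily

/-! ### Monotone and conserved logarithmic integrals -/

/-- The integral of the logarithm of the support function with density `φ`. -/
def logIntegral (φ : Sph d → ℝ) (Y : Sph d → Euc d) : ℝ :=
  ∫ q, φ q * Real.log (supExt Y (q : Euc d)) ∂(sphMeasure d)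

/-- The derivatives are computed only at interior times; continuity carries the comparison to the
initial time. -/
lemma continuousOn_logIntegral {φ : Sph d → ℝ} (hφ : Continuous φ) {Y : Sph d → ℝ → Euc d}
    {J : Set ℝ} (hY : ContinuousOn (fun z : Sph d × ℝ => Y z.1 z.2) (univ ×ˢ J))
    (hpos : ∀ t ∈ J, ∀ q : Sph d, 0 < supExt (fun z => Y z t) (q : Euc d)) :
    ContinuousOn (fun t => logIntegral φ fun z => Y z t) J := by
  rw [continuousOn_iff_continuous_domRestrict]
  have h1 : Continuous fun z : (J × Sph d) × Sph d => ⟪Y z.2 (z.1.1 : ℝ), (z.1.2 : Euc d)⟫ := by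
    have h2 : Continuous fun z : (J × Sph d) × Sph d => Y z.2 (z.1.1 : ℝ) :=
      hY.comp_continuous (f := fun z : (J × Sph d) × Sph d => (z.2, (z.1.1 : ℝ))) (by fun_prop)
        fun z => ⟨mem_univ _, z.1.1.2⟩
    exact h2.inner (by fun_prop)
  have h3 := (isCompact_univ (X := Sph d)).continuous_sSup
    (f := fun (z : J × Sph d) (x : Sph d) => ⟪Y x (z.1 : ℝ), (z.2 : Euc d)⟫) h1
  simp only [image_univ] at h3
  have h4 : Continuous fun z : J × Sph d =>
      φ z.2 * Real.log (supExt (fun x => Y x (z.1 : ℝ)) (z.2 : Euc d)) :=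
    (hφ.comp continuous_snd).mul (Continuous.log h3 fun z => (hpos z.1 z.1.2 z.2).ne')
  have h5 := continuousOn_integral_of_compact_support (μ := sphMeasure d) (s := univ)
    (f := fun (t : J) (q : Sph d) => φ q * Real.log (supExt (fun x => Y x (t : ℝ)) (q : Euc d)))
    isCompact_univ h4.continuousOn (fun p x _ hx => absurd (mem_univ x) hx)
  rw [continuousOn_univ] at h5
  exact h5

namespace IsStrictlyConvexEmbedding

variable {Y : Sph d → Euc d} (hY : IsStrictlyConvexEmbedding Y)
include hY

lemma supExt_pos (q : Sph d) : 0 < supExt Y (q : Euc d) := by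
  obtain ⟨x, rfl⟩ := hY.exists_gaussMap_eq q
  rw [← supportFn_eq_supExt, hY.supportFn_gaussMap]
  exact hY.height_pos x

lemma continuous_dualPt : Continuous (dualPt Y) := by
  have h1 : Continuous fun x : Sph d => conicExt (dualPt Y) (x : Euc d) :=
    hY.contDiffOn_conicExt_dualPt.continuousOn.comp_continuous continuous_subtype_val
      fun x => sph_ne_zero x
  simpa using h1

lemma supExt_dualPt (x : Sph d) : supExt (dualPt Y) (Y x) = 1 := by
  rw [supExt_eq_of_le (x := x), real_inner_comm, hY.inner_dualPt_self]
  intro z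
  rw [real_inner_comm, real_inner_comm (Y x), hY.inner_dualPt_self]
  exact hY.inner_dualPt_le x z

/-- The support function of the polar dual is the reciprocal of the radial function, so its
logarithmic integral is minus that of the radial function. -/
lemma supExt_dualPt_direction (x : Sph d) :
    supExt (dualPt Y) (direction (Y x) : Euc d) = ‖Y x‖⁻¹ := by
  rw [coe_direction (hY.ne_zero x), supExt_smul hY.continuous_dualPt (inv_nonneg.2 (norm_nonneg _)),
    hY.supExt_dualPt, mul_one]

lemma supExt_dualPt_pos (q : Sph d) : 0 < supExt (dualPt Y) (q : Euc d) := by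
  obtain ⟨x, rfl⟩ := hY.exists_direction_eq q
  rw [hY.supExt_dualPt_direction]
  exact inv_pos.2 (norm_pos_iff.2 (hY.ne_zero x))

lemma gaussCurvature_nonneg {c : ℝ} (hc : 0 ≤ c) (hb : CurvatureBound Y c) (x : Sph d) :
    0 ≤ gaussCurvature Y x := by
  have hsymm : (secondForm Y x).IsHermitian := by
    ext i j
    simp only [Matrix.conjTranspose_apply, star_trivial, hY.secondForm_eq]
    rw [hY.curvature_symm]
  have hpsd : (secondForm Y x).PosSemidef := by
    apply Matrix.PosSemidef.of_dotProduct_mulVec_nonneg hsymm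
    intro v
    rw [star_trivial, hY.dotProduct_secondForm]
    exact le_trans (by positivity) (hb x _ (inner_sphIncl x _))
  rw [gaussCurvature, weingarten, Matrix.det_mul, Matrix.det_nonsing_inv, Ring.inverse_eq_inv']
  exact mul_nonneg (inv_nonneg.2 (hY.firstForm_posDef x).det_pos.le) hpsd.det_nonneg

end IsStrictlyConvexEmbedding

namespace IsConvexSolution

variable {f g : Sph d → ℝ} {X₀ : Sph d → Euc d} {T : EReal} {X : Sph d → ℝ → Euc d}
  (h : IsConvexSolution f g X₀ T X)
include h

/-- With the roles exchanged, the immersion requirement concerns the cone over X, so no curvature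
hypothesis is needed. -/
lemma dualFamily_swap {I : Set ℝ} (hI : I ⊆ timeInterval T) :
    DualFamily (fun x t => dualPt (fun z => X z t) x) X I where
  smooth_left := h.contDiffOn_conic_dual.mono (prod_mono_right hI)
  smooth_right := (contDiffOn_conicExt_family h.contDiffOn_radial).mono (prod_mono_right hI)
  inner_self t ht x := by rw [real_inner_comm]; exact (h.convex t (hI ht)).inner_dualPt_self x
  inner_lt t ht x z hxz := by
    rw [real_inner_comm]; exact (h.convex t (hI ht)).inner_dualPt_lt hxz.symm
  injective t ht x := (h.convex t (hI ht)).fderiv_conic_injective x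
  surj t ht q := (h.convex t (hI ht)).exists_direction_eq q

lemma continuousOn_logIntegral {φ : Sph d → ℝ} (hφ : Continuous φ) :
    ContinuousOn (fun t => logIntegral φ fun z => X z t) (timeInterval T) ∧
    ContinuousOn (fun t => logIntegral φ (dualPt fun z => X z t)) (timeInterval T) := by
  have D := h.dualFamily_swap subset_rfl
  exact ⟨GaussFlow.continuousOn_logIntegral hφ D.continuousOn_right
      fun t ht q => (h.convex t ht).supExt_pos q,
    GaussFlow.continuousOn_logIntegral hφ (Y := fun x t => dualPt (fun z => X z t) x)
      D.continuousOn_left fun t ht q => (h.convex t ht).supExt_dualPt_pos q⟩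

/-- The derivatives of the two integrals along the flow. -/
lemma hasDerivAt_logIntegral (hfc : Continuous f) (hgc : Continuous g)
    (hg_pos : ∀ x, 0 < g x)
    (hfg : ∫ x, f x ∂(sphMeasure d) = ∫ x, g x ∂(sphMeasure d))
    {I : Set ℝ} (hIo : IsOpen I) (hI : I ⊆ timeInterval T)
    (hb : ∀ t ∈ I, ∃ c > 0, CurvatureBound (fun z => X z t) c) {t : ℝ} (ht : t ∈ I) :
    HasDerivAt (fun t => logIntegral g (dualPt fun z => X z t)) 0 t ∧
    ∃ D ≤ 0, HasDerivAt (fun t => logIntegral f fun z => X z t) D t := by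
  have D := h.dualFamily hI hb
  have D' := h.dualFamily_swap hI
  have hY := h.convex t (hI ht)
  obtain ⟨c, hc, hcb⟩ := hb t ht
  have dA := D.hasDerivAt_integral_log_supExt hIo hfc ht
  have dB := D'.hasDerivAt_integral_log_supExt hIo hgc ht
  -- `Jf` and `Jg` are the densities f and g pulled back by the Gauss map and by radial projection;
  -- each keeps its total mass. The flow says that the relative normal speed is u = 1 - Jf/Jg.
  set Jf : Sph d → ℝ := fun x => f (direction (dualPt (fun z => X z t) x)) *
    (‖dualPt (fun z => X z t) x‖⁻¹ ^ (d + 1) *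
      |(fderiv ℝ (conicExt (dualPt fun z => X z t)) (x : Euc d)).det|) with hJf
  set Jg : Sph d → ℝ := fun x => g (direction (X x t)) *
    (‖X x t‖⁻¹ ^ (d + 1) * |(fderiv ℝ (conicExt fun z => X z t) (x : Euc d)).det|) with hJg
  have hdir : ∀ {p : Sph d → Euc d}, (∀ x, p x ≠ 0) → ContDiffOn ℝ ∞ (conicExt p) {0}ᶜ →
      Continuous (fun x => direction (p x)) ∧ Continuous fun x : Sph d =>
        ‖p x‖⁻¹ ^ (d + 1) * |(fderiv ℝ (conicExt p) (x : Euc d)).det| := by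
    intro p h0 hp
    have hpc : Continuous p := by
      have h1 : Continuous fun x : Sph d => conicExt p (x : Euc d) :=
        hp.continuousOn.comp_continuous continuous_subtype_val fun x => sph_ne_zero x
      simpa using h1
    refine ⟨continuousOn_direction.comp_continuous hpc h0, ?_⟩
    have h1 : ContinuousOn (fderiv ℝ (conicExt p)) {0}ᶜ :=
      (hp.fderiv_of_isOpen isOpen_compl_singleton (m := ∞) (by simp)).continuousOn
    have h2 : Continuous fun x : Sph d => (fderiv ℝ (conicExt p) (x : Euc d)).det :=
      ContinuousLinearMap.continuous_det.comp
        (h1.comp_continuous continuous_subtype_val fun x => sph_ne_zero x)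
    exact ((hpc.norm.inv₀ fun x => norm_ne_zero_iff.2 (h0 x)).pow _).mul h2.abs
  have hsX := D'.contDiffOn_right ht
  have hsP : ContDiffOn ℝ ∞ (conicExt (dualPt fun z => X z t)) {0}ᶜ := D.contDiffOn_right ht
  have cJf : Continuous Jf := (hfc.comp (hdir hY.dualPt_ne_zero hsP).1).mul
    (hdir hY.dualPt_ne_zero hsP).2
  have cJg : Continuous Jg := (hgc.comp (hdir hY.ne_zero hsX).1).mul (hdir hY.ne_zero hsX).2
  have hint : ∀ {u : Sph d → ℝ}, Continuous u → Integrable u (sphMeasure d) := fun hu =>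
    hu.integrable_of_hasCompactSupport (HasCompactSupport.of_compactSpace _)
  have iJf : ∫ x, Jf x ∂(sphMeasure d) = ∫ x, f x ∂(sphMeasure d) := by
    rw [← integral_comp_mul_abs_det (D.bijective_direction ht)
      (contDiffOn_conicExt_direction hY.dualPt_ne_zero hsP) hfc]
    refine integral_congr_ae (.of_forall fun x => ?_)
    simp only [hJf]
    rw [det_fderiv_conicExt_direction hY.dualPt_ne_zero hsP, abs_mul,
      abs_of_pos (pow_pos (inv_pos.2 (norm_pos_iff.2 (hY.dualPt_ne_zero x))) _)]
  have iJg : ∫ x, Jg x ∂(sphMeasure d) = ∫ x, g x ∂(sphMeasure d) := by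
    rw [← integral_comp_mul_abs_det (D'.bijective_direction ht)
      (contDiffOn_conicExt_direction hY.ne_zero hsX) hgc]
    refine integral_congr_ae (.of_forall fun x => ?_)
    simp only [hJg]
    rw [det_fderiv_conicExt_direction hY.ne_zero hsX, abs_mul,
      abs_of_pos (pow_pos (inv_pos.2 (norm_pos_iff.2 (hY.ne_zero x))) _)]
  have Jg_pos : ∀ x, 0 ≤ Jg x := fun x => by
    have := (hg_pos (direction (X x t))).le
    positivity
  -- the normal speed
  have hu : ∀ x, ⟪deriv (fun s => X x s) t, dualPt (fun z => X z t) x⟫ * Jg x = Jg x - Jf x := by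
    intro x
    have hg0 := (hg_pos (direction (X x t))).ne'
    have hη := hY.height_pos x
    have hX0 := norm_pos_iff.2 (hY.ne_zero x)
    obtain ⟨-, hK⟩ := hY.gaussCurvature_mul_det x
    have hK' := congrArg (fun r => |r|) hK
    simp only [abs_mul, abs_of_nonneg (hY.gaussCurvature_nonneg hc.le hcb x), abs_pow,
      abs_of_pos hη] at hK'
    have hp : dualPt (fun z => X z t) x = (⟪X x t, (gaussMap (fun z => X z t) x : Euc d)⟫)⁻¹ •
      (gaussMap (fun z => X z t) x : Euc d) := rfl
    have e1 := hY.norm_dualPt x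
    have e2 := hY.direction_dualPt x
    have e3 := hY.inner_dualPt_self x
    rw [(h.deriv_eq hIo hI ht x).deriv, inner_add_left, e3, real_inner_smul_left]
    have e4 : ⟪(gaussMap (fun z => X z t) x : Euc d), dualPt (fun z => X z t) x⟫ =
        (⟪X x t, (gaussMap (fun z => X z t) x : Euc d)⟫)⁻¹ := by
      rw [hp, inner_smul_right, inner_sph_self, mul_one]
    rw [e4]
    simp only [hJf, hJg]
    rw [e1, e2, inv_inv]
    set η := ⟪X x t, (gaussMap (fun z => X z t) x : Euc d)⟫
    set K := gaussCurvature (fun z => X z t) x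
    set P := |(fderiv ℝ (conicExt (dualPt fun z => X z t)) (x : Euc d)).det|
    set A := |(fderiv ℝ (conicExt fun z => X z t) (x : Euc d)).det|
    set r := ‖X x t‖
    have e5 : η ^ (d + 1) * P = K * A * η⁻¹ := by
      rw [hK']; field_simp; ring
    rw [e5, inv_pow]
    field_simp
    ring
  -- Differentiating ⟨p, X⟩ = 1 in time: the dual hypersurface moves with the opposite relative
  -- speed, so the integrand for g becomes Jf - Jg, of total integral zero.
  have hdual : ∀ x, ⟪deriv (fun s => dualPt (fun z => X z s) x) t, X x t⟫ =
      -⟪deriv (fun s => X x s) t, dualPt (fun z => X z t) x⟫ := by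
    intro x
    have h1 := (D'.differentiableAt_left_time hIo ht x).hasDerivAt
    have h2 := (D.differentiableAt_left_time hIo ht x).hasDerivAt
    have h3 := h1.inner ℝ h2
    have h4 : (fun s => ⟪dualPt (fun z => X z s) x, X x s⟫) =ᶠ[𝓝 t] fun _ => (1 : ℝ) := by
      filter_upwards [hIo.mem_nhds ht] with s hs using D'.inner_self s hs x
    have h5 := h3.unique ((hasDerivAt_const t (1 : ℝ)).congr_of_eventuallyEq h4)
    rw [real_inner_comm] at h5
    linarith
  have hB0 : ∫ x, g (direction (X x t)) *
      ⟪deriv (fun s => dualPt (fun z => X z s) x) t, X x t⟫ *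
      (‖X x t‖⁻¹ ^ (d + 1) * |(fderiv ℝ (conicExt fun z => X z t) (x : Euc d)).det|)
        ∂(sphMeasure d) = 0 := by
    have : ∀ x, g (direction (X x t)) *
      ⟪deriv (fun s => dualPt (fun z => X z s) x) t, X x t⟫ *
      (‖X x t‖⁻¹ ^ (d + 1) * |(fderiv ℝ (conicExt fun z => X z t) (x : Euc d)).det|) =
        Jf x - Jg x := by
      intro x
      rw [hdual, ← neg_sub, ← hu]
      simp only [hJg]
      ring
    simp only [this]
    rw [integral_sub (hint cJf) (hint cJg), iJf, iJg, hfg, sub_self]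
  refine ⟨dB.congr_deriv hB0, _, ?_, dA⟩
  -- The integrand is u Jf with Jf = (1 - u) Jg, and it falls short of Jg - Jf = u Jg by u² Jg ≥ 0.
  have hle : ∀ x, f (direction (dualPt (fun z => X z t) x)) *
      ⟪deriv (fun s => X x s) t, dualPt (fun z => X z t) x⟫ *
      (‖dualPt (fun z => X z t) x‖⁻¹ ^ (d + 1) *
        |(fderiv ℝ (conicExt (dualPt fun z => X z t)) (x : Euc d)).det|) ≤ Jg x - Jf x := by
    intro x
    set u := ⟪deriv (fun s => X x s) t, dualPt (fun z => X z t) x⟫ with hudef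
    have h1 := hu x
    have h2 : f (direction (dualPt (fun z => X z t) x)) * u *
      (‖dualPt (fun z => X z t) x‖⁻¹ ^ (d + 1) *
        |(fderiv ℝ (conicExt (dualPt fun z => X z t)) (x : Euc d)).det|) = u * Jf x := by
      simp only [hJf]; ring
    rw [h2]
    have h3 : Jf x = (1 - u) * Jg x := by linarith
    rw [h3]
    nlinarith [mul_nonneg (sq_nonneg u) (Jg_pos x)]
  have hcont : Continuous fun x => f (direction (dualPt (fun z => X z t) x)) *
      ⟪deriv (fun s => X x s) t, dualPt (fun z => X z t) x⟫ *
      (‖dualPt (fun z => X z t) x‖⁻¹ ^ (d + 1) *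
        |(fderiv ℝ (conicExt (dualPt fun z => X z t)) (x : Euc d)).det|) := by
    have h1 : Continuous fun x => ⟪deriv (fun s => X x s) t, dualPt (fun z => X z t) x⟫ := by
      have : ∀ x, ⟪deriv (fun s => X x s) t, dualPt (fun z => X z t) x⟫ =
          dt (flowSupport X) ((gaussMap (fun z => X z t) x : Euc d), t) /
            flowSupport X ((gaussMap (fun z => X z t) x : Euc d), t) := by
        intro x
        rw [h.flowSupport_gaussMap hI ht, h.dt_flowSupport hIo hI D ht,
          (h.deriv_eq hIo hI ht x).deriv, inner_add_left, hY.inner_dualPt_self, dualPt,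
          real_inner_smul_left, inner_smul_right, inner_sph_self]
        have := (hY.height_pos x).ne'
        field_simp
        ring
      simp only [this]
      have hU := isOpen_domain (d := d) hIo
      have hs : ContDiffOn ℝ ∞ (flowSupport X) ({0}ᶜ ×ˢ I) := D.contDiffOn_supExt hIo
      have hg1 : Continuous fun x => gaussMap (fun z => X z t) x := by
        have := (hdir hY.dualPt_ne_zero hsP).1
        simpa only [hY.direction_dualPt] using this
      have hmem : ∀ x, ((gaussMap (fun z => X z t) x : Euc d), t) ∈
        ({0}ᶜ : Set (Euc d)) ×ˢ I := fun x => ⟨sph_ne_zero _, ht⟩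
      have hg2 : Continuous fun x => ((gaussMap (fun z => X z t) x : Euc d), t) := by fun_prop
      refine ((contDiffOn_dd hU hs _).continuousOn.comp_continuous hg2 hmem).div
        (hs.continuousOn.comp_continuous hg2 hmem) fun x => ?_
      exact (hY.supExt_pos _).ne'
    exact ((hfc.comp (hdir hY.dualPt_ne_zero hsP).1).mul h1).mul (hdir hY.dualPt_ne_zero hsP).2
  refine (integral_mono (hint hcont) (hint (cJg.sub cJf)) hle).trans ?_
  simp only [Pi.sub_apply]
  rw [integral_sub (hint cJg) (hint cJf), iJf, iJg, hfg, sub_self]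

/-- The entropy does not increase along the flow and the integral of the logarithm of the radial
function is preserved. -/
lemma logIntegral_le (hfc : Continuous f) (hgc : Continuous g)
    (hg_pos : ∀ x, 0 < g x)
    (hfg : ∫ x, f x ∂(sphMeasure d) = ∫ x, g x ∂(sphMeasure d)) {t : ℝ} (ht : t ∈ timeInterval T)
    (hb : ∀ s ∈ Icc 0 t, ∃ c > 0, CurvatureBound (fun z => X z s) c) :
    logIntegral g (dualPt fun z => X z t) = logIntegral g (dualPt X₀) ∧
      logIntegral f (fun z => X z t) ≤ logIntegral f X₀ := by
  have h0 : X₀ = fun z => X z 0 := (funext h.initial).symm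
  have hsub := Icc_subset_timeInterval ht
  have hd := fun s (hs : s ∈ Ioo 0 t) => h.hasDerivAt_logIntegral hfc hgc hg_pos hfg
    isOpen_Ioo (Ioo_subset_Icc_self.trans hsub) (fun s hs => hb s (Ioo_subset_Icc_self hs)) hs
  have hg' := ((h.continuousOn_logIntegral hgc).2).mono hsub
  have hf' := ((h.continuousOn_logIntegral hfc).1).mono hsub
  have m0 : (0 : ℝ) ∈ Icc 0 t := ⟨le_rfl, ht.1⟩
  have m1 : t ∈ Icc 0 t := ⟨ht.1, le_rfl⟩
  have dg : DifferentiableOn ℝ (fun t => logIntegral g (dualPt fun z => X z t))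
      (interior (Icc 0 t)) := by
    rw [interior_Icc]
    exact fun s hs => (hd s hs).1.differentiableAt.differentiableWithinAt
  rw [h0]
  refine ⟨le_antisymm ?_ ?_, ?_⟩
  · refine antitoneOn_of_deriv_nonpos (convex_Icc 0 t) hg' dg (fun s hs => ?_) m0 m1 ht.1
    rw [interior_Icc] at hs
    rw [(hd s hs).1.deriv]
  · refine monotoneOn_of_deriv_nonneg (convex_Icc 0 t) hg' dg (fun s hs => ?_) m0 m1 ht.1
    rw [interior_Icc] at hs
    rw [(hd s hs).1.deriv]
  · refine antitoneOn_of_deriv_nonpos (convex_Icc 0 t) hf' ?_ (fun s hs => ?_) m0 m1 ht.1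
    · rw [interior_Icc]
      intro s hs
      obtain ⟨D, -, hD⟩ := (hd s hs).2
      exact hD.differentiableAt.differentiableWithinAt
    · rw [interior_Icc] at hs
      obtain ⟨D, hD0, hD⟩ := (hd s hs).2
      rw [hD.deriv]; exact hD0

end IsConvexSolution

/-! ### Polarity of sets of directions -/

lemma subset_polarSet_polarSet (W : Set (Sph d)) : W ⊆ polarSet (polarSet W) := fun u hu v hv => by
  rw [real_inner_comm]; exact hv u hu

lemma polarSet_anti {V W : Set (Sph d)} (h : V ⊆ W) : polarSet W ⊆ polarSet V :=
  fun _ hv u hu => hv u (h hu)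

lemma polarSet_polarSet_polarSet (W : Set (Sph d)) : polarSet (polarSet (polarSet W)) = polarSet W :=
  (polarSet_anti (subset_polarSet_polarSet W)).antisymm (subset_polarSet_polarSet _)

lemma isClosed_setOf_forall_inner_le (W : Set (Sph d)) (ε : ℝ) :
    IsClosed {v : Sph d | ∀ u ∈ W, ⟪(u : Euc d), (v : Euc d)⟫ ≤ ε} := by
  have : {v : Sph d | ∀ u ∈ W, ⟪(u : Euc d), (v : Euc d)⟫ ≤ ε} =
      ⋂ u ∈ W, {v : Sph d | ⟪(u : Euc d), (v : Euc d)⟫ ≤ ε} := by ext; simp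
  rw [this]
  refine isClosed_biInter fun u _ => isClosed_le (by fun_prop) continuous_const

lemma isClosed_polarSet (W : Set (Sph d)) : IsClosed (polarSet W) :=
  isClosed_setOf_forall_inner_le W 0

lemma coneOf_polarSet {V : Set (Sph d)} (hV : (polarSet V).Nonempty) :
    coneOf (polarSet V) = {y | ∀ v ∈ V, ⟪(v : Euc d), y⟫ ≤ 0} := by
  ext y
  constructor
  · rintro ⟨t, ht, u, hu, rfl⟩ v hv
    rw [inner_smul_right]
    exact mul_nonpos_of_nonneg_of_nonpos ht (hu v hv)
  · intro hy
    by_cases h0 : y = 0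
    · obtain ⟨u, hu⟩ := hV
      exact ⟨0, le_rfl, u, hu, by simp [h0]⟩
    · refine ⟨‖y‖, norm_nonneg y, direction y, fun v hv => ?_, (norm_smul_direction h0).symm⟩
      rw [coe_direction h0, inner_smul_right]
      exact mul_nonpos_of_nonneg_of_nonpos (by positivity) (hy v hv)

/-- The cone of a polar set is an intersection of half spaces, proper as soon as one of them is
present. Polar sets are thus admissible in the Aleksandrov condition without further convexity
arguments. -/
lemma sphericallyConvex_polarSet {V : Set (Sph d)} (hV : V.Nonempty) (hV' : (polarSet V).Nonempty) :
    SphericallyConvex (polarSet V) := by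
  refine ⟨hV', ?_, ?_⟩
  · rw [coneOf_polarSet hV']
    intro y hy z hz a b ha hb _ v hv
    rw [inner_add_right, inner_smul_right, inner_smul_right]
    have := mul_nonpos_of_nonneg_of_nonpos ha (hy v hv)
    have := mul_nonpos_of_nonneg_of_nonpos hb (hz v hv)
    linarith
  · rw [coneOf_polarSet hV']
    obtain ⟨v, hv⟩ := hV
    intro h
    have h1 : (v : Euc d) ∈ {y : Euc d | ∀ v ∈ V, ⟪(v : Euc d), y⟫ ≤ 0} := h ▸ mem_univ _
    have := h1 v hv
    rw [inner_sph_self] at this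
    linarith

/-! ### Quantitative form of the Aleksandrov condition -/

section Related

variable {f g : Sph d → ℝ}

lemma _root_.Continuous.integrable_sphMeasure {φ : Sph d → ℝ} (hφ : Continuous φ) :
    Integrable φ (sphMeasure d) :=
  hφ.integrable_of_hasCompactSupport (HasCompactSupport.of_compactSpace φ)

lemma inner_le_add_dist (x y ξ : Sph d) :
    ⟪(x : Euc d), (ξ : Euc d)⟫ ≤ ⟪(y : Euc d), (ξ : Euc d)⟫ + dist x y := by
  have h1 : ⟪(x : Euc d) - y, (ξ : Euc d)⟫ ≤ ‖(x : Euc d) - y‖ * ‖(ξ : Euc d)‖ :=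
    real_inner_le_norm _ _
  rw [norm_sph, mul_one, inner_sub_left] at h1
  rw [Subtype.dist_eq, dist_eq_norm]
  linarith

/-- The limit case of the relation, for arbitrary closed sets with nonempty polar. -/
lemma AleksandrovRelated.lt_of_isClosed (h : AleksandrovRelated f g) (hf : Continuous f)
    (hf0 : ∀ x, 0 < f x) {W : Set (Sph d)} (hW : W.Nonempty)
    (hW' : (polarSet W).Nonempty) :
    ∫ x in W, f x ∂(sphMeasure d) + ∫ u in polarSet W, g u ∂(sphMeasure d)
      < ∫ u, g u ∂(sphMeasure d) := by
  -- The bipolar set is compact and spherically convex, contains `W` and has the same polar set, so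
  -- passing to it can only increase the left side.
  have h1 := h.2 (polarSet (polarSet W)) (isClosed_polarSet _).isCompact
    (sphericallyConvex_polarSet hW' (hW.mono (subset_polarSet_polarSet W)))
  rw [polarSet_polarSet_polarSet] at h1
  have h2 : ∫ x in W, f x ∂(sphMeasure d) ≤ ∫ x in polarSet (polarSet W), f x ∂(sphMeasure d) :=
    setIntegral_mono_set hf.integrable_sphMeasure.integrableOn
      (Eventually.of_forall fun x => (hf0 x).le) (subset_polarSet_polarSet W).eventuallyLE
  linarith

/-- A uniform version of the relation. -/
theorem AleksandrovRelated.exists_gap (h : AleksandrovRelated f g) (hf : Continuous f)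
    (hg : Continuous g) (hf0 : ∀ x, 0 < f x) (hg0 : ∀ x, 0 < g x) :
    ∃ ε : ℝ, 0 < ε ∧ ε < 1 ∧ ∀ W : Set (Sph d), IsClosed W → W.Nonempty →
      (∃ ξ : Sph d, ∀ x ∈ W, ⟪(x : Euc d), (ξ : Euc d)⟫ ≤ ε) →
      ∫ x in W, f x ∂(sphMeasure d) +
        ∫ u in {ξ : Sph d | ∀ x ∈ W, ⟪(x : Euc d), (ξ : Euc d)⟫ ≤ ε}, g u ∂(sphMeasure d)
      ≤ ∫ u, g u ∂(sphMeasure d) - ε := by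
  by_contra hcon
  push Not at hcon
  set e : ℕ → ℝ := fun j => 1 / ((j : ℝ) + 2) with he
  have he0 : ∀ j, 0 < e j := fun j => by positivity
  have he1 : ∀ j, e j < 1 := fun j => by
    rw [he]; simp only; rw [div_lt_one (by positivity)]
    have : (0 : ℝ) ≤ j := j.cast_nonneg
    linarith
  have helim : Tendsto e atTop (𝓝 0) := by
    have := tendsto_one_div_add_atTop_nhds_zero_nat (𝕜 := ℝ)
    refine ((tendsto_add_atTop_iff_nat 1).2 this).congr fun j => ?_
    simp only [he]; push_cast; ring
  choose W hWc hWne hWξ hW using fun j => hcon (e j) (he0 j) (he1 j)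
  choose ξ hξ using hWξ
  -- Nonempty compact subsets of the sphere form a compact space for the Hausdorff distance; a
  -- sequence of counterexamples with ε → 0, together with the directions ξ, subconverges.
  set K : ℕ → TopologicalSpace.NonemptyCompacts (Sph d) := fun j =>
    ⟨⟨W j, (hWc j).isCompact⟩, hWne j⟩ with hK
  obtain ⟨⟨V, ζ⟩, φ, hφ, hlim⟩ := CompactSpace.tendsto_subseq fun j => (K j, ξ j)
  have hlimK : Tendsto (fun j => K (φ j)) atTop (𝓝 V) :=
    (continuous_fst.tendsto _).comp hlim
  have hlimξ : Tendsto (fun j => ξ (φ j)) atTop (𝓝 ζ) :=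
    (continuous_snd.tendsto _).comp hlim
  have hlime : Tendsto (fun j => e (φ j)) atTop (𝓝 0) := helim.comp hφ.tendsto_atTop
  have hfin : ∀ j, Metric.hausdorffEDist (K (φ j) : Set (Sph d)) (V : Set (Sph d)) ≠ ⊤ := fun j =>
    Metric.hausdorffEDist_ne_top_of_nonempty_of_bounded (K (φ j)).nonempty V.nonempty
      (K (φ j)).isCompact.isBounded V.isCompact.isBounded
  have hd : Tendsto (fun j => Metric.hausdorffDist (K (φ j) : Set (Sph d)) (V : Set (Sph d)))
      atTop (𝓝 0) := (tendsto_iff_dist_tendsto_zero.1 hlimK)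
  -- Closed sets decreasing to the limit set and to its polar set. They contain the sets of the
  -- sequence for large indices, which replaces convergence of the integrals along it.
  set A : ℕ → Set (Sph d) := fun k => {x | Metric.infDist x V ≤ e k} with hA
  set B : ℕ → Set (Sph d) := fun k =>
    {ζ | ∀ x ∈ (V : Set (Sph d)), ⟪(x : Euc d), (ζ : Euc d)⟫ ≤ e k} with hB
  have heanti : Antitone e := fun i j hij => by
    simp only [he]; gcongr
  have hAanti : Antitone A := fun i j hij x hx => le_trans hx (heanti hij)
  have hBanti : Antitone B := fun i j hij x hx y hy => (hx y hy).trans (heanti hij)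
  have hAc : ∀ k, IsClosed (A k) := fun k =>
    isClosed_le (Metric.continuous_infDist_pt _) continuous_const
  have hBc : ∀ k, IsClosed (B k) := fun k => isClosed_setOf_forall_inner_le _ _
  have hAint : ⋂ k, A k = (V : Set (Sph d)) := by
    ext x
    simp only [mem_iInter]
    constructor
    · intro hx
      rw [V.isCompact.isClosed.mem_iff_infDist_zero V.nonempty]
      exact le_antisymm (ge_of_tendsto' helim hx) Metric.infDist_nonneg
    · intro hx k
      simp only [hA, Set.mem_ofPred_eq, Metric.infDist_zero_of_mem hx]
      exact (he0 k).le
  have hBint : ⋂ k, B k = polarSet (V : Set (Sph d)) := by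
    ext x
    simp only [mem_iInter]
    constructor
    · exact fun hx y hy => ge_of_tendsto' helim fun k => hx k y hy
    · exact fun hx k y hy => (hx y hy).trans (he0 k).le
  have hnear : ∀ j, ∀ x ∈ (V : Set (Sph d)), ∀ r,
      Metric.hausdorffDist (K (φ j) : Set (Sph d)) (V : Set (Sph d)) < r →
      ∃ y ∈ W (φ j), dist x y < r := fun j x hx r hr =>
    let ⟨y, hy, hxy⟩ := Metric.exists_dist_lt_of_hausdorffDist_lt' hx hr (hfin j)
    ⟨y, hy, by rwa [dist_comm]⟩
  have hζ : ζ ∈ polarSet (V : Set (Sph d)) := by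
    intro x hx
    have h1 : Tendsto (fun j => ⟪(x : Euc d), (ξ (φ j) : Euc d)⟫) atTop
        (𝓝 ⟪(x : Euc d), (ζ : Euc d)⟫) :=
      tendsto_const_nhds.inner ((continuous_subtype_val.tendsto _).comp hlimξ)
    have h2 : Tendsto (fun j => e (φ j) + (Metric.hausdorffDist (K (φ j) : Set (Sph d))
        (V : Set (Sph d)) + e (φ j))) atTop (𝓝 (0 + (0 + 0))) := hlime.add (hd.add hlime)
    simp only [add_zero] at h2
    refine le_of_tendsto_of_tendsto' h1 h2 fun j => ?_
    obtain ⟨y, hy, hxy⟩ := hnear j x hx _ (lt_add_of_pos_right _ (he0 (φ j)))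
    have := inner_le_add_dist x y (ξ (φ j))
    have := hξ (φ j) y hy
    linarith
  have hk : ∀ k, ∫ u, g u ∂(sphMeasure d) ≤
      ∫ x in A k, f x ∂(sphMeasure d) + ∫ u in B k, g u ∂(sphMeasure d) := by
    intro k
    have h1 : Tendsto (fun j => ∫ u, g u ∂(sphMeasure d) - e (φ j)) atTop
        (𝓝 (∫ u, g u ∂(sphMeasure d) - 0)) := tendsto_const_nhds.sub hlime
    rw [sub_zero] at h1
    refine le_of_tendsto h1 ?_
    have hpos : 0 < e k / 2 := half_pos (he0 k)
    filter_upwards [hlime.eventually (gt_mem_nhds hpos), hd.eventually (gt_mem_nhds hpos)]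
      with j hj1 hj2
    have h3 : W (φ j) ⊆ A k := fun x hx => by
      obtain ⟨y, hy, hxy⟩ := Metric.exists_dist_lt_of_hausdorffDist_lt (s := (K (φ j) : Set (Sph d)))
        hx hj2 (hfin j)
      have := Metric.infDist_le_dist_of_mem (x := x) hy
      change Metric.infDist x V ≤ e k
      linarith
    have h4 : {ξ : Sph d | ∀ x ∈ W (φ j), ⟪(x : Euc d), (ξ : Euc d)⟫ ≤ e (φ j)} ⊆ B k := by
      intro ξ' hξ' x hx
      obtain ⟨y, hy, hxy⟩ := hnear j x hx _ hj2
      have := inner_le_add_dist x y ξ'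
      have := hξ' y hy
      linarith
    have h5 := setIntegral_mono_set (μ := sphMeasure d) hf.integrable_sphMeasure.integrableOn
      (Eventually.of_forall fun x => (hf0 x).le) h3.eventuallyLE
    have h6 := setIntegral_mono_set (μ := sphMeasure d) hg.integrable_sphMeasure.integrableOn
      (Eventually.of_forall fun x => (hg0 x).le) h4.eventuallyLE
    have := hW (φ j)
    linarith
  have hl1 := tendsto_setIntegral_of_antitone (μ := sphMeasure d) (f := f)
    (fun k => (hAc k).measurableSet) hAanti ⟨0, hf.integrable_sphMeasure.integrableOn⟩
  have hl2 := tendsto_setIntegral_of_antitone (μ := sphMeasure d) (f := g)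
    (fun k => (hBc k).measurableSet) hBanti ⟨0, hg.integrable_sphMeasure.integrableOn⟩
  rw [hAint] at hl1
  rw [hBint] at hl2
  exact absurd (ge_of_tendsto' (hl1.add hl2) hk)
    (not_le.2 (h.lt_of_isClosed hf hf0 V.nonempty ⟨ζ, hζ⟩))

end Related

/-- Layer-cake comparison with step δ: the levels kδ below `a` number at most a/δ + 1. -/
lemma mul_sum_indicator_le {δ a : ℝ} (hδ : 0 < δ) (ha : 0 ≤ a) (N : ℕ) :
    δ * ∑ k ∈ Finset.range N, (if (k : ℝ) * δ < a then (1 : ℝ) else 0) ≤ a + δ := by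
  rw [Finset.sum_boole]
  have h1 : (Finset.range N).filter (fun k : ℕ => (k : ℝ) * δ < a) ⊆ Finset.range ⌈a / δ⌉₊ := by
    intro k hk
    rw [Finset.mem_filter] at hk
    rw [Finset.mem_range, Nat.lt_ceil, lt_div_iff₀ hδ]
    exact hk.2
  have h2 : (((Finset.range N).filter (fun k : ℕ => (k : ℝ) * δ < a)).card : ℝ) ≤ ⌈a / δ⌉₊ := by
    exact_mod_cast (Finset.card_le_card h1).trans (Finset.card_range _).le
  have h3 := Nat.ceil_lt_add_one (div_nonneg ha hδ.le)
  calc _ ≤ δ * (a / δ + 1) := by gcongr; exact h2.trans h3.le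
    _ = a + δ := by field_simp

/-- The opposite comparison, with levels shifted by one step; the shift creates the room needed to
apply the gap between two consecutive levels. -/
lemma le_mul_sum_indicator {δ a : ℝ} (hδ : 0 < δ) (ha : 0 ≤ a) {N : ℕ} (hN : ⌊a / δ⌋₊ ≤ N) :
    a ≤ δ * ∑ k ∈ Finset.range N, (if ((k : ℝ) + 1) * δ ≤ a then (1 : ℝ) else 0) + δ := by
  rw [Finset.sum_boole]
  have h1 : Finset.range ⌊a / δ⌋₊ ⊆
      (Finset.range N).filter (fun k : ℕ => ((k : ℝ) + 1) * δ ≤ a) := by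
    intro k hk
    rw [Finset.mem_range] at hk
    rw [Finset.mem_filter, Finset.mem_range]
    refine ⟨hk.trans_le hN, ?_⟩
    rw [← le_div_iff₀ hδ]
    have h2 : ((k + 1 : ℕ) : ℝ) ≤ a / δ := (Nat.le_floor_iff (div_nonneg ha hδ.le)).1 hk
    exact_mod_cast h2
  have h2 : (⌊a / δ⌋₊ : ℝ) ≤
      ((Finset.range N).filter (fun k : ℕ => ((k : ℝ) + 1) * δ ≤ a)).card := by
    exact_mod_cast (Finset.card_range _).symm.le.trans (Finset.card_le_card h1)
  have h3 := Nat.lt_floor_add_one (a / δ)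
  calc a = δ * (a / δ) := by field_simp
    _ ≤ δ * (((Finset.range N).filter (fun k : ℕ => ((k : ℝ) + 1) * δ ≤ a)).card + 1) := by
        gcongr; linarith
    _ = _ := by ring

/-- Two functions on the sphere whose logarithms have small relative oscillation integral have
bounded oscillation, if the densities satisfy the gap estimate. -/
theorem AleksandrovRelated.exists_oscillation_bound {f g : Sph d → ℝ} (hfg : AleksandrovRelated f g)
    (hf : Continuous f) (hg : Continuous g) (hf0 : ∀ x, 0 < f x) (hg0 : ∀ x, 0 < g x) (C₁ : ℝ) :
    ∃ L : ℝ, 0 < L ∧ ∀ a b : Sph d → ℝ, Continuous a → Continuous b →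
      (∀ x, 0 ≤ a x) → (∀ x, 0 ≤ b x) → (∃ ξ, b ξ = 0) →
      (∀ x ξ : Sph d, ⟪(x : Euc d), (ξ : Euc d)⟫ ≤ Real.exp (b ξ - a x)) →
      ∫ x, g x * b x ∂(sphMeasure d) - ∫ x, f x * a x ∂(sphMeasure d) ≤ C₁ →
      ∀ x, a x ≤ L := by
  obtain ⟨ε, hε0, hε1, hgap⟩ := hfg.exists_gap hf hg hf0 hg0
  set μ := sphMeasure d with hμ
  -- One step of length δ in logarithmic scale is a factor ε, so the levels of `a` and `b` match the
  -- tolerance of the gap estimate.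
  set δ := -Real.log ε with hδd
  have hδ : 0 < δ := by
    rw [hδd, neg_pos]; exact Real.log_neg hε0 hε1
  have hexp : Real.exp (-δ) = ε := by rw [hδd, neg_neg, Real.exp_log hε0]
  set F := ∫ x, f x ∂μ with hF
  set G := ∫ x, g x ∂μ with hG
  refine ⟨(|(C₁ + δ * G + δ * F) / (δ * ε)| + 1) * δ, by positivity, ?_⟩
  rintro a b ha hb ha0 hb0 ⟨ξ₀, hξ₀⟩ hab hint x₁
  obtain ⟨x₀, -, hx₀⟩ := isCompact_univ.exists_isMaxOn (univ_nonempty (α := Sph d)) ha.continuousOn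
  replace hx₀ : ∀ x, a x ≤ a x₀ := fun x => hx₀ (mem_univ x)
  set N := ⌊a x₀ / δ⌋₊ with hN
  set W : ℕ → Set (Sph d) := fun k => {x | ((k : ℝ) + 1) * δ ≤ a x} with hW
  set V : ℕ → Set (Sph d) := fun k => {ξ | (k : ℝ) * δ < b ξ} with hV
  have hWc : ∀ k, IsClosed (W k) := fun k => isClosed_le continuous_const ha
  have hVo : ∀ k, IsOpen (V k) := fun k => isOpen_lt continuous_const hb
  have hfi : Integrable f μ := hf.integrable_sphMeasure
  have hgi : Integrable g μ := hg.integrable_sphMeasure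
  -- If a ≥ (k + 1)δ at x and b ≤ kδ at ξ, the assumed inequality gives ⟨x, ξ⟩ ≤ exp(-δ) = ε. The
  -- zero ξ₀ of `b` lies outside every `V k`, so these complements are nonempty.
  have hsub : ∀ k, (V k)ᶜ ⊆ {ξ : Sph d | ∀ x ∈ W k, ⟪(x : Euc d), (ξ : Euc d)⟫ ≤ ε} := by
    intro k ξ hξ x hx
    have h1 : b ξ ≤ k * δ := not_lt.1 hξ
    have h2 : ((k : ℝ) + 1) * δ ≤ a x := hx
    refine (hab x ξ).trans ?_
    rw [← hexp]
    exact Real.exp_le_exp.2 (by linarith)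
  have hfa : Integrable (fun x => f x * a x) μ := (hf.mul ha).integrable_sphMeasure
  have hgb : Integrable (fun x => g x * b x) μ := (hg.mul hb).integrable_sphMeasure
  have hk : ∀ k ∈ Finset.range N, ∫ x in W k, f x ∂μ + ε ≤ ∫ x in V k, g x ∂μ := by
    intro k hkN
    rw [Finset.mem_range] at hkN
    have h1 : x₀ ∈ W k := by
      have h2 : ((k + 1 : ℕ) : ℝ) ≤ a x₀ / δ :=
        (Nat.le_floor_iff (div_nonneg (ha0 x₀) hδ.le)).1 hkN
      rw [le_div_iff₀ hδ] at h2
      push_cast at h2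
      exact h2
    have h2 := hgap (W k) (hWc k) ⟨x₀, h1⟩ ⟨ξ₀, hsub k (by
      change ¬ ((k : ℝ) * δ < b ξ₀)
      rw [hξ₀]; push Not; positivity)⟩
    have h3 := setIntegral_mono_set (μ := μ) hgi.integrableOn
      (Eventually.of_forall fun x => (hg0 x).le) (hsub k).eventuallyLE
    have h4 := integral_add_compl (hVo k).measurableSet hgi
    linarith
  have hsumV : δ * ∑ k ∈ Finset.range N, ∫ x in V k, g x ∂μ ≤ ∫ x, g x * b x ∂μ + δ * G := by
    have h1 : δ * ∑ k ∈ Finset.range N, ∫ x in V k, g x ∂μ =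
        ∫ x, δ * ∑ k ∈ Finset.range N, (V k).indicator g x ∂μ := by
      rw [integral_const_mul, integral_finsetSum _ fun k _ => hgi.indicator (hVo k).measurableSet]
      simp only [integral_indicator (hVo _).measurableSet]
    have h2 : ∫ x, g x * b x ∂μ + δ * G = ∫ x, (g x * b x + δ * g x) ∂μ := by
      rw [integral_add hgb (hgi.const_mul δ), integral_const_mul]
    rw [h1, h2]
    refine integral_mono ((integrable_finsetSum _ fun k _ =>
      hgi.indicator (hVo k).measurableSet).const_mul δ)
      (hgb.add (hgi.const_mul δ)) fun x => ?_
    have h3 := mul_le_mul_of_nonneg_left (mul_sum_indicator_le hδ (hb0 x) N) (hg0 x).le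
    have h4 : ∑ k ∈ Finset.range N, (V k).indicator g x =
        g x * ∑ k ∈ Finset.range N, (if (k : ℝ) * δ < b x then (1 : ℝ) else 0) := by
      rw [Finset.mul_sum]
      refine Finset.sum_congr rfl fun k _ => ?_
      simp only [hV, indicator_apply, Set.mem_ofPred_eq, mul_ite, mul_one, mul_zero]
    simp only [h4]
    linarith
  have hsumW : ∫ x, f x * a x ∂μ ≤ δ * ∑ k ∈ Finset.range N, ∫ x in W k, f x ∂μ + δ * F := by
    have h1 : δ * ∑ k ∈ Finset.range N, ∫ x in W k, f x ∂μ =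
        ∫ x, δ * ∑ k ∈ Finset.range N, (W k).indicator f x ∂μ := by
      rw [integral_const_mul, integral_finsetSum _ fun k _ => hfi.indicator (hWc k).measurableSet]
      simp only [integral_indicator (hWc _).measurableSet]
    have hi : Integrable (fun x => δ * ∑ k ∈ Finset.range N, (W k).indicator f x) μ :=
      (integrable_finsetSum _ fun k _ => hfi.indicator (hWc k).measurableSet).const_mul δ
    have h2 : ∫ x, δ * ∑ k ∈ Finset.range N, (W k).indicator f x ∂μ + δ * F =
        ∫ x, (δ * ∑ k ∈ Finset.range N, (W k).indicator f x + δ * f x) ∂μ := by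
      rw [integral_add hi (hfi.const_mul δ), integral_const_mul δ f]
    rw [h1, h2]
    refine integral_mono hfa (hi.add (hfi.const_mul δ)) fun x => ?_
    have hxN : ⌊a x / δ⌋₊ ≤ N := Nat.floor_le_floor (by gcongr; exact hx₀ x)
    have h3 := mul_le_mul_of_nonneg_left (le_mul_sum_indicator hδ (ha0 x) hxN) (hf0 x).le
    have h4 : ∑ k ∈ Finset.range N, (W k).indicator f x =
        f x * ∑ k ∈ Finset.range N, (if ((k : ℝ) + 1) * δ ≤ a x then (1 : ℝ) else 0) := by
      rw [Finset.mul_sum]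
      refine Finset.sum_congr rfl fun k _ => ?_
      simp only [hW, indicator_apply, Set.mem_ofPred_eq, mul_ite, mul_one, mul_zero]
    simp only [h4]
    linarith
  -- Each of the `N` levels below max a contributes at least ε, so Nδε is at most C₁ plus the
  -- discretisation errors δF and δG.
  have hsum := mul_le_mul_of_nonneg_left (Finset.sum_le_sum hk) hδ.le
  rw [Finset.sum_add_distrib, Finset.sum_const, Finset.card_range, nsmul_eq_mul] at hsum
  have hNle : (N : ℝ) ≤ |(C₁ + δ * G + δ * F) / (δ * ε)| := by
    refine le_trans ?_ (le_abs_self _)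
    rw [le_div_iff₀ (by positivity)]
    linarith
  have h5 := Nat.lt_floor_add_one (a x₀ / δ)
  rw [div_lt_iff₀ hδ] at h5
  calc a x₁ ≤ a x₀ := hx₀ x₁
    _ ≤ (N + 1) * δ := h5.le
    _ ≤ _ := by gcongr

/-- A priori bounds for a pair consisting of a support function and a radial function. -/
theorem AleksandrovRelated.exists_support_bound {f g : Sph d → ℝ} (hfg : AleksandrovRelated f g)
    (hf : Continuous f) (hg : Continuous g) (hf0 : ∀ x, 0 < f x) (hg0 : ∀ x, 0 < g x) (C₁ C₂ : ℝ) :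
    ∃ C₀ : ℝ, 0 < C₀ ∧ ∀ h r : Sph d → ℝ, Continuous h → Continuous r →
      (∀ x, 0 < h x) → (∀ x, 0 < r x) →
      (∀ x ξ : Sph d, ⟪(x : Euc d), (ξ : Euc d)⟫ * r ξ ≤ h x) →
      (∃ ξ, ∀ x, h x ≤ r ξ) → (∃ x, ∀ ξ, h x ≤ r ξ) →
      ∫ x, f x * Real.log (h x) ∂(sphMeasure d) - ∫ x, g x * Real.log (r x) ∂(sphMeasure d) ≤ C₁ →
      |∫ x, g x * Real.log (r x) ∂(sphMeasure d)| ≤ C₂ →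
      ∀ x, 1 / C₀ ≤ h x ∧ h x ≤ C₀ := by
  obtain ⟨L, hL, hbound⟩ := hfg.exists_oscillation_bound hf hg hf0 hg0 C₁
  set μ := sphMeasure d with hμ
  set G := ∫ x, g x ∂μ with hG
  have hGF : ∫ x, f x ∂μ = G := hfg.1
  refine ⟨Real.exp (L + |C₂ / G|), Real.exp_pos _, ?_⟩
  rintro h r hh hr hh0 hr0 hrh ⟨ξ₀, hξ₀⟩ ⟨x₀, hx₀⟩ hint habs x
  have hrle : ∀ ξ, r ξ ≤ h ξ := fun ξ => by
    have := hrh ξ ξ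
    rwa [inner_sph_self, one_mul] at this
  have hlh : Continuous fun x => Real.log (h x) := hh.log fun x => (hh0 x).ne'
  have hlr : Continuous fun x => Real.log (r x) := hr.log fun x => (hr0 x).ne'
  -- Normalise by the maximum of the radial function: R - log h and R - log r are nonnegative, the
  -- latter vanishes at ξ₀, and equality of the total masses cancels R in the difference of
  -- integrals.
  set R := Real.log (r ξ₀) with hR
  have hlhi : Integrable (fun x => f x * Real.log (h x)) μ := (hf.mul hlh).integrable_sphMeasure
  have hlri : Integrable (fun x => g x * Real.log (r x)) μ := (hg.mul hlr).integrable_sphMeasure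
  have hfi : Integrable f μ := hf.integrable_sphMeasure
  have hgi : Integrable g μ := hg.integrable_sphMeasure
  have hcf : ∀ c : ℝ, ∫ x, g x * c ∂μ = c * G := fun c => by rw [integral_mul_const, mul_comm]
  have e1 : ∫ x, g x * (R - Real.log (r x)) ∂μ = R * G - ∫ x, g x * Real.log (r x) ∂μ := by
    rw [← hcf, ← integral_sub (hgi.mul_const R) hlri]
    simp only [mul_sub]
  have e2 : ∫ x, f x * (R - Real.log (h x)) ∂μ = R * G - ∫ x, f x * Real.log (h x) ∂μ := by
    rw [← hGF, mul_comm R, ← integral_mul_const, ← integral_sub (hfi.mul_const R) hlhi]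
    simp only [mul_sub]
  have hosc := hbound (fun x => R - Real.log (h x)) (fun x => R - Real.log (r x))
    (continuous_const.sub hlh) (continuous_const.sub hlr)
    (fun x => sub_nonneg.2 (Real.log_le_log (hh0 x) (hξ₀ x)))
    (fun x => sub_nonneg.2 (Real.log_le_log (hr0 x) ((hrle x).trans (hξ₀ x))))
    ⟨ξ₀, sub_self _⟩ (fun x ξ => by
      rw [sub_sub_sub_cancel_left, Real.exp_sub, Real.exp_log (hh0 x), Real.exp_log (hr0 ξ),
        le_div_iff₀ (hr0 ξ)]
      exact hrh x ξ) (by rw [e1, e2]; linarith)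
  have hm := hosc x₀
  have hGle : ∀ c : ℝ, (∀ x, c ≤ Real.log (r x)) → c * G ≤ ∫ x, g x * Real.log (r x) ∂μ :=
    fun c hc => by
      rw [← hcf]
      exact integral_mono (hgi.mul_const c) hlri fun x =>
        mul_le_mul_of_nonneg_left (hc x) (hg0 x).le
  have hleG : ∀ c : ℝ, (∀ x, Real.log (r x) ≤ c) → ∫ x, g x * Real.log (r x) ∂μ ≤ c * G :=
    fun c hc => by
      rw [← hcf]
      exact integral_mono hlri (hgi.mul_const c) fun x =>
        mul_le_mul_of_nonneg_left (hc x) (hg0 x).le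
  have hGpos : 0 < G := by
    -- Positivity of the total mass follows from the strict relation itself, applied to a single
    -- direction.
    refine lt_of_le_of_ne (integral_nonneg fun x => (hg0 x).le) fun hG0 => ?_
    have hV : (polarSet ({Classical.arbitrary (Sph d)} : Set (Sph d))).Nonempty := by
      refine ⟨-Classical.arbitrary (Sph d), fun u hu => ?_⟩
      rw [mem_singleton_iff.1 hu, coe_neg_sphere, inner_neg_right, inner_sph_self]
      norm_num
    have h1 := hfg.lt_of_isClosed hf hf0 (singleton_nonempty _) hV
    have h2 := setIntegral_nonneg (μ := μ) (measurableSet_singleton (Classical.arbitrary (Sph d)))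
      fun x _ => (hf0 x).le
    have h3 := setIntegral_nonneg (μ := μ) (isClosed_polarSet
      ({Classical.arbitrary (Sph d)} : Set (Sph d))).measurableSet fun x _ => (hg0 x).le
    linarith
  -- The controlled integral of log r keeps log min h from being very large and log max r from being
  -- very small; with the oscillation bound this fixes h from both sides.
  have h1 := hGle (Real.log (h x₀)) fun ξ => Real.log_le_log (hh0 x₀) (hx₀ ξ)
  have h2 := hleG R fun ξ => Real.log_le_log (hr0 ξ) ((hrle ξ).trans (hξ₀ ξ))
  obtain ⟨h3, h4⟩ := abs_le.1 habs
  have hCG : C₂ / G * G = C₂ := div_mul_cancel₀ _ hGpos.ne'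
  have h5 : Real.log (h x₀) ≤ |C₂ / G| := by
    refine le_trans ?_ (le_abs_self _)
    rw [le_div_iff₀ hGpos]; linarith
  have h6 : -|C₂ / G| ≤ R := by
    refine le_trans (neg_le_neg (le_abs_self _)) ?_
    rw [← neg_div, div_le_iff₀ hGpos]; linarith
  have h7 : Real.log (h x) ≤ R := Real.log_le_log (hh0 x) (hξ₀ x)
  have h8 := hosc x

  constructor
  · rw [one_div, ← Real.exp_neg, ← Real.le_log_iff_exp_le (hh0 x)]
    linarith
  · rw [← Real.log_le_iff_le_exp (hh0 x)]
    linarith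

/-! ### Independence of the parametrization -/

lemma supExt_comp {Y : Sph d → Euc d} {φ : Sph d → Sph d} (hφ : Function.Surjective φ) (q : Euc d) :
    supExt (fun x => Y (φ x)) q = supExt Y q := by
  rw [supExt, supExt, ← hφ.range_comp fun x => ⟪Y x, q⟫]
  rfl

lemma logIntegral_comp {Y : Sph d → Euc d} {φ : Sph d → Sph d} (hφ : Function.Surjective φ)
    (ψ : Sph d → ℝ) : logIntegral ψ (fun x => Y (φ x)) = logIntegral ψ Y := by
  simp only [logIntegral, supExt_comp hφ]

lemma conicExt_conicExt_coe {Y : Sph d → Euc d} {φ : Sph d → Sph d} {y : Euc d} (hy : y ≠ 0) :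
    conicExt Y (conicExt (fun x => (φ x : Euc d)) y) = conicExt (fun x => Y (φ x)) y := by
  have h := norm_pos_iff.2 hy
  simp only [conicExt, direction_smul_coe h, norm_smul, norm_norm, norm_sph, mul_one]

lemma continuous_supExt_coe {Y : Sph d → Euc d} (hY : Continuous Y) :
    Continuous fun q : Sph d => supExt Y (q : Euc d) := by
  have h := (isCompact_univ (X := Sph d)).continuous_sSup
    (f := fun (q : Sph d) (x : Sph d) => ⟪Y x, (q : Euc d)⟫)
    (show Continuous fun z : Sph d × Sph d => ⟪Y z.2, (z.1 : Euc d)⟫ by fun_prop)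
  simp only [image_univ] at h
  exact h

namespace IsStrictlyConvexEmbedding

variable {Y Z : Sph d → Euc d} (hY : IsStrictlyConvexEmbedding Y)
include hY

/-- Two embeddings with the same image differ by a homeomorphism of the sphere. -/
lemma exists_reparametrization (hZ : IsStrictlyConvexEmbedding Z) (h : range Z = range Y) :
    ∃ φ : Sph d → Sph d, Continuous φ ∧ Function.Surjective φ ∧ (∀ x, Y (φ x) = Z x) ∧
      ∀ x, dualPt Y (φ x) = dualPt Z x := by
  have hemb : IsEmbedding Y := (hY.continuous.isClosedEmbedding hY.injective).isEmbedding
  have hex : ∀ x, ∃ y, Y y = Z x := fun x => by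
    have : Z x ∈ range Y := h ▸ mem_range_self x
    exact this
  choose φ hφ using hex
  refine ⟨φ, ?_, ?_, hφ, fun x => ?_⟩
  · rw [hemb.continuous_iff]
    have : Y ∘ φ = Z := funext hφ
    rw [this]
    exact hZ.continuous
  · intro y
    have : Y y ∈ range Z := h ▸ mem_range_self y
    obtain ⟨x, hx⟩ := this
    exact ⟨x, hY.injective (by rw [hφ, hx])⟩
  · simp only [dualPt, gaussMap, hφ, h]

/-- The lower curvature bound depends only on the image of the embedding. -/
lemma curvatureBound_of_range_eq (hZ : IsStrictlyConvexEmbedding Z) (h : range Z = range Y) {c : ℝ}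
    (hb : CurvatureBound Y c) : CurvatureBound Z c := by
  obtain ⟨φ, hφc, -, hφ, hφd⟩ := hY.exists_reparametrization hZ h
  intro x w hw
  set Φ : Euc d → Euc d := conicExt fun x => (φ x : Euc d) with hΦ
  have hx := sph_ne_zero x
  have hΦx : Φ x = φ x := by simp [hΦ]
  have e1 : ∀ y ≠ 0, conicExt Y (Φ y) = conicExt Z y := fun y hy => by
    rw [hΦ, conicExt_conicExt_coe hy]; simp only [hφ]
  have e2 : ∀ y ≠ 0, conicExt (dualPt Y) (Φ y) = conicExt (dualPt Z) y := fun y hy => by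
    rw [hΦ, conicExt_conicExt_coe hy]; simp only [hφd]
  have hΦc : ContinuousAt Φ x := by
    have h1 : ContinuousAt (direction : Euc d → Sph d) x :=
      continuousOn_direction.continuousAt (isOpen_compl_singleton.mem_nhds hx)
    exact continuousAt_id.norm.smul
      ((continuous_subtype_val.comp hφc).continuousAt.comp h1)
  have hne : ∀ᶠ y in 𝓝 (x : Euc d), y ≠ 0 := isOpen_compl_singleton.mem_nhds hx
  set A := fderiv ℝ (conicExt Y) (φ x : Euc d) with hA
  set L : Euc d ≃L[ℝ] Euc d := (LinearEquiv.ofInjectiveEndo A.toLinearMap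
    (hY.fderiv_conic_injective (φ x))).toContinuousLinearEquiv with hL
  have hLA : (L : Euc d →L[ℝ] Euc d) = A := by ext1 v; rfl
  have hφ0 : (φ x : Euc d) ≠ 0 := sph_ne_zero _
  have cY : ContDiffAt ℝ ∞ (conicExt Y) (φ x : Euc d) := by
    rw [conicExt_eq]
    exact (contDiffAt_norm ℝ hφ0).smul (contDiffAt_radialExt hY.smooth hφ0)
  have hs : HasStrictFDerivAt (conicExt Y) (L : Euc d →L[ℝ] Euc d) (φ x : Euc d) := by
    rw [hLA]; exact cY.hasStrictFDerivAt (by simp)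
  have dZ := (hZ.differentiableAt hx)
  have dcZ : DifferentiableAt ℝ (conicExt Z) (x : Euc d) := differentiableAt_conicExt hx dZ
  -- The reparametrization is so far only continuous. Locally its conic extension is the cone over Z
  -- followed by a local inverse of the cone over Y, hence differentiable.
  have dΦ : DifferentiableAt ℝ Φ (x : Euc d) := by
    have h1 : DifferentiableAt ℝ (hs.localInverse (conicExt Y) L (φ x : Euc d)) (conicExt Z x) := by
      rw [← e1 x hx, hΦx]
      exact hs.to_localInverse.hasFDerivAt.differentiableAt
    refine (h1.comp _ dcZ).congr_of_eventuallyEq ?_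
    have h2 := hs.eventually_left_inverse
    have h3 : Tendsto Φ (𝓝 (x : Euc d)) (𝓝 (φ x : Euc d)) := hΦx ▸ hΦc
    filter_upwards [h3.eventually h2, hne] with y hy hy0
    rw [← hy, e1 y hy0]
    rfl
  have dcY : DifferentiableAt ℝ (conicExt Y) (Φ x) := by
    rw [hΦx]; exact cY.differentiableAt (by simp)
  have dcD : DifferentiableAt ℝ (conicExt (dualPt Y)) (Φ x) := by
    rw [hΦx]; exact differentiableAt_conicExt hφ0 (hY.differentiableAt_dualPt hφ0)
  set u := fderiv ℝ Φ x w with hu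
  have k1 : fderiv ℝ (conicExt Z) (x : Euc d) w = fderiv ℝ (conicExt Y) (φ x : Euc d) u := by
    have h1 : conicExt Z =ᶠ[𝓝 (x : Euc d)] conicExt Y ∘ Φ := by
      filter_upwards [hne] with y hy using (e1 y hy).symm
    rw [h1.fderiv_eq, fderiv_comp _ dcY dΦ, hΦx]; rfl
  have k2 : fderiv ℝ (conicExt (dualPt Z)) (x : Euc d) w =
      fderiv ℝ (conicExt (dualPt Y)) (φ x : Euc d) u := by
    have h1 : conicExt (dualPt Z) =ᶠ[𝓝 (x : Euc d)] conicExt (dualPt Y) ∘ Φ := by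
      filter_upwards [hne] with y hy using (e2 y hy).symm
    rw [h1.fderiv_eq, fderiv_comp _ dcD dΦ, hΦx]; rfl
  -- Pairing with the common dual point shows that tangent vectors correspond to tangent vectors.
  have hperp : ⟪(φ x : Euc d), u⟫ = 0 := by
    rw [← hY.inner_conic_dualPt, ← k1, hφd, hZ.inner_conic_dualPt, hw]
  rw [hY.fderiv_conic_self, hZ.fderiv_conic_self, hw, hperp, zero_smul, zero_smul, add_zero,
    add_zero] at k1
  rw [hY.fderiv_conic_dualPt, hZ.fderiv_conic_dualPt, hw, hperp, zero_smul, zero_smul, add_zero,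
    add_zero] at k2
  have hg : gaussMap Y (φ x) = gaussMap Z x := by simp only [gaussMap, hφ, h]
  have := hb (φ x) u hperp
  rwa [← k1, ← k2, hφ, hg] at this

lemma logIntegral_eq_of_range_eq (hZ : IsStrictlyConvexEmbedding Z) (h : range Z = range Y)
    (ψ : Sph d → ℝ) : logIntegral ψ Z = logIntegral ψ Y ∧
      logIntegral ψ (dualPt Z) = logIntegral ψ (dualPt Y) := by
  obtain ⟨φ, -, hφs, hφ, hφd⟩ := hY.exists_reparametrization hZ h
  constructor
  · rw [← logIntegral_comp (Y := Y) hφs ψ]; simp only [hφ]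
  · rw [← logIntegral_comp (Y := dualPt Y) hφs ψ]; simp only [hφd]

end IsStrictlyConvexEmbedding

/-! ### Initial bounds and the conclusion -/

/-- The principal curvatures of a uniformly convex hypersurface are bounded below. -/
lemma IsUniformlyConvexEmbedding.exists_curvatureBound {Y : Sph d → Euc d}
    (hY : IsUniformlyConvexEmbedding Y) : ∃ c > 0, CurvatureBound Y c := by
  have hY' := hY.toIsStrictlyConvexEmbedding
  set S : Set (Sph d × Sph d) := {z | ⟪(z.1 : Euc d), (z.2 : Euc d)⟫ = 0} with hS
  have hSc : IsCompact S :=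
    (isClosed_eq (by fun_prop) continuous_const).isCompact
  have cv : Continuous fun z : Sph d × Sph d => fderiv ℝ (radialExt Y) (z.1 : Euc d) z.2 := by
    have h1 : Continuous fun z : Sph d × Sph d => fderiv ℝ (radialExt Y) (z.1 : Euc d) :=
      ((contDiffOn_radialExt hY'.smooth).continuousOn_fderiv_of_isOpen isOpen_compl_singleton
        (by simp)).comp_continuous (by fun_prop) fun z => sph_ne_zero z.1
    exact h1.clm_apply (by fun_prop)
  have cw : Continuous fun z : Sph d × Sph d =>
      fderiv ℝ (radialExt (dualPt Y)) (z.1 : Euc d) z.2 := by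
    have h0 : ContDiffOn ℝ ∞ (radialExt (dualPt Y)) {0}ᶜ := fun y hy =>
      (hY'.contDiffAt_radialExt_dualPt hy).contDiffWithinAt
    have h1 : Continuous fun z : Sph d × Sph d => fderiv ℝ (radialExt (dualPt Y)) (z.1 : Euc d) :=
      (h0.continuousOn_fderiv_of_isOpen isOpen_compl_singleton
        (by simp)).comp_continuous (by fun_prop) fun z => sph_ne_zero z.1
    exact h1.clm_apply (by fun_prop)
  have ch : Continuous fun z : Sph d × Sph d => ⟪Y z.1, (gaussMap Y z.1 : Euc d)⟫ := by
    have h1 : (fun z : Sph d × Sph d => ⟪Y z.1, (gaussMap Y z.1 : Euc d)⟫) =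
        fun z : Sph d × Sph d => ‖dualPt Y z.1‖⁻¹ := by
      funext z; rw [hY'.norm_dualPt, inv_inv]
    rw [h1]
    exact ((hY'.continuous_dualPt.comp continuous_fst).norm).inv₀
      fun z => norm_ne_zero_iff.2 (hY'.dualPt_ne_zero _)
  have hpos : ∀ z ∈ S, 0 < ‖fderiv ℝ (radialExt Y) (z.1 : Euc d) z.2‖ ^ 2 := by
    intro z hz
    have : 0 < ‖fderiv ℝ (radialExt Y) (z.1 : Euc d) z.2‖ := norm_pos_iff.2 fun h0 =>
      sph_ne_zero z.2 (hY'.fderiv_eq_zero hz h0)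
    positivity
  set q : Sph d × Sph d → ℝ := fun z => ⟪Y z.1, (gaussMap Y z.1 : Euc d)⟫ *
      ⟪fderiv ℝ (radialExt (dualPt Y)) (z.1 : Euc d) z.2,
        fderiv ℝ (radialExt Y) (z.1 : Euc d) z.2⟫ with hq
  have cq : Continuous q := ch.mul (cw.inner cv)
  have hqpos : ∀ z ∈ S, 0 < q z := by
    intro z hz
    obtain ⟨κ, hκ, hle⟩ := hY'.exists_isPrincipalCurvature_le z.1 hz (sph_ne_zero z.2)
    exact (mul_pos (hY.curvature_pos _ _ hκ) (hpos z hz)).trans_le hle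
  have key : ∃ c > 0, ∀ z ∈ S, c * ‖fderiv ℝ (radialExt Y) (z.1 : Euc d) z.2‖ ^ 2 ≤ q z := by
    -- There are no unit tangent vectors when d = 0, and any constant then serves.
    by_cases hne : S.Nonempty
    · obtain ⟨z₀, hz₀, hmin⟩ := hSc.exists_isMinOn hne
        (cq.continuousOn.div (cv.norm.pow 2).continuousOn fun z hz => (hpos z hz).ne')
      refine ⟨_, div_pos (hqpos z₀ hz₀) (hpos z₀ hz₀), fun z hz => ?_⟩
      rw [← le_div_iff₀ (hpos z hz)]
      exact hmin hz
    · exact ⟨1, one_pos, fun z hz => absurd ⟨z, hz⟩ hne⟩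
  obtain ⟨c, hc, hle⟩ := key
  refine ⟨c, hc, fun x w hw => ?_⟩
  by_cases hw0 : w = 0
  · simp [hw0]
  have h1 := hle (x, direction w) (by
    change ⟪(x : Euc d), (direction w : Euc d)⟫ = 0
    rw [coe_direction hw0, inner_smul_right, hw, mul_zero])
  rw [← norm_smul_direction hw0]
  simp only [hq] at h1
  simp only [map_smul, norm_smul, norm_norm, real_inner_smul_left, inner_smul_right, mul_pow]
  have h3 := mul_le_mul_of_nonneg_left h1 (sq_nonneg ‖w‖)
  linarith

/-- Bounds for the support function in terms of the two logarithmic integrals. -/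
lemma AleksandrovRelated.exists_supportFn_bound {f g : Sph d → ℝ}
    (hfg : AleksandrovRelated f g) (hf : Continuous f) (hg : Continuous g) (hf0 : ∀ x, 0 < f x)
    (hg0 : ∀ x, 0 < g x) (A B : ℝ) :
    ∃ C₀ : ℝ, 0 < C₀ ∧ ∀ Y : Sph d → Euc d, IsStrictlyConvexEmbedding Y →
      logIntegral f Y ≤ A → logIntegral g (dualPt Y) = B →
      ∀ x, 1 / C₀ ≤ supportFn (range Y) x ∧ supportFn (range Y) x ≤ C₀ := by
  obtain ⟨C₀, hC₀, hC⟩ := hfg.exists_support_bound hf hg hf0 hg0 (A + B) |B|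
  refine ⟨C₀, hC₀, fun Y hY hA hB x => ?_⟩
  have hcont := hY.continuous
  have hr : ∀ z, (supExt (dualPt Y) (direction (Y z) : Euc d))⁻¹ = ‖Y z‖ := fun z => by
    rw [hY.supExt_dualPt_direction, inv_inv]
  have hlog : ∫ x, g x * Real.log (supExt (dualPt Y) (x : Euc d))⁻¹ ∂(sphMeasure d) = -B := by
    rw [← hB, logIntegral, ← integral_neg]
    simp only [Real.log_inv, mul_neg]
  have hres := hC (fun x => supExt Y (x : Euc d)) (fun x => (supExt (dualPt Y) (x : Euc d))⁻¹)
    (continuous_supExt_coe hcont)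
    ((continuous_supExt_coe hY.continuous_dualPt).inv₀ fun x => (hY.supExt_dualPt_pos x).ne')
    hY.supExt_pos (fun x => inv_pos.2 (hY.supExt_dualPt_pos x)) ?_ ?_ ?_ ?_ ?_ x
  · rwa [supportFn_eq_supExt]
  · intro x ξ
    obtain ⟨z, rfl⟩ := hY.exists_direction_eq ξ
    rw [hr, mul_comm, ← inner_smul_right, norm_smul_direction (hY.ne_zero z), real_inner_comm]
    exact le_supExt hcont _ z
  · obtain ⟨z, -, hz⟩ := isCompact_univ.exists_isMaxOn (univ_nonempty (α := Sph d))
      (f := fun z => ‖Y z‖) hcont.norm.continuousOn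
    refine ⟨direction (Y z), fun x => ?_⟩
    simp only [hr]
    obtain ⟨y, hy⟩ := exists_supExt_eq hcont (x : Euc d)
    rw [hy]
    refine (real_inner_le_norm _ _).trans ?_
    rw [norm_sph, mul_one]
    exact hz (mem_univ y)
  -- The minimum of the support function is at most its value at the normal of any point, which is
  -- at most the distance of that point from the origin.
  · obtain ⟨x₀, -, hx₀⟩ := isCompact_univ.exists_isMinOn (univ_nonempty (α := Sph d))
      (continuous_supExt_coe hcont).continuousOn
    refine ⟨x₀, fun ξ => ?_⟩
    obtain ⟨z, rfl⟩ := hY.exists_direction_eq ξ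
    simp only [hr]
    refine (hx₀ (mem_univ (gaussMap Y z))).trans ?_
    simp only [← supportFn_eq_supExt, hY.supportFn_gaussMap]
    refine (real_inner_le_norm _ _).trans ?_
    rw [norm_sph, mul_one]
  · simp only [hlog]
    change logIntegral f Y - -B ≤ A + B
    linarith
  · simp only [hlog, abs_neg, le_refl]

end GaussFlow

end

theorem lemma4p3 (d : ℕ) (hd : 1 ≤ d) (f g : GaussFlow.Sph d → ℝ)
    (hf : ContMDiff (𝓡 d) 𝓘(ℝ, ℝ) ∞ f) (hf_pos : ∀ x, 0 < f x)
    (hg : ContMDiff (𝓡 d) 𝓘(ℝ, ℝ) ∞ g) (hg_pos : ∀ x, 0 < g x) :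
    -- uniform lower bound, with a constant depending only on the initial hypersurface, `f`, `g`
    (GaussFlow.AleksandrovRelated f g →
      ∀ M₀ : Set (GaussFlow.Euc d), ∃ C : ℝ, 0 < C ∧
        ∀ X₀ : GaussFlow.Sph d → GaussFlow.Euc d,
          GaussFlow.IsUniformlyConvexEmbedding X₀ → range X₀ = M₀ →
          ∀ (T : EReal) (X : GaussFlow.Sph d → ℝ → GaussFlow.Euc d),
            GaussFlow.IsConvexSolution f g X₀ T X →
              ∀ x, ∀ t ∈ GaussFlow.timeInterval T, ∀ κ : ℝ,
                GaussFlow.IsPrincipalCurvature (fun z => X z t) x κ → C ≤ κ) ∧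
    -- the constant depends on the solution only through the bounds of the support function
    -- and the initial curvature
    (∀ C₀ κ₀ : ℝ, 0 < C₀ → 0 < κ₀ →
      ∃ C : ℝ, 0 < C ∧ ∀ X₀ : GaussFlow.Sph d → GaussFlow.Euc d,
        GaussFlow.IsUniformlyConvexEmbedding X₀ →
        (∀ x κ, GaussFlow.IsPrincipalCurvature X₀ x κ → κ₀ ≤ κ) →
        ∀ (T : EReal) (X : GaussFlow.Sph d → ℝ → GaussFlow.Euc d),
          GaussFlow.IsConvexSolution f g X₀ T X →
          (∀ x, ∀ t ∈ GaussFlow.timeInterval T,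
            1 / C₀ ≤ GaussFlow.supportFn (range fun z => X z t) x ∧
              GaussFlow.supportFn (range fun z => X z t) x ≤ C₀) →
            ∀ x, ∀ t ∈ GaussFlow.timeInterval T, ∀ κ : ℝ,
              GaussFlow.IsPrincipalCurvature (fun z => X z t) x κ → C ≤ κ) := by
  refine ⟨?_, ?_⟩
  · intro hfg M₀
    -- A reference parametrization `Z` of the given image is fixed before any solution, and all
    -- constants are read off from it. If there is none, the claim is empty.
    by_cases hM : ∃ Z : GaussFlow.Sph d → GaussFlow.Euc d,
        GaussFlow.IsUniformlyConvexEmbedding Z ∧ range Z = M₀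
    · obtain ⟨Z, hZ, hZM⟩ := hM
      obtain ⟨κ₀, hκ₀, hini⟩ := hZ.exists_curvatureBound
      obtain ⟨C₀, hC₀, hC⟩ := hfg.exists_supportFn_bound hf.continuous hg.continuous hf_pos hg_pos
        (GaussFlow.logIntegral f Z) (GaussFlow.logIntegral g (GaussFlow.dualPt Z))
      obtain ⟨c, hc, hest⟩ := GaussFlow.exists_curvatureBound f g hf hf_pos hg hg_pos hC₀ hκ₀
      refine ⟨c, hc, fun X₀ hX₀ hXM T X hX x t ht κ hκ => ?_⟩
      have hZ' := hZ.toIsStrictlyConvexEmbedding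
      have hX₀' := hX₀.toIsStrictlyConvexEmbedding
      have hrange : range X₀ = range Z := hXM.trans hZM.symm
      refine (hX.convex t ht).le_of_curvatureBound (hest X₀ T X hX
        (hZ'.curvatureBound_of_range_eq hX₀' hrange hini) (fun s hs hb => ?_) t ht) hκ
      -- The logarithmic integrals of the evolving hypersurface are compared with those of `X₀`,
      -- which agree with those of `Z` because they depend only on the image.
      obtain ⟨h1, h2⟩ := hX.logIntegral_le hf.continuous hg.continuous hg_pos hfg.1 hs hb
      refine hC _ (hX.convex s hs) (h2.trans_eq ?_) (h1.trans ?_)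
      · exact (hZ'.logIntegral_eq_of_range_eq hX₀' hrange f).1
      · exact (hZ'.logIntegral_eq_of_range_eq hX₀' hrange g).2
    · exact ⟨1, one_pos, fun X₀ hX₀ hXM => absurd ⟨X₀, hX₀, hXM⟩ hM⟩
  · intro C₀ κ₀ hC₀ hκ₀
    obtain ⟨c, hc, hest⟩ := GaussFlow.exists_curvatureBound f g hf hf_pos hg hg_pos hC₀ hκ₀
    refine ⟨c, hc, fun X₀ hX₀ hini T X hX hC x t ht κ hκ => ?_⟩
    exact (hX.convex t ht).le_of_curvatureBound
      (hest X₀ T X hX (hX₀.curvatureBound_of_forall hini)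
        (fun t ht _ x => hC x t ht) t ht) hκ
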